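/- **Theorem 2.2.** Let $\kappa$ be an infinite cardinal. The following are equivalent: (a) $\kappa=\mathrm{wcn}(\mathcal L^{\mathrm{II}}_{\kappa,\omega})$; (b) $\kappa=\mathrm{wcn}(\mathcal L^{\mathrm{HO}}_{\kappa,\kappa})$; (c) $\kappa$ is weakly extendible. Here the following terminology is used. *Logics.* Structures are nonempty first-order structures. In $\mathcal L^{\mathrm{HO}}$ there are variables of every sort $i<\omega$, those of sort $0$ (first-order variables) ranging over the underlying set $A$ and those of sort $i$ over the full $i$-fold iterated power set $\mathcal P^i(A)$; besides the usual first-order atomic formulas there are atomic formulas $t\,\varepsilon\,X$ ($t$ a first-order term, $X$ of sort $1$) and $X\,\varepsilon\,Y$ ($X$ of sort $i$, $Y$ of sort $i+1$, $i\ge 1$), interpreted by true membership. $\mathcal L^{\mathrm{II}}$ is (full, monadic) second-order logic, where only the sorts $0$ and $1$ are used. For infinite cardinals $\lambda\le\kappa$, the formulas of $\mathcal L^{\mathrm{II}}_{\kappa,\lambda}$ and $\mathcal L^{\mathrm{HO}}_{\kappa,\lambda}$ are built (from $\kappa$ many variables of each sort) by negation, by conjunctions $\bigwedge\Phi$ and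 disjunctions $\bigvee\Phi$ of sets $\Phi$ of fewer than $\kappa$ formulas having altogether fewer than $\lambda$ free variables, and by existential and universal quantification over blocks of fewer than $\lambda$ variables. *Weak compactness number.* A theory is a set of sentences; it is $<\mu$-satisfiable if each of its subsets of size $<\mu$ has a model. For a logic $\mathcal L$, $\mathrm{wcn}(\mathcal L)$ is the least uncountable cardinal $\mu$ such that every $<\mu$-satisfiable $\mathcal L$-theory in a signature with at most $\mu$ non-logical symbols has a model, and $\mathrm{wcn}(\mathcal L)=\infty$ if there is no such $\mu$. *Weakly extendible.* $\kappa$ is weakly extendible if $2^{<\kappa}=\kappa$ and, for every ordinal $\theta>\kappa$ and every $M\prec V_\theta$ with $\kappa+1\subseteq M$ and $|M|=\kappa$, there are an ordinal $\bar\theta$ with $\kappa+1\subseteq V_{\bar\theta}$ and a first-order elementary embedding $j:\langle M,\in\rangle\to\langle V_{\bar\theta},\in\rangle$ with $j\restriction\kappa=\mathrm{id}_\kappa$ and $j(\kappa)>\kappa$. -/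

import Mathlib

open Cardinal FirstOrder
open scoped ZFSet

universe u

/-! ### Infinitary higher-order formulas

All logics below share one syntax.  A variable is a pair `(i, x) : ℕ × V`; it is a variable of
sort `i`.  Variables of sort `0` are the individual (first-order) variables and range over the
underlying set `A` of a structure, variables of sort `1` (second-order) range over all subsets of
`A`, and in general variables of sort `i` range over the `i`-fold iterated power set of `A`. -/

/-- The `i`-fold iterated power set of `A`: the range of the variables of sort `i`. -/
def IterPow (A : Type u) : ℕ → Type u
  | 0 => A
  | i + 1 => Set (IterPow A i)

/-- Raw infinitary higher-order formulas over the signature `L`.  Conjunctions and disjunctions are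
taken over families indexed by subsets of `V`, and quantifiers bind an arbitrary set (a block)
of variables; the size restrictions are imposed by `HOForm.IsFormula`. -/
inductive HOForm (L : FirstOrder.Language.{u, u}) (V : Type u) : Type u
  /-- equality of two terms -/
  | eq (t s : L.Term V) : HOForm L V
  /-- a relation symbol applied to terms -/
  | rel {n : ℕ} (R : L.Relations n) (ts : Fin n → L.Term V) : HOForm L V
  /-- `t ε X`, with `X` the variable `(1, X)` of sort `1` -/
  | memTerm (t : L.Term V) (X : V) : HOForm L V
  /-- `X ε Y`, with `X` the variable `(i + 1, X)` and `Y` the variable `(i + 2, Y)` -/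
  | memVar (i : ℕ) (X Y : V) : HOForm L V
  | neg (φ : HOForm L V) : HOForm L V
  | conj (I : Set V) (φ : I → HOForm L V) : HOForm L V
  | disj (I : Set V) (φ : I → HOForm L V) : HOForm L V
  | ex (B : Set (ℕ × V)) (φ : HOForm L V) : HOForm L V
  | all (B : Set (ℕ × V)) (φ : HOForm L V) : HOForm L V

/-- The set of variables (of sort `0`) occurring in a term. -/
def termVars {L : FirstOrder.Language.{u, u}} {V : Type u} : L.Term V → Set (ℕ × V)
  | .var x => {(0, x)}
  | .func _ ts => ⋃ k, termVars (ts k)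

namespace HOForm

variable {L : FirstOrder.Language.{u, u}} {V : Type u}

/-- The set of free variables, of all sorts. -/
def freeVars : HOForm L V → Set (ℕ × V)
  | eq t s => termVars t ∪ termVars s
  | rel _ ts => ⋃ k, termVars (ts k)
  | memTerm t X => termVars t ∪ {(1, X)}
  | memVar i X Y => {(i + 1, X), (i + 2, Y)}
  | neg φ => φ.freeVars
  | conj _ φ => ⋃ k, (φ k).freeVars
  | disj _ φ => ⋃ k, (φ k).freeVars
  | ex B φ => φ.freeVars \ B
  | all B φ => φ.freeVars \ B

/-- `φ.IsFormula N κ lam`: only variables of sorts `< N` are used, conjunctions and disjunctions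
are over sets of fewer than `κ` formulas having together fewer than `lam` free variables,
and blocks of quantifiers have fewer than `lam` variables. -/
def IsFormula (N : ℕ∞) (κ lam : Cardinal.{u}) : HOForm L V → Prop
  | eq _ _ => True
  | rel _ _ => True
  | memTerm _ _ => 1 < N
  | memVar i _ _ => ((i + 2 : ℕ) : ℕ∞) < N
  | neg φ => φ.IsFormula N κ lam
  | conj I φ => #I < κ ∧ #(⋃ k, (φ k).freeVars : Set (ℕ × V)) < lam ∧
      ∀ k, (φ k).IsFormula N κ lam
  | disj I φ => #I < κ ∧ #(⋃ k, (φ k).freeVars : Set (ℕ × V)) < lam ∧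
      ∀ k, (φ k).IsFormula N κ lam
  | ex B φ => #B < lam ∧ (∀ p ∈ B, (p.1 : ℕ∞) < N) ∧ φ.IsFormula N κ lam
  | all B φ => #B < lam ∧ (∀ p ∈ B, (p.1 : ℕ∞) < N) ∧ φ.IsFormula N κ lam

/-- Satisfaction of a formula in the structure `A` under the assignment `v` (full semantics). -/
def Realize (A : Type u) [L.Structure A] :
    HOForm L V → (∀ p : ℕ × V, IterPow A p.1) → Prop
  | eq t s, v =>
      t.realize (M := A) (fun x => v (0, x)) = s.realize (M := A) (fun x => v (0, x))
  | rel R ts, v =>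
      FirstOrder.Language.Structure.RelMap R (fun k => (ts k).realize (M := A) (fun x => v (0, x)))
  | memTerm t X, v =>
      t.realize (M := A) (fun x => v (0, x)) ∈ (show Set A from v (1, X))
  | memVar i X Y, v =>
      (show IterPow A (i + 1) from v (i + 1, X)) ∈
        (show Set (IterPow A (i + 1)) from v (i + 2, Y))
  | neg φ, v => ¬ φ.Realize A v
  | conj _ φ, v => ∀ k, (φ k).Realize A v
  | disj _ φ, v => ∃ k, (φ k).Realize A v
  | ex B φ, v => ∃ w : ∀ p : ℕ × V, IterPow A p.1, (∀ p, p ∉ B → w p = v p) ∧ φ.Realize A w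
  | all B φ, v => ∀ w : ∀ p : ℕ × V, IterPow A p.1, (∀ p, p ∉ B → w p = v p) → φ.Realize A w

end HOForm

/-- The raw formulas from which `L_{κ, lam}` and its higher-order versions are built: there are
`κ` variables of each sort. -/
abbrev RawForm (L : FirstOrder.Language.{u, u}) (κ : Cardinal.{u}) : Type u := HOForm L κ.out

/-- `φ` is a sentence of the `(κ, lam)`-infinitary logic with variables of the sorts `< N`. -/
def IsSentenceOf {L : FirstOrder.Language.{u, u}} (N : ℕ∞) (κ lam : Cardinal.{u}) (φ : RawForm L κ) : Prop :=
  φ.IsFormula N κ lam ∧ φ.freeVars = ∅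

/-- `T` has a model (with a nonempty underlying set).  For sentences the truth value does not depend
on the assignment. -/
def IsSatisfiableTheory {L : FirstOrder.Language.{u, u}} {κ : Cardinal.{u}} (T : Set (RawForm L κ)) : Prop :=
  ∃ (A : Type u) (_ : L.Structure A) (_ : Nonempty A), ∀ φ ∈ T, ∀ v, φ.Realize A v

/-- `T` is `< μ`-satisfiable. -/
def IsLTSatisfiable {L : FirstOrder.Language.{u, u}} {κ : Cardinal.{u}} (μ : Cardinal.{u})
    (T : Set (RawForm L κ)) : Prop :=
  ∀ T₀ ⊆ T, #T₀ < μ → IsSatisfiableTheory T₀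

/-- The weak compactness spectrum of the `(κ, lam)`-infinitary logic with variables of the
sorts `< N`. -/
def WCS (N : ℕ∞) (κ lam : Cardinal.{u}) : Set Cardinal.{u} :=
  {μ | ℵ₀ < μ ∧ ∀ L : FirstOrder.Language.{u, u}, L.card ≤ μ → ∀ T : Set (RawForm L κ),
    (∀ φ ∈ T, IsSentenceOf N κ lam φ) → IsLTSatisfiable μ T → IsSatisfiableTheory T}

/-- The weak compactness number: the minimum of the weak compactness spectrum, or `⊤`
(i.e. `∞`) if the spectrum is empty. -/
noncomputable def wcn (N : ℕ∞) (κ lam : Cardinal.{u}) : WithTop Cardinal.{u} :=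
  sInf ((fun μ : Cardinal.{u} => (μ : WithTop Cardinal.{u})) '' WCS N κ lam)

/-- The weak compactness number of the monadic second-order logic `L^II_{κ, lam}`
(variables of the two sorts `0` and `1`). -/
noncomputable def wcnII (κ lam : Cardinal.{u}) : WithTop Cardinal.{u} := wcn 2 κ lam

/-- The weak compactness number of the higher-order logic `L^HO_{κ, lam}`
(variables of all finite sorts). -/
noncomputable def wcnHO (κ lam : Cardinal.{u}) : WithTop Cardinal.{u} := wcn ⊤ κ lam

theorem coe_eq_wcn_iff {μ : Cardinal.{u}} {N : ℕ∞} {κ lam : Cardinal.{u}} :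
    (μ : WithTop Cardinal.{u}) = wcn N κ lam ↔ IsLeast (WCS N κ lam) μ := by
  have key : ∀ m, IsLeast (WCS N κ lam) m → wcn N κ lam = (m : WithTop Cardinal.{u}) := by
    intro m hm
    apply IsLeast.csInf_eq
    refine ⟨⟨m, hm.1, rfl⟩, ?_⟩
    rintro _ ⟨n, hn, rfl⟩
    exact WithTop.coe_le_coe.2 (hm.2 hn)
  constructor
  · intro h
    rcases (WCS N κ lam).eq_empty_or_nonempty with he | hne
    · rw [wcn, he, Set.image_empty, WithTop.sInf_empty] at h
      exact absurd h WithTop.coe_ne_top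
    · have hl : IsLeast (WCS N κ lam) (sInf (WCS N κ lam)) :=
        ⟨csInf_mem hne, fun n hn => csInf_le' hn⟩
      rw [key _ hl] at h
      rwa [WithTop.coe_injective h]
  · exact fun h => (key μ h).symm

/-! ### Weakly extendible cardinals

The universe of sets is `ZFSet.{u}`, and `V_ θ` is the `θ`-th level of the von Neumann hierarchy. -/

/-- The only symbol of the language of set theory: a binary relation symbol. -/
inductive EpsRel : ℕ → Type
  | mem : EpsRel 2

/-- The first-order language of set theory. -/
def setLang : FirstOrder.Language.{0, 0} := ⟨fun _ => Empty, EpsRel⟩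

/-- A set `M`, as a structure with its true membership relation. -/
instance setStructure (M : ZFSet.{u}) : setLang.Structure M where
  funMap f _ := nomatch f
  RelMap {_} r v := match r, v with
    | EpsRel.mem, v => (v 0 : ZFSet.{u}) ∈ (v 1 : ZFSet.{u})

/-- `M ≺ N`: `M` is an elementary substructure of `N` with respect to first-order formulas in the
language of set theory. -/
def IsElemSub (M N : ZFSet.{u}) : Prop :=
  ∃ i : M ↪ₑ[setLang] N, ∀ x : M, (i x : ZFSet.{u}) = x

/-- The cardinal `κ` as a set, i.e. as a von Neumann ordinal. -/
noncomputable def cardSet (κ : Cardinal.{u}) : ZFSet.{u} := κ.ord.toZFSet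

/-- `κ + 1 ⊆ M, N`, and `j : M → N` is an elementary embedding which is the identity below `κ` and
satisfies `j(κ) > κ`. -/
def IsEmbeddingAt (κ : Cardinal.{u}) {M N : ZFSet.{u}} (j : M ↪ₑ[setLang] N) : Prop :=
  (κ.ord + 1).toZFSet ⊆ M ∧ (κ.ord + 1).toZFSet ⊆ N ∧
  (∀ x : M, (x : ZFSet.{u}) ∈ cardSet κ → (j x : ZFSet.{u}) = x) ∧
  (∀ x : M, (x : ZFSet.{u}) = cardSet κ → cardSet κ ∈ (j x : ZFSet.{u}))

/-- `κ` is weakly extendible: `κ = 2^{<κ}`, and for every ordinal `θ > κ` and every `M ≺ V_θ` with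
`κ + 1 ⊆ M` and `|M| = κ` there are `θ'` and `j : M → V_θ'` with critical point `κ`. -/
def IsWeaklyExtendible (κ : Cardinal.{u}) : Prop :=
  κ = 2 ^< κ ∧
  ∀ (θ : Ordinal.{u}) (M : ZFSet.{u}), κ.ord < θ → IsElemSub M (V_ θ) →
    (κ.ord + 1).toZFSet ⊆ M → M.card = κ →
    ∃ (θ' : Ordinal.{u}) (j : M ↪ₑ[setLang] V_ θ'), IsEmbeddingAt κ j

/-!
The weak compactness spectrum of each of the logics considered has no member below `κ`
(`le_of_mem_WCS`: a disjunction of fewer than `κ` atoms, together with the negations of all of them,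
is a counterexample), so that `κ` is the weak compactness number as soon as it belongs to the spectrum.
The implication from `L^HO_{κ, κ}` to `L^II_{κ, ω}` is then immediate, and two implications remain.

*From weak compactness of `L^II_{κ, ω}` to weak extendibility.*  Simple propositional theories show
that `κ` is regular and that `2 ^ c < κ` for `c < κ`.  Given `M ≺ V_ θ`, take the elementary diagram of
`M`, the second-order sentences that characterize the levels `V_ θ'` up to isomorphism
(`exists_equiv_vonNeumann`), for each ordinal `a < κ` the infinitary sentence saying that `a` has no
further elements, and the sentences placing a new constant above all `a < κ` but below `κ`.  Fewer than
`κ` of these sentences hold in `V_ θ`, and the collapse of a model of the whole theory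
is a level `V_ θ'` into which `M` embeds elementarily, fixing the ordinals below `κ` and moving `κ`
(`exists_embedding_of_mem_WCS`).

*From weak extendibility to weak compactness of `L^HO_{κ, κ}`.*  First, `κ` is an uncountable regular
cardinal with `κ ^ c ≤ κ` for `c < κ`, and therefore has only `κ` many formulas, which can be numbered
by ordinals below `κ`.  Given a `< κ`-satisfiable theory `T`, choose for each `a < κ` a model `A a` of
the sentences of `T` with numbers below `a`.  The sequence of these models, with the iterated power
sets, the evaluation of terms and the satisfaction relation, is coded by at most `κ` sets, which belong
to the domain of an embedding `J` with critical point `κ` (`IsWeaklyExtendible.exists_reflection`).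
Every first-order property common to all indices `a < κ` passes on to the index `κ < J κ` of the image
of the sequence (`Reflection.transfer_card`).  This yields a structure with index `κ` for which the
coded iterated power sets are still the full ones (`ModelSeq.IsImage.mem_map_Q`), because the levels
`V_ θ'` are closed under subsets of their elements, and for which the image of the satisfaction relation
is true satisfaction (`ModelSeq.IsImage.mem_map_S_iff`), because the embedding fixes the numbers
of the formulas and the subsets of `κ` of size less than `κ`.  As every sentence of `T` has a number
below `κ`, this structure is a model of `T`.

In place of the assignments themselves, which involve `κ × ω` many variables of all sorts, the coded
relations mention subsets `v` of a fixed set `Y`; the value of a variable under `v` is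
read off from a section of `v` (`IsCoding`).  Functions from assignments to values are given by their
graphs, and the symbols of the signature are interpreted at the index `κ` through the values of the
terms `f x₀ … xₙ₋₁` and the truth values of the formulas `R x₀ … xₙ₋₁`.
-/

/-! ### Predicates definable over the levels of the von Neumann hierarchy -/

/-- The membership symbol of the language of set theory. -/
def memSymb : setLang.Relations 2 := EpsRel.mem

theorem card_setLang_le : setLang.card ≤ ℵ₀ := by
  have : Countable setLang.Symbols := by
    refine Function.Injective.countable (f := fun _ : setLang.Symbols => ()) ?_
    rintro (⟨_, ⟨⟩⟩ | ⟨_, ⟨⟩⟩) (⟨_, ⟨⟩⟩ | ⟨_, ⟨⟩⟩) _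
    rfl
  exact Cardinal.mk_le_aleph0

/-- A predicate `P N v` of a level `N = V_ θ` and of an assignment `v` of parameters is definable if
one formula of the language of set theory expresses it over all levels `V_ θ` simultaneously. -/
def SetDef {α : Type} (P : ZFSet.{u} → (α → ZFSet.{u}) → Prop) : Prop :=
  ∃ φ : setLang.Formula α, ∀ (θ : Ordinal.{u}) (v : α → V_ θ),
    φ.Realize v ↔ P (V_ θ) (fun a => v a)

namespace SetDef

variable {α : Type}

theorem mem (a b : α) : SetDef.{u} fun _ v => v a ∈ v b := by
  refine ⟨Language.Relations.formula₂ memSymb (Language.Term.var a)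
    (Language.Term.var b), fun θ v => ?_⟩
  rw [Language.Formula.realize_rel₂]
  exact Iff.rfl

theorem eq (a b : α) : SetDef.{u} fun _ v => v a = v b := by
  refine ⟨Language.Term.equal (L := setLang) (Language.Term.var a) (Language.Term.var b),
    fun θ v => ?_⟩
  rw [Language.Formula.realize_equal]
  exact Subtype.ext_iff

variable {P Q : ZFSet.{u} → (α → ZFSet.{u}) → Prop}

theorem not (hP : SetDef P) : SetDef fun N v => ¬ P N v := by
  obtain ⟨φ, hφ⟩ := hP
  exact ⟨φ.not, fun θ v => by rw [Language.Formula.realize_not, hφ]⟩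

theorem imp (hP : SetDef P) (hQ : SetDef Q) : SetDef fun N v => P N v → Q N v := by
  obtain ⟨φ, hφ⟩ := hP
  obtain ⟨ψ, hψ⟩ := hQ
  exact ⟨φ.imp ψ, fun θ v => by rw [Language.Formula.realize_imp, hφ, hψ]⟩

theorem and (hP : SetDef P) (hQ : SetDef Q) : SetDef fun N v => P N v ∧ Q N v := by
  obtain ⟨φ, hφ⟩ := hP
  obtain ⟨ψ, hψ⟩ := hQ
  exact ⟨φ ⊓ ψ, fun θ v => by rw [Language.Formula.realize_inf, hφ, hψ]⟩

theorem or (hP : SetDef P) (hQ : SetDef Q) : SetDef fun N v => P N v ∨ Q N v := by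
  obtain ⟨φ, hφ⟩ := hP
  obtain ⟨ψ, hψ⟩ := hQ
  exact ⟨φ ⊔ ψ, fun θ v => by rw [Language.Formula.realize_sup, hφ, hψ]⟩

theorem iff (hP : SetDef P) (hQ : SetDef Q) : SetDef fun N v => (P N v ↔ Q N v) := by
  obtain ⟨φ, hφ⟩ := hP
  obtain ⟨ψ, hψ⟩ := hQ
  exact ⟨φ.iff ψ, fun θ v => by rw [Language.Formula.realize_iff, hφ, hψ]⟩

theorem all {P : ZFSet.{u} → (α → ZFSet.{u}) → ZFSet.{u} → Prop}
    (h : SetDef (α := Option α) fun N v => P N (fun a => v (some a)) (v none)) :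
    SetDef fun N v => ∀ x ∈ N, P N v x := by
  obtain ⟨φ, hφ⟩ := h
  let e : Option α → α ⊕ Unit := fun o => o.elim (Sum.inr ()) Sum.inl
  refine ⟨Language.Formula.iAlls (β := Unit) (φ.relabel e), fun θ v => ?_⟩
  rw [Language.Formula.realize_iAlls]
  simp only [Language.Formula.realize_relabel]
  constructor
  · intro H x hx
    exact (hφ θ _).1 (H fun _ => ⟨x, hx⟩)
  · intro H i
    exact (hφ θ _).2 (H _ (i ()).2)

theorem ex {P : ZFSet.{u} → (α → ZFSet.{u}) → ZFSet.{u} → Prop}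
    (h : SetDef (α := Option α) fun N v => P N (fun a => v (some a)) (v none)) :
    SetDef fun N v => ∃ x ∈ N, P N v x := by
  have := (all (P := fun N v x => ¬ P N v x) h.not).not
  simpa only [not_forall, not_not, exists_prop] using this

theorem forallFin {n : ℕ} {P : Fin n → ZFSet.{u} → (α → ZFSet.{u}) → Prop}
    (h : ∀ k, SetDef (P k)) : SetDef fun N v => ∀ k, P k N v := by
  choose φ hφ using h
  refine ⟨Language.Formula.iInf φ, fun θ v => ?_⟩
  rw [Language.Formula.realize_iInf]
  exact forall_congr' fun k => hφ k θ v

theorem congr (hP : SetDef P) (h : ∀ θ : Ordinal.{u}, ∀ v : α → ZFSet.{u}, (∀ a, v a ∈ V_ θ) →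
    (Q (V_ θ) v ↔ P (V_ θ) v)) : SetDef Q := by
  obtain ⟨φ, hφ⟩ := hP
  exact ⟨φ, fun θ v => by rw [hφ, h θ _ fun a => (v a).2]⟩

theorem mem_level_of_mem {θ : Ordinal.{u}} {x y : ZFSet.{u}} (h : x ∈ y) (hy : y ∈ V_ θ) :
    x ∈ V_ θ :=
  (ZFSet.isTransitive_vonNeumann θ).subset_of_mem hy h

theorem subset (a b : α) : SetDef.{u} fun _ v => v a ⊆ v b := by
  refine congr (P := fun N v => ∀ x ∈ N, x ∈ v a → x ∈ v b)
    (all (imp (mem _ _) (mem _ _))) fun θ v hv => ?_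
  exact ⟨fun h x _ hx => h hx, fun h x hx => h x (mem_level_of_mem hx (hv a)) hx⟩

theorem eqEmpty (a : α) : SetDef.{u} fun _ v => v a = ∅ := by
  refine congr (P := fun N v => ∀ x ∈ N, ¬ x ∈ v a) (all (not (mem _ _))) fun θ v hv => ?_
  rw [ZFSet.eq_empty]
  exact ⟨fun h x _ => h x, fun h x hx => h x (mem_level_of_mem hx (hv a)) hx⟩

theorem eqUpair (a b c : α) : SetDef.{u} fun _ v => v a = {v b, v c} := by
  refine congr (P := fun N v => ∀ x ∈ N, x ∈ v a ↔ (x = v b ∨ x = v c))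
    (all (iff (mem _ _) (or (eq _ _) (eq _ _)))) fun θ v hv => ?_
  constructor
  · rintro h x -
    rw [h, ZFSet.mem_pair]
  · intro h
    ext x
    rw [ZFSet.mem_pair]
    refine ⟨fun hx => (h x (mem_level_of_mem hx (hv a))).1 hx, ?_⟩
    rintro (rfl | rfl)
    · exact (h _ (hv b)).2 (Or.inl rfl)
    · exact (h _ (hv c)).2 (Or.inr rfl)

theorem eqPair (a b c : α) : SetDef.{u} fun _ v => v a = ZFSet.pair (v b) (v c) := by
  refine congr (P := fun N v => ∃ s ∈ N, ∃ t ∈ N, s = {v b, v b} ∧ t = {v b, v c} ∧ v a = {s, t})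
    (ex (ex (and (eqUpair _ _ _) (and (eqUpair _ _ _) (eqUpair _ _ _))))) fun θ v hv => ?_
  constructor
  · intro h
    have hs : ({v b, v b} : ZFSet) ∈ v a := by
      rw [h, ZFSet.pair, ZFSet.pair_eq_singleton]; simp
    have ht : ({v b, v c} : ZFSet) ∈ v a := by rw [h, ZFSet.pair]; simp
    refine ⟨_, mem_level_of_mem hs (hv a), _, mem_level_of_mem ht (hv a), rfl, rfl, ?_⟩
    rw [h, ZFSet.pair, ZFSet.pair_eq_singleton (v b)]
  · rintro ⟨s, -, t, -, rfl, rfl, h⟩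
    rw [h, ZFSet.pair, ZFSet.pair_eq_singleton (v b)]

theorem snd_mem_level {θ : Ordinal.{u}} {x y : ZFSet.{u}} (h : ZFSet.pair x y ∈ V_ θ) :
    y ∈ V_ θ := by
  refine mem_level_of_mem (y := {x, y}) (by simp) (mem_level_of_mem ?_ h)
  simp [ZFSet.pair]

theorem fst_mem_level {θ : Ordinal.{u}} {x y : ZFSet.{u}} (h : ZFSet.pair x y ∈ V_ θ) :
    x ∈ V_ θ := by
  refine mem_level_of_mem (y := {x, y}) (by simp) (mem_level_of_mem ?_ h)
  simp [ZFSet.pair]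

theorem pairMem (a b c : α) : SetDef.{u} fun _ v => ZFSet.pair (v a) (v b) ∈ v c := by
  refine congr (P := fun N v => ∃ z ∈ N, z = ZFSet.pair (v a) (v b) ∧ z ∈ v c)
    (ex (and (eqPair _ _ _) (mem _ _))) fun θ v hv => ?_
  constructor
  · intro h
    exact ⟨_, mem_level_of_mem h (hv c), rfl, h⟩
  · rintro ⟨_, -, rfl, h⟩
    exact h

theorem tripleMem (a b c d : α) :
    SetDef.{u} fun _ v => ZFSet.pair (v a) (ZFSet.pair (v b) (v c)) ∈ v d := by
  refine congr (P := fun N v => ∃ r ∈ N, r = ZFSet.pair (v b) (v c) ∧ ZFSet.pair (v a) r ∈ v d)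
    (ex (and (eqPair _ _ _) (pairMem _ _ _))) fun θ v hv => ?_
  constructor
  · intro h
    exact ⟨_, snd_mem_level (mem_level_of_mem h (hv d)), rfl, h⟩
  · rintro ⟨_, -, rfl, h⟩
    exact h

end SetDef

/-! ### Reflection -/

/-- `M ≺ V_ θ` contains `κ + 1`, and `J` restricts to an elementary embedding of `M` into `V_ θ'` with
critical point `κ`.  Elementarity is phrased for definable predicates of parameters in `M`; the
values of `J` outside `M` are irrelevant. -/
structure Reflection (κ : Cardinal.{u}) (θ θ' : Ordinal.{u}) (M : ZFSet.{u})
    (J : ZFSet.{u} → ZFSet.{u}) : Prop where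
  subset : M ⊆ V_ θ
  map_mem : ∀ x ∈ M, J x ∈ V_ θ'
  card_mem : cardSet κ ∈ M
  mem_of_lt : ∀ x ∈ cardSet κ, x ∈ M
  map_lt : ∀ x ∈ cardSet κ, J x = x
  lt_map : cardSet κ ∈ J (cardSet κ)
  transfer : ∀ {α : Type} {P : ZFSet.{u} → (α → ZFSet.{u}) → Prop}, SetDef P →
    ∀ v : α → ZFSet.{u}, (∀ a, v a ∈ M) → (P (V_ θ) v ↔ P (V_ θ') (fun a => J (v a)))

theorem mem_cardSet_succ {κ : Cardinal.{u}} {x : ZFSet.{u}} :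
    x ∈ (κ.ord + 1).toZFSet ↔ x = cardSet κ ∨ x ∈ cardSet κ := by
  rw [Ordinal.toZFSet_add_one, ZFSet.mem_insert_iff]; rfl

theorem card_toZFSet_succ (κ : Cardinal.{u}) (hκ : ℵ₀ ≤ κ) : (κ.ord + 1).toZFSet.card = κ := by
  rw [Ordinal.card_toZFSet]
  simp [Cardinal.add_one_eq hκ]

/-- The Löwenheim–Skolem argument: at most `κ` parameters can be put into the domain `M` of an
embedding supplied by weak extendibility, for a level `V_ θ` containing them all. -/
theorem IsWeaklyExtendible.exists_reflection {κ : Cardinal.{u}} (h : IsWeaklyExtendible κ)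
    (hκ : ℵ₀ ≤ κ) {ι : Type u} (p : ι → ZFSet.{u}) (hι : #ι ≤ κ) :
    ∃ θ θ' M J, Reflection κ θ θ' M J ∧ ∀ i, p i ∈ M := by
  let X : ZFSet.{u} := ZFSet.range p ∪ (κ.ord + 1).toZFSet
  let θ : Ordinal.{u} := Order.succ X.rank
  have hXθ : X ⊆ V_ θ := by
    rw [ZFSet.subset_vonNeumann]; exact Order.le_succ _
  have hκθ : κ.ord < θ := by
    have h1 : (κ.ord + 1).toZFSet.rank ≤ X.rank := ZFSet.rank_mono fun x hx =>
      ZFSet.mem_union.2 (Or.inr hx)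
    rw [Ordinal.rank_toZFSet] at h1
    exact (lt_add_one _).trans_le (h1.trans (Order.le_succ _))
  have hXc : X.card ≤ κ := by
    refine (ZFSet.card_union_le).trans (Cardinal.add_le_of_le hκ ?_ (card_toZFSet_succ κ hκ).le)
    have := ZFSet.lift_card_range_le (f := p)
    simp only [Cardinal.lift_id] at this
    exact this.trans hι
  let s : Set (V_ θ) := {x | (x : ZFSet) ∈ X}
  have hs : #s ≤ lift.{u + 1} κ := by
    have h1 : #s ≤ #X := Cardinal.mk_le_of_injective
      (f := fun x : s => (⟨x.1.1, x.2⟩ : X)) fun x y hxy => by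
        apply Subtype.ext; apply Subtype.ext; simpa using hxy
    rw [ZFSet.cardinalMk_coe_sort] at h1
    exact h1.trans (lift_le.2 hXc)
  have hV : lift.{u + 1} κ ≤ #(V_ θ) := by
    rw [ZFSet.cardinalMk_coe_sort, lift_le]
    calc κ = κ.ord.card := (card_ord κ).symm
      _ ≤ θ.card := Ordinal.card_le_card hκθ.le
      _ ≤ _ := Ordinal.card_le_card_vonNeumann θ
  obtain ⟨S, hsS, hS⟩ := Language.exists_elementarySubstructure_card_eq setLang s
    (lift.{u + 1} κ) (by simpa using hκ) (by simpa using hs)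
    ((lift_le.2 card_setLang_le).trans (by simpa using hκ)) (by simpa using hV)
  let M : ZFSet.{u} := (V_ θ).sep fun x => ∃ y : S, (y : V_ θ).1 = x
  have hMS : ∀ x, x ∈ M ↔ ∃ y : S, (y : V_ θ).1 = x := by
    intro x
    rw [ZFSet.mem_sep]
    refine ⟨fun h => h.2, fun h => ⟨?_, h⟩⟩
    obtain ⟨y, rfl⟩ := h
    exact y.1.2
  have hMV : M ⊆ V_ θ := ZFSet.sep_subset
  have hXM : ∀ x ∈ X, x ∈ M := fun x hx => (hMS x).2 ⟨⟨⟨x, hXθ hx⟩, hsS hx⟩, rfl⟩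
  let e : M ≃ S :=
    { toFun := fun x => ⟨⟨x, hMV x.2⟩, by
        obtain ⟨y, hy⟩ := (hMS x).1 x.2
        have : (⟨x, hMV x.2⟩ : V_ θ) = y := Subtype.ext hy.symm
        rw [this]; exact y.2⟩
      invFun := fun y => ⟨y.1.1, (hMS _).2 ⟨y, rfl⟩⟩
      left_inv := fun x => rfl
      right_inv := fun y => rfl }
  let e' : M ≃[setLang] S :=
    { e with
      map_fun' := fun f => nomatch f
      map_rel' := fun {n} r x => by
        cases r; exact Iff.rfl }
  have hMel : IsElemSub M (V_ θ) := ⟨S.subtype.comp e'.toElementaryEmbedding, fun x => rfl⟩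
  have hMc : M.card = κ := by
    have : #M = #S := Cardinal.mk_congr e
    rw [ZFSet.cardinalMk_coe_sort] at this
    rw [← this] at hS
    simpa using hS
  have hκM : (κ.ord + 1).toZFSet ⊆ M := fun x hx => hXM x (ZFSet.mem_union.2 (Or.inr hx))
  obtain ⟨θ', j, -, -, hj, hjκ⟩ := h.2 θ M hκθ hMel hκM hMc
  obtain ⟨i, hi⟩ := hMel
  classical
  have hκm : cardSet κ ∈ M := hκM (mem_cardSet_succ.2 (Or.inl rfl))
  have hlt : ∀ x ∈ cardSet κ, x ∈ M := fun x hx => hκM (mem_cardSet_succ.2 (Or.inr hx))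
  let J : ZFSet.{u} → ZFSet.{u} := fun x => if hx : x ∈ M then j ⟨x, hx⟩ else ∅
  have hJ : ∀ x (hx : x ∈ M), J x = j ⟨x, hx⟩ := fun x hx => dif_pos hx
  refine ⟨θ, θ', M, J, ⟨hMV, ?_, hκm, hlt, ?_, ?_, ?_⟩, ?_⟩
  · intro x hx; rw [hJ x hx]; exact (j _).2
  · intro x hx; rw [hJ x (hlt x hx)]; exact hj _ hx
  · rw [hJ _ hκm]; exact hjκ _ rfl
  · rintro α P ⟨φ, hφ⟩ v hv
    have h1 := hφ θ (fun a => i ⟨v a, hv a⟩)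
    have h2 := hφ θ' (fun a => j ⟨v a, hv a⟩)
    have e1 := i.map_formula φ (fun a => ⟨v a, hv a⟩)
    have e2 := j.map_formula φ (fun a => ⟨v a, hv a⟩)
    have hv1 : (fun a => ((i ⟨v a, hv a⟩ : V_ θ) : ZFSet)) = v := funext fun a => hi _
    have hv2 : (fun a => ((j ⟨v a, hv a⟩ : V_ θ') : ZFSet)) = fun a => J (v a) :=
      funext fun a => (hJ _ _).symm
    rw [hv1] at h1
    rw [hv2] at h2
    rw [← h1, ← h2]
    exact e1.trans e2.symm
  · exact fun k => hXM _ (by simp [X])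

/-! ### Conjunctions and disjunctions over arbitrary small families -/

namespace HOForm

variable {L : FirstOrder.Language.{u, u}} {V Y : Type u}

/-- The disjunction of the family `ψ`, indexed by the image of `Y` in the set of variables. -/
noncomputable def iDisj (e : Y ↪ V) (ψ : Y → HOForm L V) : HOForm L V :=
  disj (Set.range e) fun k => ψ ((Equiv.ofInjective e e.injective).symm k)

/-- The conjunction of the family `ψ`, indexed by the image of `Y` in the set of variables. -/
noncomputable def iConj (e : Y ↪ V) (ψ : Y → HOForm L V) : HOForm L V :=
  conj (Set.range e) fun k => ψ ((Equiv.ofInjective e e.injective).symm k)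

theorem freeVars_iDisj (e : Y ↪ V) (ψ : Y → HOForm L V) :
    (iDisj e ψ).freeVars = ⋃ y, (ψ y).freeVars :=
  (Equiv.ofInjective e e.injective).symm.surjective.iUnion_comp fun y => (ψ y).freeVars

theorem freeVars_iConj (e : Y ↪ V) (ψ : Y → HOForm L V) :
    (iConj e ψ).freeVars = ⋃ y, (ψ y).freeVars :=
  (Equiv.ofInjective e e.injective).symm.surjective.iUnion_comp fun y => (ψ y).freeVars

theorem realize_iDisj (e : Y ↪ V) (ψ : Y → HOForm L V) (A : Type u) [L.Structure A] (v) :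
    (iDisj e ψ).Realize A v ↔ ∃ y, (ψ y).Realize A v :=
  (Equiv.ofInjective e e.injective).symm.surjective.exists (p := fun y => (ψ y).Realize A v) |>.symm

theorem realize_iConj (e : Y ↪ V) (ψ : Y → HOForm L V) (A : Type u) [L.Structure A] (v) :
    (iConj e ψ).Realize A v ↔ ∀ y, (ψ y).Realize A v :=
  (Equiv.ofInjective e e.injective).symm.surjective.forall (p := fun y => (ψ y).Realize A v) |>.symm

variable {N : ℕ∞} {κ lam : Cardinal.{u}}

theorem isFormula_iDisj {e : Y ↪ V} {ψ : Y → HOForm L V} (hY : #Y < κ)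
    (hf : #(⋃ y, (ψ y).freeVars : Set (ℕ × V)) < lam) (h : ∀ y, (ψ y).IsFormula N κ lam) :
    (iDisj e ψ).IsFormula N κ lam := by
  refine ⟨?_, ?_, fun k => h _⟩
  · rwa [Cardinal.mk_range_eq _ e.injective]
  · rw [← freeVars_iDisj e] at hf; exact hf

theorem isFormula_iConj {e : Y ↪ V} {ψ : Y → HOForm L V} (hY : #Y < κ)
    (hf : #(⋃ y, (ψ y).freeVars : Set (ℕ × V)) < lam) (h : ∀ y, (ψ y).IsFormula N κ lam) :
    (iConj e ψ).IsFormula N κ lam := by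
  refine ⟨?_, ?_, fun k => h _⟩
  · rwa [Cardinal.mk_range_eq _ e.injective]
  · rw [← freeVars_iConj e] at hf; exact hf

end HOForm

/-- A family of fewer than `κ` members can be indexed by variables. -/
theorem exists_embedding_out {κ : Cardinal.{u}} {Y : Type u} (h : #Y < κ) :
    Nonempty (Y ↪ κ.out) :=
  Cardinal.le_def Y κ.out |>.1 (by rw [mk_out]; exact h.le)

/-! ### Propositional theories -/

/-- The relation symbols of the propositional signature over `X`. -/
inductive PropSymb (X : Type u) : ℕ → Type u
  | atom (x : X) : PropSymb X 0

/-- The signature with one propositional variable (a nullary relation symbol) for each `x : X`. -/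
def propLang (X : Type u) : FirstOrder.Language.{u, u} := ⟨fun _ => PEmpty, PropSymb X⟩

theorem card_propLang_le (X : Type u) : (propLang X).card ≤ #X := by
  let f : (propLang X).Symbols → X := fun s => match s with
    | .inl ⟨_, c⟩ => nomatch (c : PEmpty)
    | .inr ⟨_, PropSymb.atom x⟩ => x
  refine Cardinal.mk_le_of_injective (f := f) ?_
  rintro (⟨_, ⟨⟩⟩ | ⟨_, ⟨x⟩⟩) (⟨_, ⟨⟩⟩ | ⟨_, ⟨y⟩⟩) h
  obtain rfl : x = y := h
  rfl

/-- The one-point structure in which exactly the atoms in `s` hold. -/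
@[reducible] def propStructure {X : Type u} (s : Set X) : (propLang X).Structure PUnit.{u + 1} where
  funMap f _ := nomatch (f : PEmpty)
  RelMap {_} r _ := match r with
    | PropSymb.atom x => x ∈ s

/-- The propositional variable `x` as a formula. -/
def atomForm {X V : Type u} (x : X) : HOForm (propLang X) V :=
  .rel (PropSymb.atom x : (propLang X).Relations 0) Fin.elim0

theorem freeVars_atomForm {X V : Type u} (x : X) : (atomForm x : HOForm _ V).freeVars = ∅ := by
  simp [atomForm, HOForm.freeVars]

theorem realize_atomForm {X V : Type u} (s : Set X) (x : X) (v) :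
    @HOForm.Realize _ V PUnit (propStructure s) (atomForm x) v ↔ x ∈ s := Iff.rfl

section

variable {N : ℕ∞} {κ lam μ : Cardinal.{u}}

/-- If `μ` belongs to the weak compactness spectrum, a set of size `μ` is not a union of
fewer than `κ` sets of size less than `κ`: otherwise the propositional theory
`{¬ x | x ∈ X} ∪ {⋁ i, ⋁ x ∈ Z i, x}` would be `< μ`-satisfiable. -/
theorem false_of_mem_WCS_of_cover (hlam : 0 < lam) (hμ : μ ∈ WCS N κ lam) {X I : Type u}
    (hX : #X = μ) (hI : #I < κ) (Z : I → Set X) (hZ : ∀ i, #(Z i) < κ)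
    (hcov : ∀ x, ∃ i, x ∈ Z i) : False := by
  obtain ⟨eI⟩ := exists_embedding_out hI
  let eZ : ∀ i, Z i ↪ κ.out := fun i => (exists_embedding_out (hZ i)).some
  let at' : X → RawForm (propLang X) κ := atomForm
  let ng : X → RawForm (propLang X) κ := fun x => (at' x).neg
  let σ : RawForm (propLang X) κ :=
    HOForm.iDisj eI fun i => HOForm.iDisj (eZ i) fun x => at' x
  have hσ : σ.freeVars = ∅ := by
    simp [σ, HOForm.freeVars_iDisj, at', freeVars_atomForm]
  have hng : ng.Injective := by
    intro x y h
    injection h with h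
    injection h with _ h _
    injection h
  obtain ⟨A, inst, ⟨a⟩, hA⟩ := hμ.2 (propLang X) ((card_propLang_le X).trans hX.le)
    (insert σ (Set.range ng)) (by
      rintro φ (rfl | ⟨x, rfl⟩)
      · refine ⟨HOForm.isFormula_iDisj hI ?_ fun i => HOForm.isFormula_iDisj (hZ i) ?_ fun _ =>
          trivial, hσ⟩
        · simpa [HOForm.freeVars_iDisj, at', freeVars_atomForm] using hlam
        · simpa [at', freeVars_atomForm] using hlam
      · exact ⟨trivial, freeVars_atomForm x⟩) (by
      intro T₀ _ hT₀
      obtain ⟨x, hx⟩ : ∃ x, ng x ∉ T₀ := by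
        by_contra! hcon
        have : #X ≤ #T₀ := Cardinal.mk_le_of_injective (f := fun x => (⟨ng x, hcon x⟩ : T₀))
          fun x y h => hng (congrArg Subtype.val h)
        exact absurd (hX ▸ this) (not_le.2 hT₀)
      refine ⟨PUnit, propStructure {x}, ⟨⟨⟩⟩, fun φ hφ v => ?_⟩
      have hφT := ‹T₀ ⊆ _› hφ
      let _ := propStructure ({x} : Set X)
      rcases hφT with rfl | ⟨y, rfl⟩
      · obtain ⟨i, hi⟩ := hcov x
        exact (HOForm.realize_iDisj _ _ _ _).2 ⟨i, (HOForm.realize_iDisj _ _ _ _).2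
          ⟨⟨x, hi⟩, (realize_atomForm _ _ _).2 rfl⟩⟩
      · intro h
        have : y = x := (realize_atomForm {x} y v).1 h
        exact hx (this ▸ hφ))
  let v : ∀ p : ℕ × κ.out, IterPow A p.1 := fun p => Classical.choice (by
    rcases p with ⟨_ | i, _⟩
    · exact ⟨a⟩
    · exact ⟨(∅ : Set (IterPow A i))⟩)
  obtain ⟨i, hi⟩ := (HOForm.realize_iDisj _ _ _ _).1 (hA σ (Set.mem_insert _ _) v)
  obtain ⟨x, hx⟩ := (HOForm.realize_iDisj _ _ _ _).1 hi
  exact hA (ng x) (Set.mem_insert_of_mem _ ⟨_, rfl⟩) v hx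

theorem le_of_mem_WCS (hlam : 0 < lam) (hμ : μ ∈ WCS N κ lam) : κ ≤ μ := by
  by_contra! h
  refine false_of_mem_WCS_of_cover hlam hμ (X := μ.out) (I := PUnit) (mk_out μ) ?_
    (fun _ => Set.univ) (fun _ => ?_) fun x => ⟨⟨⟩, trivial⟩
  · rw [mk_punit]
    exact one_lt_aleph0.trans (hμ.1.trans h)
  · rwa [mk_univ, mk_out]

theorem coe_eq_wcn_iff_mem (hlam : 0 < lam) :
    (κ : WithTop Cardinal.{u}) = wcn N κ lam ↔ κ ∈ WCS N κ lam :=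
  coe_eq_wcn_iff.trans ⟨fun h => h.1, fun h => ⟨h, fun _ hμ => le_of_mem_WCS hlam hμ⟩⟩

theorem isRegular_of_mem_WCS (hlam : 0 < lam) (h : κ ∈ WCS N κ lam) : κ.IsRegular := by
  refine ⟨h.1.le, ?_⟩
  by_contra! hcof
  obtain ⟨s, hs, hsc⟩ := Order.exists_cof_eq κ.ord.ToType
  have hc : #s < κ := by
    rw [hsc]; simpa using hcof
  refine false_of_mem_WCS_of_cover hlam h (X := κ.ord.ToType) (I := s) (by simp) hc
    (fun i => Set.Iic i.1) (fun i => ?_) fun x => ?_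
  · exact (mk_Iic_lt i.1 (by simp) (by simpa using h.1.le)).trans_eq (by simp)
  · obtain ⟨y, hy, hxy⟩ := hs x
    exact ⟨⟨y, hy⟩, hxy⟩

/-- Below a member of the spectrum `κ`, the power function stays below `κ`: the theory saying that
the set of true atoms differs from every `s ⊆ X` is satisfiable as soon as one `s` is left out. -/
theorem two_power_lt_of_mem_WCS (hlam : 0 < lam) (h : κ ∈ WCS N κ lam) {c : Cardinal.{u}}
    (hc : c < κ) : 2 ^ c < κ := by
  by_contra! hcon
  classical
  let X := c.out
  have hX : #X < κ := by rwa [mk_out]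
  obtain ⟨e⟩ := exists_embedding_out hX
  let lit : Set X → X → RawForm (propLang X) κ := fun s x =>
    if x ∈ s then atomForm x else (atomForm x).neg
  have hlit : ∀ s x, (lit s x).freeVars = ∅ := by
    intro s x
    by_cases hx : x ∈ s
    · simp only [lit, if_pos hx]; exact freeVars_atomForm x
    · simp only [lit, if_neg hx]; exact freeVars_atomForm x
  have hlitf : ∀ s x, (lit s x).IsFormula N κ lam := by
    intro s x
    by_cases hx : x ∈ s
    · simp only [lit, if_pos hx]; exact trivial
    · simp only [lit, if_neg hx]; exact trivial
  let φ : Set X → RawForm (propLang X) κ := fun s => (HOForm.iConj e (lit s)).neg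
  have hreal : ∀ (A : Type u) [(propLang X).Structure A] v s,
      (φ s).Realize A v ↔ {x | (atomForm x : RawForm _ κ).Realize A v} ≠ s := by
    intro A _ v s
    refine not_congr ((HOForm.realize_iConj e (lit s) A v).trans ?_)
    rw [Set.ext_iff]
    refine forall_congr' fun x => ?_
    by_cases hx : x ∈ s
    · simp only [lit, if_pos hx]; simp [hx]
    · simp only [lit, if_neg hx]; simp [hx, HOForm.Realize]
  have hatoms : ∀ (s : Set X) v, {x | @HOForm.Realize _ _ PUnit (propStructure s)
      (atomForm x : RawForm _ κ) v} = s := fun s v => rfl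
  have hφi : φ.Injective := by
    intro s t hst
    by_contra hne
    let _ := propStructure s
    let v : ∀ p : ℕ × κ.out, IterPow PUnit.{u + 1} p.1 := fun p => Classical.choice (by
      rcases p with ⟨_ | i, _⟩
      · exact ⟨⟨⟩⟩
      · exact ⟨(∅ : Set (IterPow PUnit i))⟩)
    have h1 := hreal PUnit v s
    have h2 := hreal PUnit v t
    rw [hatoms] at h1 h2
    rw [← hst, h1] at h2
    exact h2.2 hne rfl
  obtain ⟨A, inst, ⟨a⟩, hA⟩ := h.2 (propLang X) ((card_propLang_le X).trans hX.le)
    (Set.range φ) (by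
      rintro _ ⟨s, rfl⟩
      refine ⟨HOForm.isFormula_iConj hX ?_ (hlitf s), ?_⟩
      · simpa [hlit] using hlam
      · exact (HOForm.freeVars_iConj e (lit s)).trans (by simp [hlit])) (by
      intro T₀ hT hT₀
      obtain ⟨s, hs⟩ : ∃ s, φ s ∉ T₀ := by
        by_contra! hcon'
        have : #(Set X) ≤ #T₀ := Cardinal.mk_le_of_injective
          (f := fun s => (⟨φ s, hcon' s⟩ : T₀)) fun x y h => hφi (congrArg Subtype.val h)
        rw [mk_set, mk_out] at this
        exact absurd (hcon.trans this) (not_le.2 hT₀)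
      refine ⟨PUnit, propStructure s, ⟨⟨⟩⟩, fun ψ hψ v => ?_⟩
      obtain ⟨t, rfl⟩ := hT hψ
      let _ := propStructure s
      rw [hreal, hatoms]
      rintro rfl
      exact hs hψ)
  let v : ∀ p : ℕ × κ.out, IterPow A p.1 := fun p => Classical.choice (by
    rcases p with ⟨_ | i, _⟩
    · exact ⟨a⟩
    · exact ⟨(∅ : Set (IterPow A i))⟩)
  exact (hreal A v _).1 (hA _ ⟨_, rfl⟩ v) rfl

theorem eq_two_powerlt_of_mem_WCS (hlam : 0 < lam) (h : κ ∈ WCS N κ lam) : κ = 2 ^< κ := by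
  apply le_antisymm
  · by_contra! hlt
    exact absurd (le_powerlt 2 hlt) (not_le.2 (cantor _))
  · exact powerlt_le.2 fun c hc => (two_power_lt_of_mem_WCS hlam h hc).le

theorem WCS_subset_of_le {N' : ℕ∞} {lam' : Cardinal.{u}} (hN : N ≤ N') (hl : lam ≤ lam') :
    WCS N' κ lam' ⊆ WCS N κ lam := by
  rintro μ ⟨h1, h2⟩
  refine ⟨h1, fun L hL T hT hs => h2 L hL T (fun φ hφ => ⟨?_, (hT φ hφ).2⟩) hs⟩
  have key : ∀ φ : RawForm L κ, φ.IsFormula N κ lam → φ.IsFormula N' κ lam' := by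
    intro φ
    induction φ with
    | eq | rel => exact fun _ => trivial
    | memTerm t X => exact fun h => lt_of_lt_of_le (show 1 < N from h) hN
    | memVar i X Y => exact fun h => lt_of_lt_of_le (show ((i + 2 : ℕ) : ℕ∞) < N from h) hN
    | neg φ ih => exact ih
    | conj I φ ih => exact fun h => ⟨h.1, h.2.1.trans_le hl, fun k => ih k (h.2.2 k)⟩
    | disj I φ ih => exact fun h => ⟨h.1, h.2.1.trans_le hl, fun k => ih k (h.2.2 k)⟩
    | ex B φ ih => exact fun h => ⟨h.1.trans_le hl, fun p hp => (h.2.1 p hp).trans_le hN, ih h.2.2⟩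
    | all B φ ih => exact fun h => ⟨h.1.trans_le hl, fun p hp => (h.2.1 p hp).trans_le hN, ih h.2.2⟩
  exact key φ (hT φ hφ).1

end

/-! ### Recognizing the levels of the von Neumann hierarchy -/

theorem ZFSet.eq_vonNeumann_rank {N : ZFSet.{u}} (hsub : ∀ x ∈ N, ∀ y ⊆ x, y ∈ N)
    (hrank : ∀ x ∈ N, V_ x.rank ∈ N) : N = V_ N.rank := by
  ext y
  refine ⟨fun h => ZFSet.subset_vonNeumann_self N h, fun h => ?_⟩
  rw [ZFSet.mem_vonNeumann, ZFSet.lt_rank_iff] at h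
  obtain ⟨x, hx, hyx⟩ := h
  exact hsub _ (hrank x hx) _ (ZFSet.subset_vonNeumann.2 hyx)

/-- A well-founded extensional structure that contains all subclasses of its members, and in which a
function `r` obeys the recursion `r x = ⋃ z ∈ x, 𝒫 (r z)` of `x ↦ V_ (rank x)`, is isomorphic to a
level of the von Neumann hierarchy, by its Mostowski collapse. -/
theorem exists_equiv_vonNeumann {A : Type u} (E : A → A → Prop) (r : A → A)
    (hext : ∀ x y, (∀ z, E z x → E z y) → (∀ z, E z y → E z x) → x = y)
    (hwf : ∀ X : Set A, (∀ x, x ∈ X → ¬ ∀ y, E y x → y ∉ X) → ∀ x, x ∉ X)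
    (hsep : ∀ (X : Set A) (a : A), ∃ b, ∀ x, E x b ↔ E x a ∧ x ∈ X)
    (hr : ∀ x y, E y (r x) ↔ ∃ z, E z x ∧ ∀ w, E w y → E w (r z)) :
    ∃ (θ : Ordinal.{u}) (π : A ≃ V_ θ), ∀ x y, E x y ↔ (π x : ZFSet) ∈ (π y : ZFSet) := by
  have hWF : WellFounded E := by
    rw [WellFounded.wellFounded_iff_has_min]
    rintro X ⟨x, hx⟩
    by_contra! hcon
    refine hwf X (fun y hy h => ?_) x hx
    obtain ⟨z, hz, hzy⟩ := hcon y hy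
    exact h z hzy hz
  let π : A → ZFSet.{u} := hWF.fix fun x f => ZFSet.range fun y : {y // E y x} => f y y.2
  have hπ : ∀ x, π x = ZFSet.range fun y : {y // E y x} => π y := fun x => hWF.fix_eq _ x
  have hmem : ∀ u x, u ∈ π x ↔ ∃ y, E y x ∧ π y = u := by
    intro u x
    rw [hπ, ZFSet.mem_range]
    exact ⟨fun ⟨y, h⟩ => ⟨y.1, y.2, h⟩, fun ⟨y, h, h'⟩ => ⟨⟨y, h⟩, h'⟩⟩
  have hinj : ∀ x y, π x = π y → x = y := by
    intro x
    induction x using hWF.induction with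
    | _ x ih =>
      intro y hxy
      apply hext
      · intro z hz
        obtain ⟨w, hw, hwz⟩ := (hmem (π z) y).1 (hxy ▸ (hmem _ _).2 ⟨z, hz, rfl⟩)
        rwa [ih z hz w hwz.symm]
      · intro z hz
        obtain ⟨w, hw, hwz⟩ := (hmem (π z) x).1 (hxy ▸ (hmem _ _).2 ⟨z, hz, rfl⟩)
        rwa [← ih w hw z hwz]
  have hE : ∀ x y, E x y ↔ π x ∈ π y := by
    intro x y
    rw [hmem]
    refine ⟨fun h => ⟨x, h, rfl⟩, ?_⟩
    rintro ⟨z, hz, h⟩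
    rwa [← hinj _ _ h]
  have hsub : ∀ x u, u ⊆ π x → ∃ y, π y = u := by
    intro x u hu
    obtain ⟨b, hb⟩ := hsep {y | π y ∈ u} x
    refine ⟨b, ?_⟩
    ext w
    rw [hmem]
    constructor
    · rintro ⟨y, hy, rfl⟩
      exact ((hb y).1 hy).2
    · intro hw
      obtain ⟨y, hy, rfl⟩ := (hmem _ _).1 (hu hw)
      exact ⟨y, (hb y).2 ⟨hy, hw⟩, rfl⟩
  have hrk : ∀ x, π (r x) = V_ (π x).rank := by
    intro x
    induction x using hWF.induction with
    | _ x ih =>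
      have hle : ∀ y z, E z x → ((∀ w, E w y → E w (r z)) ↔ π y ⊆ V_ (π z).rank) := by
        intro y z hz
        rw [← ih z hz]
        constructor
        · intro h u hu
          obtain ⟨w, hw, rfl⟩ := (hmem _ _).1 hu
          exact (hE _ _).1 (h w hw)
        · intro h w hw
          exact (hE _ _).2 (h ((hE _ _).1 hw))
      ext u
      rw [ZFSet.mem_vonNeumann, ZFSet.lt_rank_iff, hmem]
      constructor
      · rintro ⟨y, hy, rfl⟩
        obtain ⟨z, hz, h⟩ := (hr x y).1 hy
        exact ⟨π z, (hE _ _).1 hz, ZFSet.subset_vonNeumann.1 ((hle y z hz).1 h)⟩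
      · rintro ⟨_, hz, h⟩
        obtain ⟨z, hzx, rfl⟩ := (hmem _ _).1 hz
        rw [← ZFSet.subset_vonNeumann] at h
        obtain ⟨y, rfl⟩ := hsub (r z) u (by rwa [ih z hzx])
        exact ⟨y, (hr x y).2 ⟨z, hzx, (hle y z hzx).2 h⟩, rfl⟩
  have hN : ZFSet.range π = V_ (ZFSet.range π).rank := by
    apply ZFSet.eq_vonNeumann_rank
    · rintro x hx y hy
      obtain ⟨a, rfl⟩ := ZFSet.mem_range.1 hx
      exact ZFSet.mem_range.2 (hsub a y hy)
    · rintro x hx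
      obtain ⟨a, rfl⟩ := ZFSet.mem_range.1 hx
      exact ZFSet.mem_range.2 ⟨r a, hrk a⟩
  refine ⟨(ZFSet.range π).rank, Equiv.ofBijective
    (fun a => ⟨π a, hN.le (ZFSet.mem_range_self a)⟩) ⟨fun x y h => hinj x y (congrArg Subtype.val h),
      fun y => ?_⟩, hE⟩
  obtain ⟨a, ha⟩ := ZFSet.mem_range.1 (hN.ge y.2)
  exact ⟨a, Subtype.ext ha⟩

/-! ### Finitary second-order formulas -/

namespace HOForm

variable {L : FirstOrder.Language.{u, u}} {V : Type u}

theorem finite_termVars (t : L.Term V) : (termVars t).Finite := by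
  induction t with
  | var x => exact Set.finite_singleton _
  | func f ts ih => exact Set.finite_iUnion ih

theorem IsFormula.finite_freeVars {N : ℕ∞} {κ : Cardinal.{u}} {φ : HOForm L V}
    (h : φ.IsFormula N κ ℵ₀) : φ.freeVars.Finite := by
  induction φ with
  | eq t s => exact (finite_termVars t).union (finite_termVars s)
  | rel R ts => exact Set.finite_iUnion fun k => finite_termVars (ts k)
  | memTerm t X => exact (finite_termVars t).union (Set.finite_singleton _)
  | memVar i X Y => exact (Set.finite_singleton _).insert _
  | neg φ ih => exact ih h
  | conj I φ ih => exact Cardinal.lt_aleph0_iff_set_finite.1 h.2.1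
  | disj I φ ih => exact Cardinal.lt_aleph0_iff_set_finite.1 h.2.1
  | ex B φ ih => exact (ih h.2.2).sdiff
  | all B φ ih => exact (ih h.2.2).sdiff

variable {A : Type u}

/-- The part of an assignment that concerns the individual variables. -/
def ev₀ (v : ∀ p : ℕ × V, IterPow A p.1) : V → A := fun x => v (0, x)

/-- The part of an assignment that concerns the variables of sort `1`. -/
def ev₁ (v : ∀ p : ℕ × V, IterPow A p.1) : V → Set A := fun x => v (1, x)

theorem realize_eq [L.Structure A] {t s : L.Term V} {v} :
    (HOForm.eq t s).Realize A v ↔ t.realize (ev₀ v) = s.realize (ev₀ v) := Iff.rfl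

theorem realize_memTerm [L.Structure A] {t : L.Term V} {X : V} {v} :
    (HOForm.memTerm t X).Realize A v ↔ t.realize (ev₀ v) ∈ ev₁ v X := Iff.rfl

theorem realize_neg [L.Structure A] {φ : HOForm L V} {v} :
    (HOForm.neg φ).Realize A v ↔ ¬ φ.Realize A v := Iff.rfl

variable [Infinite V]

/-- The `n`-th of countably many distinct variables. -/
noncomputable def vr (n : ℕ) : V := Infinite.natEmbedding V n

theorem vr_inj {m n : ℕ} : (vr m : V) = vr n ↔ m = n := (Infinite.natEmbedding V).injective.eq_iff

/-- The implication `φ → ψ`, expressed as the disjunction of `¬ φ` and `ψ`. -/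
noncomputable def imp (φ ψ : HOForm L V) : HOForm L V :=
  iDisj (Y := ULift.{u} Bool)
    ⟨fun b => vr b.down.toNat, fun b c h => by
      rcases b with ⟨_ | _⟩ <;> rcases c with ⟨_ | _⟩ <;> simp [vr_inj] at h ⊢⟩
    fun b => if b.down then ψ else φ.neg

theorem realize_imp {φ ψ : HOForm L V} [L.Structure A] {v} :
    (imp φ ψ).Realize A v ↔ (φ.Realize A v → ψ.Realize A v) := by
  rw [imp, realize_iDisj]
  simp [ULift.exists, Realize, imp_iff_not_or]

theorem freeVars_imp (φ ψ : HOForm L V) : (imp φ ψ).freeVars = φ.freeVars ∪ ψ.freeVars := by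
  rw [imp, freeVars_iDisj]
  ext p
  simp [ULift.exists, freeVars]

theorem isFormula_imp {N : ℕ∞} {κ : Cardinal.{u}} (hκ : ℵ₀ ≤ κ) {φ ψ : HOForm L V}
    (hφ : φ.IsFormula N κ ℵ₀) (hψ : ψ.IsFormula N κ ℵ₀) : (imp φ ψ).IsFormula N κ ℵ₀ := by
  refine isFormula_iDisj ((Cardinal.lt_aleph0_of_finite _).trans_le hκ) ?_ ?_
  · have := (hφ.finite_freeVars.union hψ.finite_freeVars)
    rw [← freeVars_imp, imp, freeVars_iDisj] at this
    exact Cardinal.lt_aleph0_iff_set_finite.2 this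
  · rintro ⟨_ | _⟩
    · exact hφ
    · exact hψ

/-- Universal quantification over the single variable `vr n` of sort `i`. -/
noncomputable def all₁ (i n : ℕ) (φ : HOForm L V) : HOForm L V := all {(i, vr n)} φ

theorem freeVars_all₁ (i n : ℕ) (φ : HOForm L V) :
    (all₁ i n φ).freeVars = φ.freeVars \ {(i, vr n)} := rfl

theorem isFormula_all₁ {i n : ℕ} {N : ℕ∞} {κ : Cardinal.{u}} {φ : HOForm L V} (hi : i < N)
    (hφ : φ.IsFormula N κ ℵ₀) : (all₁ i n φ).IsFormula N κ ℵ₀ :=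
  ⟨by simp, by rintro _ rfl; exact hi, hφ⟩

open Classical in
theorem realize_all₁ {i n : ℕ} {φ : HOForm L V} [L.Structure A] {v} :
    (all₁ i n φ).Realize A v ↔
      ∀ a : IterPow A i, φ.Realize A (Function.update v (i, vr n) a) := by
  constructor
  · intro h a
    refine h _ fun p hp => ?_
    exact Function.update_of_ne (by simpa using hp) _ _
  · intro h w hw
    have : w = Function.update v (i, vr n) (w (i, vr n)) := by
      funext p
      by_cases hp : p = (i, vr n)
      · subst hp; simp
      · rw [Function.update_of_ne hp]; exact hw p (by simpa using hp)
    rw [this]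
    exact h _

open Classical in
/-- Reassign the individual variable `vr n`. -/
noncomputable def upd₀ (v : ∀ p : ℕ × V, IterPow A p.1) (n : ℕ) (a : A) :
    ∀ p : ℕ × V, IterPow A p.1 := Function.update v (0, vr n) a

open Classical in
/-- Reassign the variable `vr n` of sort `1`. -/
noncomputable def upd₁ (v : ∀ p : ℕ × V, IterPow A p.1) (n : ℕ) (a : Set A) :
    ∀ p : ℕ × V, IterPow A p.1 := Function.update v (1, vr n) a

theorem ev₀_upd₀ (v : ∀ p : ℕ × V, IterPow A p.1) (n m : ℕ) (a : A) :
    ev₀ (upd₀ v n a) (vr m) = if m = n then a else ev₀ v (vr m) := by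
  classical
  by_cases h : m = n
  · subst h
    rw [if_pos rfl]
    exact Function.update_self _ _ _
  · rw [if_neg h]
    exact Function.update_of_ne (fun h' => h (vr_inj.1 (Prod.ext_iff.1 h').2)) _ _

theorem ev₁_upd₀ (v : ∀ p : ℕ × V, IterPow A p.1) (n : ℕ) (a : A) :
    ev₁ (upd₀ v n a) = ev₁ v := by
  classical
  funext x
  exact Function.update_of_ne (show ((1, x) : ℕ × V) ≠ (0, vr n) by simp) a v

theorem ev₁_upd₁ (v : ∀ p : ℕ × V, IterPow A p.1) (n : ℕ) (a : Set A) :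
    ev₁ (upd₁ v n a) (vr n) = a := by
  classical
  exact Function.update_self _ _ _

theorem realize_all_zero [L.Structure A] {n : ℕ} {φ : HOForm L V} {v} :
    (all₁ 0 n φ).Realize A v ↔ ∀ a : A, φ.Realize A (upd₀ v n a) := realize_all₁

theorem realize_all_one [L.Structure A] {n : ℕ} {φ : HOForm L V} {v} :
    (all₁ 1 n φ).Realize A v ↔ ∀ a : Set A, φ.Realize A (upd₁ v n a) := realize_all₁

end HOForm

/-! ### The theory of a level of the von Neumann hierarchy with a new ordinal -/

/-- The function symbols of `diagLang C`. -/
inductive DiagFun (C : Type u) : ℕ → Type u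
  /-- a constant for each element of `C` -/
  | const (c : C) : DiagFun C 0
  /-- an additional constant -/
  | star : DiagFun C 0
  /-- a unary symbol for the function `x ↦ V_ (rank x)` -/
  | rk : DiagFun C 1

/-- The relation symbols of `diagLang C`. -/
inductive DiagRel : ℕ → Type u
  /-- the membership relation -/
  | mem : DiagRel 2

/-- The language of set theory with constants for the elements of `C`, a further constant, and a
unary function symbol for `x ↦ V_ (rank x)`. -/
def diagLang (C : Type u) : FirstOrder.Language.{u, u} := ⟨DiagFun C, DiagRel⟩

theorem card_diagLang_le {C : Type u} {κ : Cardinal.{u}} (hκ : ℵ₀ ≤ κ) (hC : #C ≤ κ) :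
    (diagLang C).card ≤ κ := by
  let f : (diagLang C).Symbols → Option (Option (Option C)) := fun s => match s with
    | .inl ⟨_, DiagFun.const c⟩ => some (some (some c))
    | .inl ⟨_, DiagFun.star⟩ => some (some none)
    | .inl ⟨_, DiagFun.rk⟩ => some none
    | .inr _ => none
  have hf : f.Injective := by
    rintro (⟨_, ⟨c⟩ | _ | _⟩ | ⟨_, ⟨⟩⟩) (⟨_, ⟨d⟩ | _ | _⟩ | ⟨_, ⟨⟩⟩) h <;>
      simp_all [f]
  refine (Cardinal.mk_le_of_injective hf).trans ?_
  simp only [mk_option]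
  exact Cardinal.add_le_of_le hκ (Cardinal.add_le_of_le hκ (Cardinal.add_le_of_le hκ hC
    (one_le_aleph0.trans hκ)) (one_le_aleph0.trans hκ)) (one_le_aleph0.trans hκ)

section Semantics

variable {C A : Type u}

/-- The `diagLang C`-structure with the given interpretations of the symbols. -/
@[reducible] def diagStructure (E : A → A → Prop) (r : A → A) (cst : C → A) (star : A) :
    (diagLang C).Structure A where
  funMap {_} f v := match f, v with
    | DiagFun.const c, _ => cst c
    | DiagFun.star, _ => star
    | DiagFun.rk, v => r (v 0)
  RelMap {_} R v := match R, v with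
    | DiagRel.mem, v => E (v 0) (v 1)

/-- The structure for the language of set theory given by a binary relation. -/
@[reducible] def epsStructure (E : A → A → Prop) : setLang.Structure A where
  funMap f _ := nomatch f
  RelMap {_} R v := match R, v with
    | EpsRel.mem, v => E (v 0) (v 1)

variable [(diagLang C).Structure A]

/-- The interpretation of membership. -/
def dE (C : Type u) {A : Type u} [(diagLang C).Structure A] (a b : A) : Prop :=
  Language.Structure.RelMap (L := diagLang C) (DiagRel.mem : (diagLang C).Relations 2) ![a, b]

/-- The interpretation of the symbol for `x ↦ V_ (rank x)`. -/
def dR (C : Type u) {A : Type u} [(diagLang C).Structure A] (a : A) : A :=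
  Language.Structure.funMap (L := diagLang C) (DiagFun.rk : (diagLang C).Functions 1) ![a]

/-- The interpretation of the constants. -/
def dC {C : Type u} (A : Type u) [(diagLang C).Structure A] (c : C) : A :=
  Language.Structure.funMap (L := diagLang C) (DiagFun.const c : (diagLang C).Functions 0) ![]

/-- The interpretation of the additional constant. -/
def dS (C A : Type u) [(diagLang C).Structure A] : A :=
  Language.Structure.funMap (L := diagLang C) (DiagFun.star : (diagLang C).Functions 0) ![]

end Semantics

namespace Diag

open HOForm

variable {C V : Type u}

/-- The constant `c` as a term. -/
def tC (c : C) : (diagLang C).Term V := .func (DiagFun.const c : (diagLang C).Functions 0) ![]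

/-- The additional constant as a term. -/
def tS : (diagLang C).Term V := .func (DiagFun.star : (diagLang C).Functions 0) ![]

/-- The term `rk t`. -/
def tR (t : (diagLang C).Term V) : (diagLang C).Term V :=
  .func (DiagFun.rk : (diagLang C).Functions 1) ![t]

/-- The formula `t ∈ s`. -/
def fm (t s : (diagLang C).Term V) : HOForm (diagLang C) V :=
  .rel (DiagRel.mem : (diagLang C).Relations 2) ![t, s]

section

variable {A : Type u} [(diagLang C).Structure A] {f : V → A}

@[simp] theorem realize_tC (c : C) : (tC c : (diagLang C).Term V).realize f = dC A c := by
  exact congrArg (Language.Structure.funMap _) (Subsingleton.elim _ _)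

@[simp] theorem realize_tS : (tS : (diagLang C).Term V).realize f = dS C A := by
  exact congrArg (Language.Structure.funMap _) (Subsingleton.elim _ _)

@[simp] theorem realize_tR (t : (diagLang C).Term V) : (tR t).realize f = dR C (t.realize f) := by
  refine congrArg (Language.Structure.funMap _) ?_
  funext i
  fin_cases i
  rfl

theorem realize_fm (t s : (diagLang C).Term V) {v} : (fm t s).Realize A v ↔
    dE C (t.realize (ev₀ v)) (s.realize (ev₀ v)) := by
  refine iff_of_eq (congrArg (Language.Structure.RelMap _) ?_)
  funext i
  fin_cases i <;> rfl

end

theorem termVars_tC (c : C) : termVars (tC c : (diagLang C).Term V) = ∅ := by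
  simp [tC, termVars]

theorem termVars_tS : termVars (tS : (diagLang C).Term V) = ∅ := by
  simp [tS, termVars]

theorem termVars_tR (t : (diagLang C).Term V) : termVars (tR t) = termVars t := by
  simp [tR, termVars, Set.iUnion_const]

theorem freeVars_fm (t s : (diagLang C).Term V) :
    (fm t s).freeVars = termVars t ∪ termVars s := by
  ext p
  simp [fm, HOForm.freeVars, Fin.exists_fin_two]

theorem isFormula_fm {N : ℕ∞} {κ lam : Cardinal.{u}} (t s : (diagLang C).Term V) :
    (fm t s).IsFormula N κ lam := trivial

theorem isFormula_eq {N : ℕ∞} {κ lam : Cardinal.{u}} (t s : (diagLang C).Term V) :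
    (HOForm.eq t s).IsFormula N κ lam := trivial

theorem isFormula_memTerm {κ lam : Cardinal.{u}} (t : (diagLang C).Term V) (X : V) :
    (HOForm.memTerm t X).IsFormula 2 κ lam := show (1 : ℕ∞) < 2 by norm_num

theorem isFormula_neg {N : ℕ∞} {κ lam : Cardinal.{u}} {φ : HOForm (diagLang C) V}
    (h : φ.IsFormula N κ lam) : φ.neg.IsFormula N κ lam := h

variable [Infinite V]

/-- The variable `n` of sort `0` as a term. -/
noncomputable def tv (n : ℕ) : (diagLang C).Term V := .var (vr n)

theorem realize_tv {A : Type u} [(diagLang C).Structure A] (n : ℕ) (f : V → A) :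
    (tv n : (diagLang C).Term V).realize f = f (vr n) := rfl

theorem termVars_tv (n : ℕ) : termVars (tv n : (diagLang C).Term V) = {(0, vr n)} := rfl

/-! #### Translation of first-order formulas -/

/-- The constants and variables of a first-order formula with parameters in `C`, as terms. -/
noncomputable def trTerm {n : ℕ} : setLang.Term (C ⊕ Fin n) → (diagLang C).Term V
  | .var (.inl c) => tC c
  | .var (.inr i) => tv i
  | .func f _ => nomatch f

/-- A first-order formula with parameters in `C`, as a sentence about the constants. -/
noncomputable def tr : {n : ℕ} → setLang.BoundedFormula C n → HOForm (diagLang C) V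
  | _, .falsum => .disj ∅ fun k => k.2.elim
  | _, .equal t s => .eq (trTerm t) (trTerm s)
  | _, .rel (l := _) R ts => match R, ts with
    | EpsRel.mem, ts => fm (trTerm (ts 0)) (trTerm (ts 1))
  | _, .imp φ ψ => imp (tr φ) (tr ψ)
  | n, .all φ => all₁ 0 n (tr φ)

theorem isFormula_tr {κ : Cardinal.{u}} (hκ : ℵ₀ ≤ κ) {n : ℕ} (φ : setLang.BoundedFormula C n) :
    (tr φ : HOForm (diagLang C) V).IsFormula 2 κ ℵ₀ := by
  induction φ with
  | falsum =>
    refine ⟨?_, ?_, fun k => k.2.elim⟩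
    · simpa using (aleph0_pos.trans_le hκ)
    · rw [Cardinal.lt_aleph0_iff_set_finite]
      exact Set.finite_iUnion fun k => k.2.elim
  | equal => exact trivial
  | rel R ts => cases R; exact trivial
  | imp φ ψ h1 h2 => exact isFormula_imp hκ h1 h2
  | all φ ih => exact isFormula_all₁ (by norm_num) ih

theorem termVars_trTerm {n : ℕ} (t : setLang.Term (C ⊕ Fin n)) :
    termVars (trTerm t : (diagLang C).Term V) ⊆ {p | ∃ i < n, p = (0, vr i)} := by
  rcases t with (c | i) | ⟨f⟩
  · rw [trTerm, termVars_tC]; exact Set.empty_subset _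
  · rw [trTerm, termVars_tv]; rintro _ rfl; exact ⟨i, i.2, rfl⟩
  · exact nomatch f

theorem freeVars_tr {n : ℕ} (φ : setLang.BoundedFormula C n) :
    (tr φ : HOForm (diagLang C) V).freeVars ⊆ {p | ∃ i < n, p = (0, vr i)} := by
  induction φ with
  | falsum => exact Set.iUnion_subset fun k => k.2.elim
  | equal t s => exact Set.union_subset (termVars_trTerm t) (termVars_trTerm s)
  | rel R ts =>
    cases R
    rw [tr, freeVars_fm]
    exact Set.union_subset (termVars_trTerm _) (termVars_trTerm _)
  | imp φ ψ h1 h2 => rw [tr, freeVars_imp]; exact Set.union_subset h1 h2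
  | all φ ih =>
    rw [tr, freeVars_all₁]
    rintro p ⟨hp, hpn⟩
    obtain ⟨i, hi, rfl⟩ := ih hp
    refine ⟨i, lt_of_le_of_ne (Nat.lt_succ_iff.1 hi) ?_, rfl⟩
    rintro rfl
    exact hpn rfl

theorem realize_trTerm {A : Type u} [(diagLang C).Structure A] {n : ℕ}
    (t : setLang.Term (C ⊕ Fin n)) (f : V → A) :
    (trTerm t : (diagLang C).Term V).realize f =
      @Language.Term.realize setLang A (epsStructure (dE C)) _
        (Sum.elim (dC A) fun i : Fin n => f (vr i)) t := by
  rcases t with (c | i) | ⟨f⟩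
  · rw [trTerm, realize_tC]; rfl
  · rfl
  · exact nomatch f

theorem realize_tr {A : Type u} [(diagLang C).Structure A] {n : ℕ}
    (φ : setLang.BoundedFormula C n) (v : ∀ p : ℕ × V, IterPow A p.1) :
    (tr φ).Realize A v ↔ @Language.BoundedFormula.Realize setLang A (epsStructure (dE C)) _ _ φ
      (dC A) fun i => ev₀ v (vr i) := by
  let _ := epsStructure (dE C (A := A))
  induction φ generalizing v with
  | falsum => exact ⟨fun ⟨k, _⟩ => k.2.elim, False.elim⟩
  | equal t s =>
    rw [tr, realize_eq, realize_trTerm, realize_trTerm]; rfl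
  | rel R ts =>
    cases R
    rw [tr, realize_fm, realize_trTerm, realize_trTerm]; rfl
  | imp φ ψ h1 h2 => rw [tr, realize_imp]; exact imp_congr (h1 v) (h2 v)
  | all φ ih =>
    rw [tr, realize_all_zero]
    refine forall_congr' fun a => ?_
    refine (ih _).trans (iff_of_eq (congrArg _ ?_))
    funext i
    rw [ev₀_upd₀]
    refine Fin.lastCases ?_ (fun i => ?_) i
    · simp
    · simp [i.2.ne]

/-! #### The axioms -/

/-- Extensionality. -/
noncomputable def axExt : HOForm (diagLang C) V :=
  all₁ 0 0 <| all₁ 0 1 <| imp (all₁ 0 2 <| imp (fm (tv 2) (tv 0)) (fm (tv 2) (tv 1))) <|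
    imp (all₁ 0 2 <| imp (fm (tv 2) (tv 1)) (fm (tv 2) (tv 0))) (.eq (tv 0) (tv 1))

/-- Well-foundedness, as a second-order axiom. -/
noncomputable def axWF : HOForm (diagLang C) V :=
  all₁ 1 0 <| imp
    (all₁ 0 0 <| imp (.memTerm (tv 0) (vr 0)) <| .neg <|
      all₁ 0 1 <| imp (fm (tv 1) (tv 0)) <| .neg <| .memTerm (tv 1) (vr 0))
    (all₁ 0 0 <| .neg <| .memTerm (tv 0) (vr 0))

/-- Second-order separation. -/
noncomputable def axSep : HOForm (diagLang C) V :=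
  all₁ 1 0 <| all₁ 0 0 <| .neg <| all₁ 0 1 <|
    imp (all₁ 0 2 <| imp (fm (tv 2) (tv 1)) (fm (tv 2) (tv 0))) <|
    imp (all₁ 0 2 <| imp (fm (tv 2) (tv 1)) (.memTerm (tv 2) (vr 0))) <|
    .neg <| all₁ 0 2 <| imp (fm (tv 2) (tv 0)) <| imp (.memTerm (tv 2) (vr 0)) (fm (tv 2) (tv 1))

/-- `y ∈ rk x` implies that `y ⊆ rk z` for some `z ∈ x`. -/
noncomputable def axRk : HOForm (diagLang C) V :=
  all₁ 0 0 <| all₁ 0 1 <| imp (fm (tv 1) (tR (tv 0))) <| .neg <| all₁ 0 2 <|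
    imp (fm (tv 2) (tv 0)) <| .neg <| all₁ 0 3 <| imp (fm (tv 3) (tv 1)) (fm (tv 3) (tR (tv 2)))

/-- `y ∈ rk x` holds whenever `y ⊆ rk z` for some `z ∈ x`. -/
noncomputable def axRk' : HOForm (diagLang C) V :=
  all₁ 0 0 <| all₁ 0 1 <| all₁ 0 2 <| imp (fm (tv 2) (tv 0)) <|
    imp (all₁ 0 3 <| imp (fm (tv 3) (tv 1)) (fm (tv 3) (tR (tv 2)))) (fm (tv 1) (tR (tv 0)))

/-- Every element of `c` is one of the constants listed by `g`. -/
noncomputable def axBound {Y : Type u} (e : Y ↪ V) (c : C) (g : Y → C) : HOForm (diagLang C) V :=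
  all₁ 0 0 <| imp (fm (tv 0) (tC c)) <| iDisj e fun y => .eq (tv 0) (tC (g y))

section

variable {A : Type u} [(diagLang C).Structure A] {v : ∀ p : ℕ × V, IterPow A p.1}

theorem realize_axExt : (axExt (C := C)).Realize A v ↔
    ∀ x y : A, (∀ z, dE C z x → dE C z y) → (∀ z, dE C z y → dE C z x) → x = y := by
  simp [axExt, realize_all_zero, realize_imp, realize_fm, realize_eq, realize_tv, ev₀_upd₀]

theorem realize_axWF : (axWF (C := C)).Realize A v ↔
    ∀ X : Set A, (∀ x, x ∈ X → ¬ ∀ y, dE C y x → y ∉ X) → ∀ x, x ∉ X := by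
  simp [axWF, realize_all_zero, realize_all_one, realize_imp, realize_fm, realize_memTerm,
    realize_neg, realize_tv, ev₀_upd₀, ev₁_upd₀, ev₁_upd₁]

theorem realize_axSep : (axSep (C := C)).Realize A v ↔
    ∀ (X : Set A) (a : A), ¬ ∀ b, (∀ x, dE C x b → dE C x a) → (∀ x, dE C x b → x ∈ X) →
      ¬ ∀ x, dE C x a → x ∈ X → dE C x b := by
  simp [axSep, realize_all_zero, realize_all_one, realize_imp, realize_fm, realize_memTerm,
    realize_neg, realize_tv, ev₀_upd₀, ev₁_upd₀, ev₁_upd₁]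

theorem realize_axRk : (axRk (C := C)).Realize A v ↔
    ∀ x y : A, dE C y (dR C x) → ¬ ∀ z, dE C z x → ¬ ∀ w, dE C w y → dE C w (dR C z) := by
  simp [axRk, realize_all_zero, realize_imp, realize_fm, realize_neg, realize_tv, ev₀_upd₀]

theorem realize_axRk' : (axRk' (C := C)).Realize A v ↔
    ∀ x y z : A, dE C z x → (∀ w, dE C w y → dE C w (dR C z)) → dE C y (dR C x) := by
  simp [axRk', realize_all_zero, realize_imp, realize_fm, realize_tv, ev₀_upd₀]

theorem realize_axBound {Y : Type u} (e : Y ↪ V) (c : C) (g : Y → C) :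
    (axBound e c g).Realize A v ↔ ∀ x : A, dE C x (dC A c) → ∃ y, x = dC A (g y) := by
  simp [axBound, realize_all_zero, realize_imp, realize_fm, realize_eq, realize_tv, ev₀_upd₀,
    realize_iDisj]

end

theorem isFormula_axioms {κ : Cardinal.{u}} (hκ : ℵ₀ ≤ κ) :
    (axExt : HOForm (diagLang C) V).IsFormula 2 κ ℵ₀ ∧
    (axWF : HOForm (diagLang C) V).IsFormula 2 κ ℵ₀ ∧
    (axSep : HOForm (diagLang C) V).IsFormula 2 κ ℵ₀ ∧
    (axRk : HOForm (diagLang C) V).IsFormula 2 κ ℵ₀ ∧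
    (axRk' : HOForm (diagLang C) V).IsFormula 2 κ ℵ₀ := by
  have h0 : ((0 : ℕ) : ℕ∞) < 2 := by norm_num
  have h1 : ((1 : ℕ) : ℕ∞) < 2 := by norm_num
  refine ⟨?_, ?_, ?_, ?_, ?_⟩ <;>
    repeat' first
      | exact isFormula_fm _ _
      | exact isFormula_eq _ _
      | exact isFormula_memTerm _ _
      | refine isFormula_imp hκ ?_ ?_
      | refine isFormula_all₁ h0 ?_
      | refine isFormula_all₁ h1 ?_
      | refine isFormula_neg ?_

theorem freeVars_axioms :
    (axExt : HOForm (diagLang C) V).freeVars = ∅ ∧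
    (axWF : HOForm (diagLang C) V).freeVars = ∅ ∧
    (axSep : HOForm (diagLang C) V).freeVars = ∅ ∧
    (axRk : HOForm (diagLang C) V).freeVars = ∅ ∧
    (axRk' : HOForm (diagLang C) V).freeVars = ∅ := by
  refine ⟨?_, ?_, ?_, ?_, ?_⟩ <;>
  · rw [Set.eq_empty_iff_forall_notMem]
    rintro ⟨i, x⟩
    simp only [axExt, axWF, axSep, axRk, axRk', freeVars_all₁, freeVars_imp, freeVars_fm,
      HOForm.freeVars, termVars_tv, termVars_tR, Set.mem_sdiff, Set.mem_union,
      Set.mem_singleton_iff]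
    tauto

theorem isFormula_axBound {κ : Cardinal.{u}} (hκ : ℵ₀ ≤ κ) {Y : Type u} (hY : #Y < κ) (e : Y ↪ V)
    (c : C) (g : Y → C) : (axBound e c g).IsFormula 2 κ ℵ₀ := by
  refine isFormula_all₁ (by norm_num) (isFormula_imp hκ (isFormula_fm _ _)
    (isFormula_iDisj hY ?_ fun _ => isFormula_eq _ _))
  rw [Cardinal.lt_aleph0_iff_set_finite]
  refine (Set.finite_singleton ((0, vr 0) : ℕ × V)).subset (Set.iUnion_subset fun y => ?_)
  simp [HOForm.freeVars, termVars_tv, termVars_tC]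

theorem freeVars_axBound {Y : Type u} (e : Y ↪ V) (c : C) (g : Y → C) :
    (axBound e c g).freeVars = ∅ := by
  rw [Set.eq_empty_iff_forall_notMem]
  rintro ⟨i, x⟩
  simp [axBound, freeVars_all₁, freeVars_imp, freeVars_fm, freeVars_iDisj,
    HOForm.freeVars, termVars_tv, termVars_tC]
  rintro rfl - rfl
  exact ⟨rfl, rfl⟩

end Diag

/-! ### From weak compactness to weak extendibility -/

namespace Diag

open HOForm

variable {C V : Type u}

/-- The sentence `c ∈ star`. -/
def axStar (c : C) : HOForm (diagLang C) V := fm (tC c) tS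

/-- The sentence `star ∈ c`. -/
def axStar' (c : C) : HOForm (diagLang C) V := fm tS (tC c)

theorem axStar_injective : (axStar : C → HOForm (diagLang C) V).Injective := by
  intro c d h
  injection h with _ _ h
  have h0 := congrFun h 0
  injection h0 with _ h1
  injection h1

end Diag

open Diag HOForm in
/-- If `κ` belongs to the weak compactness spectrum of `L^II_{κ, ω}`, every structure `M ≺ V_ θ` as in
the definition of weak extendibility has the required embedding.  The theory consists of the
elementary diagram of `M`, the characterization of the levels `V_ θ'`, the sentences fixing the
ordinals below `κ`, and the sentences putting the new constant above all of them but below the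
constant for `κ`. -/
theorem exists_embedding_of_mem_WCS {κ : Cardinal.{u}} (h : κ ∈ WCS 2 κ ℵ₀) {θ : Ordinal.{u}}
    {M : ZFSet.{u}} (hM : IsElemSub M (V_ θ)) (hκM : (κ.ord + 1).toZFSet ⊆ M)
    (hMc : M.card = κ) : ∃ (θ' : Ordinal.{u}) (j : M ↪ₑ[setLang] V_ θ'), IsEmbeddingAt κ j := by
  have hκ : ℵ₀ ≤ κ := h.1.le
  have hreg := isRegular_of_mem_WCS aleph0_pos h
  have hinf : Infinite κ.out := by rw [infinite_iff, mk_out]; exact hκ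
  obtain ⟨i, hi⟩ := hM
  have hMV : ∀ x ∈ M, x ∈ V_ θ := fun x hx => by
    have := (i ⟨x, hx⟩).2
    rwa [hi] at this
  -- the constants are indexed by a copy of `M` in the right universe
  let C : Type u := Shrink.{u} M
  let val : C → ZFSet.{u} := fun c => ((equivShrink M).symm c : M)
  have hval : val.Injective := fun c d hcd => (equivShrink M).symm.injective (Subtype.ext hcd)
  have hvalM : ∀ c, val c ∈ M := fun c => ((equivShrink M).symm c).2
  have hsurj : ∀ x ∈ M, ∃ c, val c = x := fun x hx => ⟨equivShrink M ⟨x, hx⟩, by simp [val]⟩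
  obtain ⟨k, hk⟩ := hsurj (cardSet κ) (hκM (mem_cardSet_succ.2 (Or.inl rfl)))
  -- the ordinals below `κ`, and the members of each of them
  let K : Type u := {c : C // val c ∈ cardSet κ}
  let Y : K → Type u := fun a => {c : C // val c ∈ val a.1}
  have hY : ∀ a, #(Y a) < κ := by
    intro a
    obtain ⟨o, ho, hoa⟩ := Ordinal.mem_toZFSet_iff.1 a.2
    have h1 : #(Y a) ≤ (val a.1).card := Cardinal.mk_le_of_injective
      (f := fun y : Y a => equivShrink (val a.1) ⟨val y.1, y.2⟩) fun y z hyz => by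
        have := (equivShrink _).injective hyz
        have h3 : val y.1 = val z.1 := congrArg (fun t : val a.1 => (t : ZFSet)) this
        exact Subtype.ext (hval h3)
    refine h1.trans_lt ?_
    rw [← hoa, Ordinal.card_toZFSet]
    exact lt_ord.1 ho
  let e : ∀ a, Y a ↪ κ.out := fun a => (exists_embedding_out (hY a)).some
  let bd : K → RawForm (diagLang C) κ := fun a => axBound (e a) a.1 fun y => y.1
  let st : K → RawForm (diagLang C) κ := fun a => axStar a.1
  let dg : Set (RawForm (diagLang C) κ) :=
    {ψ | ∃ φ : setLang.Formula C, @Language.Formula.Realize setLang M _ _ φ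
      (fun c => (equivShrink M).symm c) ∧ ψ = tr φ}
  let T : Set (RawForm (diagLang C) κ) :=
    {axExt, axWF, axSep, axRk, axRk', axStar' k} ∪ Set.range bd ∪ Set.range st ∪ dg
  have hTs : ∀ φ ∈ T, IsSentenceOf 2 κ ℵ₀ φ := by
    obtain ⟨h1, h2, h3, h4, h5⟩ := isFormula_axioms (C := C) (V := κ.out) hκ
    obtain ⟨f1, f2, f3, f4, f5⟩ := freeVars_axioms (C := C) (V := κ.out)
    rintro φ (((h | ⟨a, rfl⟩) | ⟨a, rfl⟩) | ⟨ψ, -, rfl⟩)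
    · rcases h with rfl | rfl | rfl | rfl | rfl | rfl
      · exact ⟨h1, f1⟩
      · exact ⟨h2, f2⟩
      · exact ⟨h3, f3⟩
      · exact ⟨h4, f4⟩
      · exact ⟨h5, f5⟩
      · exact ⟨trivial, by rw [axStar', freeVars_fm, termVars_tC, termVars_tS, Set.union_self]⟩
    · exact ⟨isFormula_axBound hκ (hY a) _ _ _, freeVars_axBound _ _ _⟩
    · exact ⟨trivial, by
        simp only [st]; rw [axStar, freeVars_fm, termVars_tC, termVars_tS, Set.union_self]⟩
    · refine ⟨isFormula_tr hκ ψ, Set.eq_empty_of_subset_empty ((freeVars_tr ψ).trans ?_)⟩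
      rintro p ⟨i, hi, -⟩
      exact absurd hi (Nat.not_lt_zero i)
  have hsat : IsLTSatisfiable κ T := by
    intro T₀ hT₀ hlt
    -- an ordinal below `κ` above all those that `T₀` puts below the new constant
    obtain ⟨s, hs, hsT⟩ : ∃ s ∈ cardSet κ, ∀ a : K, st a ∈ T₀ → val a.1 ∈ s := by
      let I : Type u := {a : K // st a ∈ T₀}
      have hI : #I < κ := by
        refine lt_of_le_of_lt (Cardinal.mk_le_of_injective
          (f := fun a : I => (⟨st a.1, a.2⟩ : T₀)) fun a b hab => ?_) hlt
        exact Subtype.ext (Subtype.ext (axStar_injective (congrArg Subtype.val hab)))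
      choose o ho hoa using fun a : I => Ordinal.mem_toZFSet_iff.1 a.1.2
      have hsup : (⨆ a, Order.succ (o a)) < κ.ord :=
        Ordinal.iSup_lt_of_lt_cof (by rwa [hreg.cof_ord]) fun a =>
          (isSuccLimit_ord hκ).succ_lt (ho a)
      refine ⟨_, Ordinal.toZFSet_mem_toZFSet_iff.2 hsup, fun a ha => ?_⟩
      rw [← hoa ⟨a, ha⟩, Ordinal.toZFSet_mem_toZFSet_iff]
      exact (Order.lt_succ _).trans_le (Ordinal.le_iSup (fun a => Order.succ (o a)) ⟨a, ha⟩)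
    have hsV : s ∈ V_ θ := hMV s (hκM (mem_cardSet_succ.2 (Or.inr hs)))
    -- `V_ θ`, with `s` as the value of the new constant, is a model of `T₀`
    let A : Type u := Shrink.{u} (V_ θ)
    let q : A ≃ V_ θ := (equivShrink (V_ θ)).symm
    have htr : ∀ {x y : ZFSet.{u}}, x ∈ y → y ∈ V_ θ → x ∈ V_ θ := fun h1 h2 =>
      (ZFSet.isTransitive_vonNeumann θ).subset_of_mem h2 h1
    let E : A → A → Prop := fun x y => (q x : ZFSet) ∈ (q y : ZFSet)
    let r : A → A := fun x => q.symm ⟨V_ (q x).1.rank, by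
      rw [ZFSet.vonNeumann_mem_vonNeumann_iff]; exact ZFSet.mem_vonNeumann.1 (q x).2⟩
    let cst : C → A := fun c => q.symm (i ((equivShrink M).symm c))
    let inst : (diagLang C).Structure A := diagStructure E r cst (q.symm ⟨s, hsV⟩)
    have hE : ∀ x y : A, dE C x y ↔ (q x : ZFSet) ∈ (q y : ZFSet) := fun x y => Iff.rfl
    have hR : ∀ x : A, (q (dR C x) : ZFSet) = V_ (q x).1.rank := fun x => by
      show ((q (r x) : V_ θ) : ZFSet) = _
      simp [r]
    have hC : ∀ c, (q (dC A c) : ZFSet) = val c := fun c => by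
      show ((q (cst c) : V_ θ) : ZFSet) = _
      simp [cst, hi, val]
    have hS : (q (dS C A) : ZFSet) = s := by
      show ((q (q.symm ⟨s, hsV⟩) : V_ θ) : ZFSet) = _
      simp
    have hsubV : ∀ (x y : A), (∀ w, dE C w y → dE C w (dR C x)) ↔
        (q y : ZFSet).rank ≤ (q x : ZFSet).rank := by
      intro x y
      rw [← ZFSet.subset_vonNeumann]
      constructor
      · intro H u hu
        have := H (q.symm ⟨u, htr hu (q y).2⟩) (by rw [hE]; simpa using hu)
        rw [hE, hR] at this
        simpa using this
      · intro H w hw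
        rw [hE, hR]
        exact H ((hE _ _).1 hw)
    refine ⟨A, inst, ⟨q.symm ⟨s, hsV⟩⟩, fun φ hφ v => ?_⟩
    rcases hT₀ hφ with ((h | ⟨a, rfl⟩) | ⟨a, rfl⟩) | ⟨ψ, hψ, rfl⟩
    · rcases h with rfl | rfl | rfl | rfl | rfl | rfl
      · rw [realize_axExt]
        intro x y h1 h2
        apply q.injective
        apply Subtype.ext
        ext z
        constructor
        · intro hz
          simpa [hE] using h1 (q.symm ⟨z, htr hz (q x).2⟩) (by simpa [hE] using hz)
        · intro hz
          simpa [hE] using h2 (q.symm ⟨z, htr hz (q y).2⟩) (by simpa [hE] using hz)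
      · rw [realize_axWF]
        intro X hX x hx
        induction hn : (q x : ZFSet) using ZFSet.inductionOn generalizing x with
        | h z ih =>
          refine hX x hx fun y hy hyX => ?_
          exact ih (q y) (hn ▸ (hE _ _).1 hy) y hyX rfl
      · rw [realize_axSep]
        intro X a H
        let b : ZFSet.{u} := (q a : ZFSet).sep fun z => ∃ x ∈ X, (q x : ZFSet) = z
        have hb : b ∈ V_ θ := ZFSet.mem_vonNeumann_of_subset ZFSet.sep_subset (q a).2
        have hbE : ∀ x, dE C x (q.symm ⟨b, hb⟩) ↔ dE C x a ∧ x ∈ X := by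
          intro x
          rw [hE, hE]
          simp only [Equiv.apply_symm_apply, b, ZFSet.mem_sep]
          refine and_congr_right fun _ => ⟨?_, fun h => ⟨x, h, rfl⟩⟩
          rintro ⟨y, hy, hyx⟩
          rwa [← q.injective (Subtype.ext hyx)]
        exact H (q.symm ⟨b, hb⟩) (fun x hx => ((hbE x).1 hx).1) (fun x hx => ((hbE x).1 hx).2)
          fun x h1 h2 => (hbE x).2 ⟨h1, h2⟩
      · rw [realize_axRk]
        intro x y hy H
        rw [hE, hR, ZFSet.mem_vonNeumann, ZFSet.lt_rank_iff] at hy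
        obtain ⟨z, hz, hyz⟩ := hy
        refine H (q.symm ⟨z, htr hz (q x).2⟩) (by simpa [hE] using hz) ?_
        rw [hsubV]
        simpa using hyz
      · rw [realize_axRk']
        intro x y z hz H
        rw [hsubV] at H
        rw [hE, hR, ZFSet.mem_vonNeumann, ZFSet.lt_rank_iff]
        exact ⟨q z, (hE _ _).1 hz, H⟩
      · exact (realize_fm _ _).2 (by
          rw [realize_tS, realize_tC, hE, hC, hS, hk]; exact hs)
    · rw [realize_axBound]
      intro x hx
      rw [hE, hC] at hx
      obtain ⟨c, hc⟩ := hsurj _ (hκM (mem_cardSet_succ.2 (Or.inr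
        ((ZFSet.isOrdinal_toZFSet _).mem_trans hx a.2))))
      refine ⟨⟨c, hc ▸ hx⟩, q.injective (Subtype.ext ?_)⟩
      rw [hC, hc]
    · exact (realize_fm _ _).2 (by
        rw [realize_tS, realize_tC, hE, hC, hS]; exact hsT a hφ)
    · rw [realize_tr]
      have h1 := (i.map_formula ψ fun c => (equivShrink M).symm c).2 hψ
      let _ := epsStructure (dE C (A := A))
      let q' : A ≃[setLang] V_ θ :=
        { q with
          map_fun' := fun f => nomatch f
          map_rel' := fun {n} R x => by cases R; exact Iff.rfl }
      have h2 := (q'.toElementaryEmbedding.map_formula ψ (dC A)).1 (by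
        convert h1 using 1
        funext c
        apply Subtype.ext
        exact (hC c).trans (hi _).symm)
      rw [Language.Formula.Realize] at h2
      convert h2 using 1
  -- a model of the whole theory, whose collapse is a level `V_ θ'`
  obtain ⟨A, inst, ⟨a₀⟩, hA⟩ := h.2 (diagLang C) (card_diagLang_le hκ hMc.le) T hTs hsat
  let v : ∀ p : ℕ × κ.out, IterPow A p.1 := fun p => Classical.choice (by
    rcases p with ⟨_ | i, _⟩
    · exact ⟨a₀⟩
    · exact ⟨(∅ : Set (IterPow A i))⟩)
  have hT1 : ∀ φ ∈ ({axExt, axWF, axSep, axRk, axRk', axStar' k} : Set (RawForm (diagLang C) κ)),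
      φ.Realize A v := fun φ hφ => hA φ (Or.inl (Or.inl (Or.inl hφ))) v
  simp only [Set.mem_insert_iff, Set.mem_singleton_iff, forall_eq_or_imp, forall_eq] at hT1
  obtain ⟨a1, a2, a3, a4, a5, a6⟩ := hT1
  rw [realize_axExt] at a1
  rw [realize_axWF] at a2
  rw [realize_axSep] at a3
  rw [realize_axRk] at a4
  rw [realize_axRk'] at a5
  have a6 : dE C (dS C A) (dC A k) := by
    have := (realize_fm _ _).1 a6
    rwa [realize_tS, realize_tC] at this
  have a7 : ∀ a : K, ∀ x : A, dE C x (dC A a.1) → ∃ y : Y a, x = dC A y.1 := fun a =>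
    (realize_axBound _ _ _).1 (hA (bd a) (Or.inl (Or.inl (Or.inr ⟨a, rfl⟩))) v)
  have a8 : ∀ a : K, dE C (dC A a.1) (dS C A) := fun a => by
    have := (realize_fm _ _).1 (hA (st a) (Or.inl (Or.inr ⟨a, rfl⟩)) v)
    rwa [realize_tS, realize_tC] at this
  let _ := epsStructure (dE C (A := A))
  have a9 : ∀ φ : setLang.Formula C, @Language.Formula.Realize setLang M _ _ φ
      (fun c => (equivShrink M).symm c) →
      φ.Realize (dC A) := by
    intro φ hφ
    have := (realize_tr _ _).1 (hA (tr φ) (Or.inr ⟨φ, hφ, rfl⟩) v)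
    rw [Language.Formula.Realize]
    convert this using 1
  obtain ⟨θ', π, hπ⟩ := exists_equiv_vonNeumann (dE C (A := A)) (dR C) a1 a2
    (fun X a => by
      by_contra! hcon
      refine a3 X a fun b h1 h2 h3 => ?_
      obtain ⟨x, hx⟩ := hcon b
      have := h1 x; have := h2 x; have := h3 x
      tauto)
    (fun x y => ⟨fun h => by
      have := a4 x y h
      push Not at this
      exact this, fun ⟨z, hz, h⟩ => a5 x y z hz h⟩)
  let π' : A ≃[setLang] V_ θ' :=
    { π with
      map_fun' := fun f => nomatch f
      map_rel' := fun {n} R x => by cases R; exact (hπ _ _).symm }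
  let j : M ↪ₑ[setLang] V_ θ' :=
    { toFun := fun x => π (dC A (equivShrink M x))
      map_formula' := by
        have key : ∀ (φ : setLang.Formula C), φ.Realize (fun c => (equivShrink M).symm c) →
            φ.Realize fun c => π (dC A c) := fun φ hφ =>
          (π'.toElementaryEmbedding.map_formula φ (dC A)).2 (a9 φ hφ)
        intro n φ x
        have key' : ∀ ψ : setLang.Formula (Fin n), ψ.Realize x →
            ψ.Realize fun m => π (dC A (equivShrink M (x m))) := by
          intro ψ hψ
          have := key (ψ.relabel fun m => equivShrink M (x m)) (by
            rw [Language.Formula.realize_relabel]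
            convert hψ using 1
            funext m
            simp)
          rwa [Language.Formula.realize_relabel] at this
        constructor
        · intro h1
          by_contra h2
          exact absurd h1 (by
            have := key' φ.not (by rwa [Language.Formula.realize_not])
            rwa [Language.Formula.realize_not] at this)
        · exact key' φ }
  have hj : ∀ c, (j ((equivShrink M).symm c) : ZFSet) = π (dC A c) := fun c => by
    show ((π (dC A (equivShrink M ((equivShrink M).symm c))) : V_ θ') : ZFSet) = _
    simp
  have hjmem : ∀ c d, val c ∈ val d → (π (dC A c) : ZFSet) ∈ (π (dC A d) : ZFSet) := by
    intro c d hcd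
    have := (j.map_rel memSymb ![(equivShrink M).symm c, (equivShrink M).symm d]).2 hcd
    have h2 : (j ((equivShrink M).symm c) : ZFSet) ∈ (j ((equivShrink M).symm d) : ZFSet) := this
    rwa [hj, hj] at h2
  have htr : ∀ {x y : ZFSet.{u}}, x ∈ y → y ∈ V_ θ' → x ∈ V_ θ' := fun h1 h2 =>
    (ZFSet.isTransitive_vonNeumann θ').subset_of_mem h2 h1
  -- the ordinals below `κ` are fixed
  have hfix : ∀ c, val c ∈ cardSet κ → (π (dC A c) : ZFSet) = val c := by
    intro c
    induction hn : val c using ZFSet.inductionOn generalizing c with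
    | h z ih =>
      subst hn
      intro hc
      ext w
      constructor
      · intro hw
        obtain ⟨y, hy⟩ := a7 ⟨c, hc⟩ (π.symm ⟨w, htr hw (π _).2⟩) (by
          rw [hπ]; simpa using hw)
        have hyw : (π (dC A y.1) : ZFSet) = w := by rw [← hy]; simp
        rw [← hyw, ih _ y.2 y.1 rfl ((ZFSet.isOrdinal_toZFSet _).mem_trans y.2 hc)]
        exact y.2
      · intro hw
        have hwκ : w ∈ cardSet κ := (ZFSet.isOrdinal_toZFSet _).mem_trans hw hc
        obtain ⟨d, rfl⟩ := hsurj w (hκM (mem_cardSet_succ.2 (Or.inr hwκ)))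
        have := hjmem d c hw
        rwa [ih _ hw d rfl hwκ] at this
  -- being an ordinal is first-order, and hence preserved by the embedding
  have hkord : (π (dC A k) : ZFSet).IsOrdinal := by
    have hdef : SetDef (α := Unit) fun N v =>
        (∀ x ∈ N, x ∈ v () → ∀ y ∈ N, y ∈ x → y ∈ v ()) ∧
        ∀ x ∈ N, x ∈ v () → ∀ y ∈ N, y ∈ x → ∀ z ∈ N, z ∈ y → z ∈ x := by
      repeat' first
        | exact SetDef.mem _ _
        | refine SetDef.and ?_ ?_
        | refine SetDef.all ?_
        | refine SetDef.imp ?_ ?_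
    obtain ⟨φ, hφ⟩ := hdef
    have hord := ZFSet.isOrdinal_toZFSet κ.ord
    have h1 := (hφ θ fun _ => i ((equivShrink M).symm k)).2 (by
      have hik : ((i ((equivShrink M).symm k) : V_ θ) : ZFSet) = κ.ord.toZFSet := (hi _).trans hk
      simp only [hik]
      exact ⟨fun x _ hx y _ hy => hord.mem_trans hy hx,
        fun x _ hx y _ hy z _ hz => (hord.mem hx).mem_trans hz hy⟩)
    have h2 := (hφ θ' fun _ => j ((equivShrink M).symm k)).1
      ((j.map_formula φ _).2 ((i.map_formula φ _).1 h1))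
    simp only [hj] at h2
    refine ZFSet.isOrdinal_iff_forall_mem_isTransitive.2 ⟨fun x hx y hy => ?_, fun x hx y hy z hz => ?_⟩
    · exact h2.1 x (htr hx (π _).2) hx y (htr hy (htr hx (π _).2)) hy
    · have hxV := htr hx (π (dC A k)).2
      exact h2.2 x hxV hx y (htr hy hxV) hy z (htr hz (htr hy hxV)) hz
  have hsκ : cardSet κ ⊆ (π (dS C A) : ZFSet) := by
    intro w hw
    obtain ⟨d, rfl⟩ := hsurj w (hκM (mem_cardSet_succ.2 (Or.inr hw)))
    have := (hπ _ _).1 (a8 ⟨d, hw⟩)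
    rwa [hfix d hw] at this
  have hκj : cardSet κ ∈ (π (dC A k) : ZFSet) :=
    (ZFSet.isOrdinal_toZFSet _).mem_of_subset_of_mem hkord hsκ ((hπ _ _).1 a6)
  refine ⟨θ', j, hκM, ?_, ?_, ?_⟩
  · have hκV : cardSet κ ∈ V_ θ' := htr hκj (π _).2
    intro x hx
    rcases mem_cardSet_succ.1 hx with rfl | hx
    · exact hκV
    · exact htr hx hκV
  · intro x hx
    obtain ⟨c, hc⟩ := hsurj x x.2
    have hcx : (equivShrink M).symm c = x := Subtype.ext hc
    rw [← hcx, hj, hfix c (hc ▸ hx)]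
  · intro x hx
    have hkx : (equivShrink M).symm k = x := Subtype.ext (hk.trans hx.symm)
    rw [← hkx, hj]
    exact hκj

theorem isWeaklyExtendible_of_mem_WCS {κ : Cardinal.{u}} (h : κ ∈ WCS 2 κ ℵ₀) :
    IsWeaklyExtendible κ :=
  ⟨eq_two_powerlt_of_mem_WCS aleph0_pos h, fun _ _ _ hM hκM hMc =>
    exists_embedding_of_mem_WCS h hM hκM hMc⟩

/-! ### Arithmetic of weakly extendible cardinals -/

/-- Every type can be enumerated by the elements of its cardinal. -/
theorem exists_code (I : Type u) :
    ∃ o : I → ZFSet.{u}, o.Injective ∧ ∀ x, x ∈ cardSet #I ↔ ∃ i, o i = x := by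
  obtain ⟨e⟩ : Nonempty (I ≃ (#I).ord.ToType) := Cardinal.eq.1 (by simp)
  refine ⟨fun i => (e i).toOrd.1.toZFSet, fun i j h => e.injective
    (Ordinal.ToType.mk.symm.injective (Subtype.ext (Ordinal.toZFSet_injective h))), fun x => ?_⟩
  rw [cardSet, Ordinal.mem_toZFSet_iff]
  constructor
  · rintro ⟨a, ha, rfl⟩
    exact ⟨e.symm (Ordinal.ToType.mk ⟨a, ha⟩), by simp⟩
  · rintro ⟨i, rfl⟩
    exact ⟨_, (e i).toOrd.2, rfl⟩

theorem notMem_cardSet_self (κ : Cardinal.{u}) : cardSet κ ∉ cardSet κ := ZFSet.mem_irrefl _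

theorem mem_cardSet_of_lt {κ c : Cardinal.{u}} (h : c < κ) : cardSet c ∈ cardSet κ :=
  Ordinal.toZFSet_mem_toZFSet_iff.2 (ord_lt_ord.2 h)

/-- The critical point of an embedding is not `ω`, as every member of `ω` is zero or a successor. -/
theorem IsWeaklyExtendible.aleph0_lt {κ : Cardinal.{u}} (h : IsWeaklyExtendible κ) (hκ : ℵ₀ ≤ κ) :
    ℵ₀ < κ := by
  refine lt_of_le_of_ne hκ ?_
  rintro rfl
  obtain ⟨θ, θ', M, J, R, -⟩ := h.exists_reflection hκ (ι := PEmpty) (fun i => nomatch i) (by simp)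
  have hdef : SetDef (α := Unit) fun N v => ∀ x ∈ N, x ∈ v () → x = ∅ ∨
      ∃ y ∈ N, y ∈ x ∧ ∀ z ∈ N, z ∈ x → z ∈ y ∨ z = y := by
    repeat' first
      | exact SetDef.mem _ _
      | exact SetDef.eq _ _
      | exact SetDef.eqEmpty _
      | refine SetDef.and ?_ ?_
      | refine SetDef.or ?_ ?_
      | refine SetDef.all ?_
      | refine SetDef.imp ?_ ?_
      | refine SetDef.ex ?_
  have h1 := (R.transfer hdef (fun _ => cardSet ℵ₀) fun _ => R.card_mem).1 (by
    intro x hxV hx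
    obtain ⟨a, ha, rfl⟩ := Ordinal.mem_toZFSet_iff.1 hx
    rw [ord_aleph0] at ha
    obtain ⟨n, rfl⟩ := Ordinal.lt_omega0.1 ha
    rcases n with _ | n
    · left; simp
    · right
      have hs : ((n + 1 : ℕ) : Ordinal.{u}).toZFSet =
          insert (n : Ordinal.{u}).toZFSet (n : Ordinal.{u}).toZFSet := by
        rw [Nat.cast_add, Nat.cast_one, Ordinal.toZFSet_add_one]
      rw [hs] at hxV ⊢
      exact ⟨_, SetDef.mem_level_of_mem (ZFSet.mem_insert _ _) hxV, ZFSet.mem_insert _ _,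
        fun z _ hz => (ZFSet.mem_insert_iff.1 hz).symm⟩)
  have hJ := R.map_mem _ R.card_mem
  rcases h1 _ (SetDef.mem_level_of_mem R.lt_map hJ) R.lt_map with h0 | ⟨y, -, hy, h2⟩
  · have : (∅ : ZFSet) ∈ cardSet ℵ₀ := by
      rw [← Ordinal.toZFSet_zero, cardSet, Ordinal.toZFSet_mem_toZFSet_iff]; simp
    rw [h0] at this
    exact ZFSet.notMem_empty _ this
  · obtain ⟨a, ha, rfl⟩ := Ordinal.mem_toZFSet_iff.1 hy
    have hsucc : (Order.succ a).toZFSet ∈ cardSet ℵ₀ :=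
      Ordinal.toZFSet_mem_toZFSet_iff.2 ((isSuccLimit_ord hκ).succ_lt ha)
    rcases h2 _ (SetDef.mem_level_of_mem hsucc (SetDef.mem_level_of_mem R.lt_map hJ)) hsucc
      with h3 | h3
    · exact absurd (Ordinal.toZFSet_mem_toZFSet_iff.1 h3) (Order.le_succ a).not_gt
    · exact absurd (Ordinal.toZFSet_injective h3) (Order.lt_succ a).ne'

/-- The critical point `κ` is regular: the embedding fixes pointwise a cofinal map from a smaller
cardinal to `κ`, although it moves `κ`. -/
theorem IsWeaklyExtendible.isRegular {κ : Cardinal.{u}} (h : IsWeaklyExtendible κ)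
    (hκ : ℵ₀ ≤ κ) : κ.IsRegular := by
  refine ⟨hκ, ?_⟩
  by_contra! hcof
  obtain ⟨s, hs, hsc⟩ := Order.exists_cof_eq κ.ord.ToType
  have hc : #s < κ := by rw [hsc]; simpa using hcof
  obtain ⟨o, hoi, ho⟩ := exists_code s
  let z : κ.ord.ToType → ZFSet.{u} := fun y => y.toOrd.1.toZFSet
  have hz : ∀ y, z y ∈ cardSet κ := fun y => Ordinal.toZFSet_mem_toZFSet_iff.2 y.toOrd.2
  let f : ZFSet.{u} := ZFSet.range fun i : s => ZFSet.pair (o i) (z i)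
  have hf : ∀ x y, ZFSet.pair x y ∈ f ↔ ∃ i : s, o i = x ∧ z i = y := by
    intro x y
    rw [ZFSet.mem_range]
    exact exists_congr fun i => ZFSet.pair_inj
  obtain ⟨θ, θ', M, J, R, hM⟩ := h.exists_reflection hκ (ι := PUnit) (fun _ => f)
    (by rw [mk_punit]; exact one_le_aleph0.trans hκ)
  have hfM : f ∈ M := hM ⟨⟩
  have hfV : f ∈ V_ θ := R.subset hfM
  have hsm : cardSet #s ∈ cardSet κ := mem_cardSet_of_lt hc
  have hdef : SetDef (α := Fin 3) fun N v => ∀ x ∈ N, x ∈ v 0 → ∃ i ∈ N, i ∈ v 1 ∧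
      ∃ y ∈ N, ZFSet.pair i y ∈ v 2 ∧ (x ∈ y ∨ x = y) := by
    repeat' first
      | exact SetDef.mem _ _
      | exact SetDef.eq _ _
      | exact SetDef.pairMem _ _ _
      | refine SetDef.and ?_ ?_
      | refine SetDef.or ?_ ?_
      | refine SetDef.all ?_
      | refine SetDef.imp ?_ ?_
      | refine SetDef.ex ?_
  have h1 := (R.transfer hdef ![cardSet κ, cardSet #s, f] (by
    intro a
    fin_cases a
    · exact R.card_mem
    · exact R.mem_of_lt _ hsm
    · exact hfM)).1 (by
    intro x _ hx
    change x ∈ cardSet κ at hx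
    obtain ⟨a, ha, rfl⟩ := Ordinal.mem_toZFSet_iff.1 hx
    obtain ⟨w, hw, hyw⟩ := hs (Ordinal.ToType.mk ⟨a, ha⟩)
    have haw : a ≤ w.toOrd.1 := by
      have := Ordinal.ToType.mk.symm.monotone hyw
      rwa [OrderIso.symm_apply_apply] at this
    have hp : ZFSet.pair (o ⟨w, hw⟩) (z w) ∈ f := (hf _ _).2 ⟨⟨w, hw⟩, rfl, rfl⟩
    have hpV := SetDef.mem_level_of_mem hp hfV
    refine ⟨_, SetDef.fst_mem_level hpV, (ho _).2 ⟨_, rfl⟩, _, SetDef.snd_mem_level hpV, hp, ?_⟩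
    rcases haw.lt_or_eq with h | h
    · exact Or.inl (Ordinal.toZFSet_mem_toZFSet_iff.2 h)
    · exact Or.inr (congrArg Ordinal.toZFSet h))
  obtain ⟨i, -, hi, y, hyV, hp, hκy⟩ := h1 (cardSet κ)
    (SetDef.mem_level_of_mem R.lt_map (R.map_mem _ R.card_mem)) R.lt_map
  change i ∈ J (cardSet #s) at hi
  change ZFSet.pair i y ∈ J f at hp
  rw [R.map_lt _ hsm, ho] at hi
  obtain ⟨t, rfl⟩ := hi
  have hot : o t ∈ cardSet κ := (ZFSet.isOrdinal_toZFSet _).mem_trans ((ho _).2 ⟨t, rfl⟩) hsm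
  have hdef2 : SetDef (α := Fin 3) fun N v => ∀ y ∈ N, ZFSet.pair (v 0) y ∈ v 2 → y = v 1 := by
    repeat' first
      | exact SetDef.eq _ _
      | exact SetDef.pairMem _ _ _
      | refine SetDef.all ?_
      | refine SetDef.imp ?_ ?_
  have h2 := (R.transfer hdef2 ![o t, z t, f] (by
    intro a
    fin_cases a
    · exact R.mem_of_lt _ hot
    · exact R.mem_of_lt _ (hz t)
    · exact hfM)).1 (by
    intro y _ hy
    obtain ⟨t', ht', rfl⟩ := (hf _ _).1 hy
    exact congrArg (fun i : s => z i) (hoi ht'))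
  have hy : y = J (z t) := h2 y hyV (by
    change ZFSet.pair (J (o t)) y ∈ J f
    rwa [R.map_lt _ hot])
  rw [R.map_lt _ (hz t)] at hy
  subst hy
  rcases hκy with h | h
  · exact ZFSet.mem_asymm h (hz t)
  · exact notMem_cardSet_self κ (h ▸ hz t)

theorem IsWeaklyExtendible.power_le {κ c : Cardinal.{u}} (h : IsWeaklyExtendible κ)
    (hκ : ℵ₀ ≤ κ) (hc : c < κ) : κ ^ c ≤ κ := by
  have hreg := h.isRegular hκ
  have hlt : ∀ d < κ, d ^ c ≤ κ := by
    intro d hd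
    calc d ^ c ≤ (2 ^ d) ^ c := power_le_power_right (cantor d).le
      _ = 2 ^ (d * c) := (power_mul).symm
      _ ≤ 2 ^< κ := le_powerlt 2 (mul_lt_of_lt hκ hd hc)
      _ = κ := h.1.symm
  let I := c.out
  have hI : #I < κ := by rwa [mk_out]
  have hbd : ∀ f : I → κ.ord.ToType, ∃ b, ∀ i, f i < b := by
    intro f
    have : ¬ IsCofinal (Set.range f) := by
      intro hcof
      have h1 := Order.cof_le hcof
      have h2 : Order.cof κ.ord.ToType = κ := by
        have := hreg.cof_ord
        simpa using this
      rw [h2] at h1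
      exact absurd (h1.trans mk_range_le) (not_le.2 hI)
    simpa [IsCofinal] using this
  choose b hb using hbd
  have : #(I → κ.ord.ToType) ≤ #(Σ b : κ.ord.ToType, (I → Set.Iio b)) := by
    refine Cardinal.mk_le_of_injective (f := fun f => ⟨b f, fun i => ⟨f i, hb f i⟩⟩) ?_
    intro f g hfg
    funext i
    have key : ∀ p : Σ b : κ.ord.ToType, (I → Set.Iio b), ∀ q, p = q →
        ((p.2 i : Set.Iio p.1) : κ.ord.ToType) = q.2 i := by rintro p _ rfl; rfl
    exact key _ _ hfg
  calc κ ^ c = #(I → κ.ord.ToType) := by simp [I]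
    _ ≤ _ := this
    _ = Cardinal.sum fun b : κ.ord.ToType => #(Set.Iio b) ^ c := by simp [mk_sigma, I]
    _ ≤ Cardinal.sum fun _ : κ.ord.ToType => κ :=
      Cardinal.sum_le_sum _ _ fun b => hlt _
      ((mk_Iio_lt b (by simp)).trans_eq (by simp))
    _ = κ := by simp [mul_eq_self hκ]

/-! ### The number of formulas -/

namespace HOForm

variable {L : FirstOrder.Language.{u, u}} {V : Type u}

/-- The node labels of the syntax trees of the `(κ, κ)`-infinitary logic. -/
inductive Node (L : FirstOrder.Language.{u, u}) (V : Type u) (κ : Cardinal.{u}) : Type u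
  | eq (t s : L.Term V)
  | rel {n : ℕ} (R : L.Relations n) (ts : Fin n → L.Term V)
  | memTerm (t : L.Term V) (X : V)
  | memVar (i : ℕ) (X Y : V)
  | neg
  | conj (I : {I : Set V // #I < κ})
  | disj (I : {I : Set V // #I < κ})
  | ex (B : {B : Set (ℕ × V) // #B < κ})
  | all (B : {B : Set (ℕ × V) // #B < κ})

/-- The type of the children of a node. -/
def Node.Child {κ : Cardinal.{u}} : Node L V κ → Type u
  | eq _ _ | rel _ _ | memTerm _ _ | memVar _ _ _ => PEmpty
  | neg | ex _ | all _ => PUnit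
  | conj I | disj I => I.1

/-- The syntax tree of a formula. -/
noncomputable def tree {κ : Cardinal.{u}} : ∀ φ : HOForm L V, φ.IsFormula ⊤ κ κ →
    WType (Node.Child (L := L) (V := V) (κ := κ))
  | eq t s, _ => ⟨.eq t s, nofun⟩
  | rel R ts, _ => ⟨.rel R ts, nofun⟩
  | memTerm t X, _ => ⟨.memTerm t X, nofun⟩
  | memVar i X Y, _ => ⟨.memVar i X Y, nofun⟩
  | neg φ, h => ⟨.neg, fun _ => φ.tree h⟩
  | conj I φ, h => ⟨.conj ⟨I, h.1⟩, fun k => (φ k).tree (h.2.2 k)⟩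
  | disj I φ, h => ⟨.disj ⟨I, h.1⟩, fun k => (φ k).tree (h.2.2 k)⟩
  | ex B φ, h => ⟨.ex ⟨B, h.1⟩, fun _ => φ.tree h.2.2⟩
  | all B φ, h => ⟨.all ⟨B, h.1⟩, fun _ => φ.tree h.2.2⟩

theorem tree_injective {κ : Cardinal.{u}} (φ : HOForm L V) (h : φ.IsFormula ⊤ κ κ)
    (ψ : HOForm L V) (h' : ψ.IsFormula ⊤ κ κ) (he : φ.tree h = ψ.tree h') : φ = ψ := by
  induction φ generalizing ψ with
  | eq t s => cases ψ <;> simp [tree] at he ⊢; exact he.1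
  | rel R ts => cases ψ <;> simp [tree] at he ⊢; exact he.1
  | memTerm t X => cases ψ <;> simp [tree] at he ⊢; exact he.1
  | memVar i X Y => cases ψ <;> simp [tree] at he ⊢; exact he.1
  | neg φ ih => 
    cases ψ <;> simp [tree] at he ⊢
    exact ih _ _ _ (congrFun he ⟨⟩)
  | conj I φ ih =>
    cases ψ <;> simp [tree] at he ⊢
    obtain ⟨rfl, he⟩ := he
    exact ⟨rfl, heq_of_eq (funext fun k => ih k _ _ _ (congrFun (eq_of_heq he) k))⟩
  | disj I φ ih =>
    cases ψ <;> simp [tree] at he ⊢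
    obtain ⟨rfl, he⟩ := he
    exact ⟨rfl, heq_of_eq (funext fun k => ih k _ _ _ (congrFun (eq_of_heq he) k))⟩
  | ex B φ ih =>
    cases ψ <;> simp [tree] at he ⊢
    obtain ⟨rfl, he⟩ := he
    exact ⟨rfl, ih _ _ _ (congrFun (eq_of_heq he) ⟨⟩)⟩
  | all B φ ih =>
    cases ψ <;> simp [tree] at he ⊢
    obtain ⟨rfl, he⟩ := he
    exact ⟨rfl, ih _ _ _ (congrFun (eq_of_heq he) ⟨⟩)⟩

theorem mk_subset_lt_le {X : Type u} {κ : Cardinal.{u}} (hκ : ℵ₀ ≤ κ)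
    (hpow : ∀ c < κ, κ ^ c ≤ κ) (hX : #X ≤ κ) : #{I : Set X // #I < κ} ≤ κ := by
  classical
  have hsurj : Function.Surjective
      (fun p : Σ b : κ.ord.ToType, (Set.Iio b → Option X) =>
        (⟨{x | ∃ i, p.2 i = some x}, by
          refine lt_of_le_of_lt (mk_le_of_injective (f := fun x :
            {x | ∃ i, p.2 i = some x} => x.2.choose) fun x y hxy => ?_)
            ((mk_Iio_lt p.1 (by simp)).trans_eq (by simp))
          have h1 := x.2.choose_spec
          have h2 := y.2.choose_spec
          have hxy' : x.2.choose = y.2.choose := hxy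
          rw [hxy', h2] at h1
          exact Subtype.ext (Option.some_injective _ h1.symm)⟩ : {I : Set X // #I < κ})) := by
    rintro ⟨I, hI⟩
    have hI' : (#I).ord < κ.ord := ord_lt_ord.2 hI
    let b : κ.ord.ToType := Ordinal.ToType.mk ⟨(#I).ord, hI'⟩
    obtain ⟨e₀⟩ : Nonempty (I ≃ (#I).ord.ToType) := Cardinal.eq.1 (by simp)
    let e : I → Set.Iio b := fun x => ⟨Ordinal.ToType.mk ⟨_, (e₀ x).toOrd.2.trans hI'⟩,
      Ordinal.ToType.mk.strictMono (e₀ x).toOrd.2⟩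
    have he : e.Injective := fun x y h => by
      have h1 := congrArg Subtype.val (Ordinal.ToType.mk.injective (congrArg Subtype.val h))
      exact e₀.injective (Ordinal.ToType.mk.symm.injective (Subtype.ext h1))
    refine ⟨⟨b, fun i => (Function.partialInv e i).map Subtype.val⟩, Subtype.ext ?_⟩
    ext x
    simp only [Option.map_eq_some_iff, Set.mem_ofPred_eq]
    constructor
    · rintro ⟨i, a, -, rfl⟩
      exact a.2
    · exact fun hx => ⟨e ⟨x, hx⟩, ⟨x, hx⟩, Function.partialInv_left he _, rfl⟩
  refine (mk_le_of_surjective hsurj).trans ?_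
  have hX1 : #X + 1 ≤ κ := add_le_of_le hκ hX (one_le_aleph0.trans hκ)
  calc #(Σ b : κ.ord.ToType, (Set.Iio b → Option X))
      = Cardinal.sum fun b : κ.ord.ToType => (#X + 1) ^ #(Set.Iio b) := by simp [mk_sigma]
    _ ≤ Cardinal.sum fun _ : κ.ord.ToType => κ := Cardinal.sum_le_sum _ _ fun b =>
      (power_le_power_right hX1).trans (hpow _ ((mk_Iio_lt b (by simp)).trans_eq (by simp)))
    _ = κ := by simp [mul_eq_self hκ]

theorem mk_term_le {κ : Cardinal.{u}} (hκ : ℵ₀ ≤ κ) (hL : L.card ≤ κ) (hV : #V ≤ κ) :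
    #(L.Term V) ≤ κ := by
  refine (Language.Term.card_le).trans (max_le hκ ?_)
  rw [mk_sum, lift_id, lift_id]
  refine add_le_of_le hκ hV (le_trans ?_ hL)
  rw [Language.card_eq_card_functions_add_card_relations]
  simp [mk_sigma]

theorem mk_node_le {κ : Cardinal.{u}} (hκ : ℵ₀ ≤ κ) (hpow : ∀ c < κ, κ ^ c ≤ κ)
    (hL : L.card ≤ κ) (hV : #V ≤ κ) : #(Node L V κ) ≤ κ := by
  have hT := mk_term_le hκ hL hV
  let S := ((L.Term V × L.Term V) ⊕ (Σ n, L.Relations n × (Fin n → L.Term V))) ⊕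
    ((L.Term V × V) ⊕ (ℕ × V × V)) ⊕ PUnit.{u + 1} ⊕
    ({I : Set V // #I < κ} ⊕ {I : Set V // #I < κ}) ⊕
    ({B : Set (ℕ × V) // #B < κ} ⊕ {B : Set (ℕ × V) // #B < κ})
  let g : S → Node L V κ := fun x => match x with
    | .inl (.inl (t, s)) => .eq t s
    | .inl (.inr ⟨_, R, ts⟩) => .rel R ts
    | .inr (.inl (.inl (t, X))) => .memTerm t X
    | .inr (.inl (.inr (i, X, Y))) => .memVar i X Y
    | .inr (.inr (.inl ⟨⟩)) => .neg
    | .inr (.inr (.inr (.inl (.inl I)))) => .conj I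
    | .inr (.inr (.inr (.inl (.inr I)))) => .disj I
    | .inr (.inr (.inr (.inr (.inl I)))) => .ex I
    | .inr (.inr (.inr (.inr (.inr I)))) => .all I
  have hg : g.Surjective := fun x => match x with
    | .eq t s => ⟨.inl (.inl (t, s)), rfl⟩
    | .rel R ts => ⟨.inl (.inr ⟨_, R, ts⟩), rfl⟩
    | .memTerm t X => ⟨.inr (.inl (.inl (t, X))), rfl⟩
    | .memVar i X Y => ⟨.inr (.inl (.inr (i, X, Y))), rfl⟩
    | .neg => ⟨.inr (.inr (.inl ⟨⟩)), rfl⟩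
    | .conj I => ⟨.inr (.inr (.inr (.inl (.inl I)))), rfl⟩
    | .disj I => ⟨.inr (.inr (.inr (.inl (.inr I)))), rfl⟩
    | .ex I => ⟨.inr (.inr (.inr (.inr (.inl I)))), rfl⟩
    | .all I => ⟨.inr (.inr (.inr (.inr (.inr I)))), rfl⟩
  refine (mk_le_of_surjective hg).trans ?_
  have hadd : ∀ {X Y : Type u}, #X ≤ κ → #Y ≤ κ → #(X ⊕ Y) ≤ κ := fun h1 h2 => by
    rw [mk_sum, lift_id, lift_id]; exact add_le_of_le hκ h1 h2
  have hmul : ∀ {X Y : Type u}, #X ≤ κ → #Y ≤ κ → #(X × Y) ≤ κ := fun h1 h2 => by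
    rw [mk_prod, lift_id, lift_id]; exact (mul_le_mul' h1 h2).trans_eq (mul_eq_self hκ)
  have hN : ∀ {X : Type u}, #X ≤ κ → #(ℕ × X) ≤ κ := fun h1 => by
    rw [mk_prod, lift_uzero, mk_nat, lift_aleph0]
    exact (mul_le_mul' hκ h1).trans_eq (mul_eq_self hκ)
  have hrel : #(Σ n, L.Relations n × (Fin n → L.Term V)) ≤ κ := by
    have : ∀ n, #(L.Relations n × (Fin n → L.Term V)) ≤ κ := fun n => by
      refine hmul ?_ ?_
      · refine le_trans ?_ hL
        exact mk_le_of_injective (f := fun R => (Sum.inr ⟨n, R⟩ : L.Symbols)) fun a b h => by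
          simpa using h
      · rw [mk_pi]
        simp only [prod_const, mk_fin, lift_natCast, lift_uzero]
        exact (power_le_power_right hT).trans (hpow _ ((natCast_lt_aleph0).trans_le hκ))
    rw [mk_sigma]
    refine (sum_le_sum _ (fun _ => κ) this).trans ?_
    rw [sum_const]
    simpa using (mul_le_mul' hκ le_rfl).trans_eq (mul_eq_self hκ)
  have h1 := mk_subset_lt_le hκ hpow hV
  have h2 := mk_subset_lt_le hκ hpow (hN hV)
  exact hadd (hadd (hmul hT hT) hrel) (hadd (hadd (hmul hT hV) (hN (hmul hV hV)))
    (hadd (by rw [mk_punit]; exact one_le_aleph0.trans hκ) (hadd (hadd h1 h1) (hadd h2 h2))))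

/-- If `κ ^ c ≤ κ` for all `c < κ`, there are at most `κ` formulas over a signature of size `κ`. -/
theorem mk_isFormula_le {κ : Cardinal.{u}} (hκ : ℵ₀ ≤ κ) (hpow : ∀ c < κ, κ ^ c ≤ κ)
    (hL : L.card ≤ κ) (hV : #V ≤ κ) : #{φ : HOForm L V // φ.IsFormula ⊤ κ κ} ≤ κ := by
  refine (mk_le_of_injective (f := fun φ : {φ : HOForm L V // φ.IsFormula ⊤ κ κ} =>
    φ.1.tree φ.2) fun φ ψ h => Subtype.ext (tree_injective _ _ _ _ h)).trans ?_
  refine WType.cardinalMk_le_of_le ?_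
  have h1 : (1 : Cardinal.{u}) < κ := one_lt_aleph0.trans_le hκ
  have hchild : ∀ a : Node L V κ, κ ^ #a.Child ≤ κ := by
    intro a
    apply hpow
    cases a with
    | conj I => exact I.2
    | disj I => exact I.2
    | neg | ex | all => exact mk_punit.trans_lt h1
    | _ => exact mk_pempty.trans_lt (zero_lt_one.trans h1)
  calc Cardinal.sum (fun a : Node L V κ => κ ^ #a.Child)
      ≤ Cardinal.sum fun _ : Node L V κ => κ := sum_le_sum _ _ hchild
    _ = #(Node L V κ) * κ := by simp
    _ ≤ κ * κ := mul_le_mul' (mk_node_le hκ hpow hL hV) le_rfl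
    _ = κ := mul_eq_self hκ

end HOForm

/-! ### Coding iterated power sets and assignments by sets -/

/-- The element of the `i`-fold iterated power set of `g '' A` that corresponds to an element of the
`i`-fold iterated power set of `A`. -/
noncomputable def encPow {A : Type u} (g : A → ZFSet.{u}) : ∀ i, IterPow A i → ZFSet.{u}
  | 0 => g
  | i + 1 => fun S => ZFSet.range fun s : (show Set (IterPow A i) from S) => encPow g i s

section encPow

variable {A : Type u} {g : A → ZFSet.{u}}

theorem mem_encPow_succ {i : ℕ} {S : Set (IterPow A i)} {z : ZFSet.{u}} :
    z ∈ encPow g (i + 1) S ↔ ∃ s ∈ S, encPow g i s = z := by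
  rw [encPow, ZFSet.mem_range]
  exact ⟨fun ⟨s, h⟩ => ⟨s.1, s.2, h⟩, fun ⟨s, hs, h⟩ => ⟨⟨s, hs⟩, h⟩⟩

theorem encPow_injective (hg : g.Injective) : ∀ i, (encPow g i).Injective
  | 0 => hg
  | i + 1 => by
    intro S S' h
    have key : ∀ S : Set (IterPow A i), ∀ s, s ∈ S ↔ encPow g i s ∈ encPow g (i + 1) S := by
      intro S s
      rw [mem_encPow_succ]
      exact ⟨fun hs => ⟨s, hs, rfl⟩, fun ⟨t, ht, h⟩ => encPow_injective hg i h ▸ ht⟩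
    exact Set.ext fun s => (key S s).trans ((iff_of_eq (by rw [h])).trans (key S' s).symm)

theorem encPow_mem_iff (hg : g.Injective) {i : ℕ} {s : IterPow A i} {S : Set (IterPow A i)} :
    encPow g i s ∈ encPow g (i + 1) S ↔ s ∈ S := by
  rw [mem_encPow_succ]
  exact ⟨fun ⟨t, ht, h⟩ => encPow_injective hg i h ▸ ht, fun hs => ⟨s, hs, rfl⟩⟩

theorem exists_encPow_succ_eq {i : ℕ} {y : ZFSet.{u}} :
    (∃ S, encPow g (i + 1) S = y) ↔ ∀ z ∈ y, ∃ s, encPow g i s = z := by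
  constructor
  · rintro ⟨S, rfl⟩ z hz
    obtain ⟨s, -, hs⟩ := mem_encPow_succ.1 hz
    exact ⟨s, hs⟩
  · intro h
    refine ⟨({s | encPow g i s ∈ y} : Set (IterPow A i)), ?_⟩
    ext z
    rw [mem_encPow_succ]
    constructor
    · rintro ⟨s, hs, rfl⟩
      exact hs
    · intro hz
      obtain ⟨s, rfl⟩ := h z hz
      exact ⟨s, hz, rfl⟩

end encPow

instance {A : Type u} [h : Nonempty A] : ∀ i, Nonempty (IterPow A i)
  | 0 => h
  | i + 1 => ⟨(∅ : Set (IterPow A i))⟩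

/-- The subsets `v` of `Y` code assignments: `asg v` is the assignment coded by `v`.  The value of the
variable `p` depends only on the section `{z | (x p, z) ∈ v}`, and it is `s` whenever this section
is the set coding `s`; moreover `Y` is large enough to contain codes of all assignments. -/
structure IsCoding {V A : Type u} (g : A → ZFSet.{u}) (x : ℕ × V → ZFSet.{u}) (Y : ZFSet.{u})
    (asg : ZFSet.{u} → ∀ p : ℕ × V, IterPow A p.1) : Prop where
  inj : x.Injective
  cover : ∀ p (s : IterPow A p.1), ∀ z ∈ encPow g p.1 s, ZFSet.pair (x p) z ∈ Y
  eq_of_section : ∀ v ⊆ Y, ∀ p s, (∀ z, z ∈ encPow g p.1 s ↔ ZFSet.pair (x p) z ∈ v) → asg v p = s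
  congr : ∀ v ⊆ Y, ∀ w ⊆ Y, ∀ p, (∀ z, ZFSet.pair (x p) z ∈ v ↔ ZFSet.pair (x p) z ∈ w) →
    asg v p = asg w p

namespace IsCoding

variable {V A : Type u} {g : A → ZFSet.{u}} {x : ℕ × V → ZFSet.{u}} {Y : ZFSet.{u}}
    {asg : ZFSet.{u} → ∀ p : ℕ × V, IterPow A p.1}

/-- The code `v` can be changed to a code of the values `w` for the variables in `B`. -/
theorem exists_modify (h : IsCoding g x Y asg) {v : ZFSet.{u}} (hv : v ⊆ Y) (B : Set (ℕ × V))
    (w : ∀ p : ℕ × V, IterPow A p.1) :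
    ∃ v' ⊆ Y, (∀ p ∈ B, asg v' p = w p) ∧ ∀ y z, (∀ p ∈ B, y ≠ x p) →
      (ZFSet.pair y z ∈ v' ↔ ZFSet.pair y z ∈ v) := by
  let v' : ZFSet.{u} := Y.sep fun q => (∃ p ∈ B, ∃ z ∈ encPow g p.1 (w p), q = ZFSet.pair (x p) z) ∨
    (q ∈ v ∧ ∀ p ∈ B, ∀ z, q ≠ ZFSet.pair (x p) z)
  have hv' : v' ⊆ Y := ZFSet.sep_subset
  refine ⟨v', hv', fun p hp => h.eq_of_section _ hv' p _ fun z => ?_, fun y z hy => ?_⟩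
  · rw [ZFSet.mem_sep]
    constructor
    · exact fun hz => ⟨h.cover p _ z hz, Or.inl ⟨p, hp, z, hz, rfl⟩⟩
    · rintro ⟨-, ⟨p', -, z', hz', he⟩ | ⟨-, hne⟩⟩
      · obtain ⟨h1, rfl⟩ := ZFSet.pair_inj.1 he
        obtain rfl := h.inj h1
        exact hz'
      · exact absurd rfl (hne p hp z)
  · rw [ZFSet.mem_sep]
    constructor
    · rintro ⟨-, ⟨p', hp', z', -, he⟩ | ⟨hq, -⟩⟩
      · exact absurd (ZFSet.pair_inj.1 he).1 (hy p' hp')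
      · exact hq
    · exact fun hq => ⟨hv hq, Or.inr ⟨hq, fun p hp z' he => hy p hp (ZFSet.pair_inj.1 he).1⟩⟩

theorem exists_eq (h : IsCoding g x Y asg) (w : ∀ p : ℕ × V, IterPow A p.1) :
    ∃ v ⊆ Y, asg v = w := by
  obtain ⟨v, hv, h1, -⟩ := h.exists_modify (ZFSet.empty_subset Y) Set.univ w
  exact ⟨v, hv, funext fun p => h1 p trivial⟩

variable {L : FirstOrder.Language.{u, u}} [L.Structure A]

/-- Quantifying over the variables in `B` amounts to quantifying over the codes that agree with the
given one outside of the codes of the members of `B`. -/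
theorem realize_ex (h : IsCoding g x Y asg) {v : ZFSet.{u}} (hv : v ⊆ Y) {B : Set (ℕ × V)}
    {b : ZFSet.{u}} (hb : ∀ p, x p ∈ b ↔ p ∈ B)
    (φ : HOForm L V) : (HOForm.ex B φ).Realize A (asg v) ↔ ∃ w ⊆ Y,
      (∀ y z, y ∉ b → (ZFSet.pair y z ∈ w ↔ ZFSet.pair y z ∈ v)) ∧ φ.Realize A (asg w) := by
  constructor
  · rintro ⟨w, hw, hφ⟩
    obtain ⟨v', hv', h1, h2⟩ := h.exists_modify hv B w
    refine ⟨v', hv', fun y z hy => h2 y z ?_, ?_⟩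
    · rintro p hp rfl
      exact hy ((hb p).2 hp)
    · have : asg v' = w := by
        funext p
        by_cases hp : p ∈ B
        · exact h1 p hp
        · rw [hw p hp]
          refine h.congr _ hv' _ hv p fun z => h2 _ z ?_
          rintro q hq he
          exact hp (h.inj he ▸ hq)
      rwa [this]
  · rintro ⟨w, hw, hag, hφ⟩
    exact ⟨asg w, fun p hp => h.congr _ hw _ hv p fun z => hag _ z fun h' => hp ((hb p).1 h'), hφ⟩

end IsCoding

open Classical in
/-- The element of the iterated power set coded by the set `{z | D z}`, and an arbitrary element if
there is none. -/
noncomputable def decPow {A : Type u} [Nonempty A] (g : A → ZFSet.{u}) (i : ℕ)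
    (D : ZFSet.{u} → Prop) : IterPow A i :=
  if h : ∃ s : IterPow A i, ∀ z, z ∈ encPow g i s ↔ D z then h.choose else Classical.arbitrary _

theorem decPow_eq {A : Type u} [Nonempty A] {g : A → ZFSet.{u}} (hg : g.Injective) {i : ℕ}
    {D : ZFSet.{u} → Prop} {s : IterPow A i} (hs : ∀ z, z ∈ encPow g i s ↔ D z) :
    decPow g i D = s := by
  have hex : ∃ s : IterPow A i, ∀ z, z ∈ encPow g i s ↔ D z := ⟨s, hs⟩
  rw [decPow, dif_pos hex]
  exact encPow_injective hg _ (ZFSet.ext fun z => (hex.choose_spec z).trans (hs z).symm)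

/-- The assignment coded by the sections of `v`. -/
noncomputable def decAsg {V A : Type u} [Nonempty A] (g : A → ZFSet.{u}) (x : ℕ × V → ZFSet.{u})
    (v : ZFSet.{u}) (p : ℕ × V) : IterPow A p.1 :=
  decPow g p.1 fun z => ZFSet.pair (x p) z ∈ v

theorem isCoding_decAsg {V A : Type u} [Nonempty A] {g : A → ZFSet.{u}} (hg : g.Injective)
    {x : ℕ × V → ZFSet.{u}} (hx : x.Injective) {Y : ZFSet.{u}}
    (hY : ∀ p (s : IterPow A p.1), ∀ z ∈ encPow g p.1 s, ZFSet.pair (x p) z ∈ Y) :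
    IsCoding g x Y (decAsg g x) where
  inj := hx
  cover := hY
  eq_of_section _ _ _ _ hs := decPow_eq hg hs
  congr _ _ _ _ p h := congrArg (decPow g p.1) (funext fun z => propext (h z))

/-! ### The coded sequence of models -/

/-- A sequence of `L`-structures of length `κ`, together with enumerations of the formulas and of the
variables by ordinals below `κ`. -/
structure ModelSeq (κ : Cardinal.{u}) (L : FirstOrder.Language.{u, u}) where
  /-- an enumeration of the ordinals below `κ` -/
  o : κ.out → ZFSet.{u}
  o_inj : o.Injective
  mem_iff : ∀ x, x ∈ cardSet κ ↔ ∃ a, o a = x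
  /-- the numbering of the formulas -/
  cF : {φ : RawForm L κ // φ.IsFormula ⊤ κ κ} ↪ κ.out
  /-- the numbering of the variables -/
  cV : ℕ × κ.out ↪ κ.out
  /-- the structures -/
  A : κ.out → Type u
  inst : ∀ a, L.Structure (A a)
  ne : ∀ a, Nonempty (A a)
  /-- the elements of the structures, as sets -/
  g : ∀ a, A a → ZFSet.{u}
  g_inj : ∀ a, (g a).Injective

attribute [instance] ModelSeq.inst ModelSeq.ne

namespace ModelSeq

variable {κ : Cardinal.{u}} {L : FirstOrder.Language.{u, u}} (c : ModelSeq κ L)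

/-- The code of a variable. -/
def x (p : ℕ × κ.out) : ZFSet.{u} := c.o (c.cV p)

/-- The code of a formula. -/
def code (φ : {φ : RawForm L κ // φ.IsFormula ⊤ κ κ}) : ZFSet.{u} := c.o (c.cF φ)

/-- The coded elements of the `i`-fold iterated power sets of the structures. -/
noncomputable def Q (i : ℕ) : ZFSet.{u} :=
  ZFSet.range fun q : Σ a, IterPow (c.A a) i => ZFSet.pair (c.o q.1) (encPow (c.g q.1) i q.2)

/-- A set whose subsets code all assignments in all structures. -/
noncomputable def Y : ZFSet.{u} :=
  (cardSet κ).prod (⋃₀ ZFSet.range fun q : Σ (a : κ.out) (i : ℕ), IterPow (c.A a) i =>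
    encPow (c.g q.1) q.2.1 q.2.2)

/-- The assignment in the structure with index `a` that is coded by `v`. -/
noncomputable def asg (a : κ.out) (v : ZFSet.{u}) : ∀ p : ℕ × κ.out, IterPow (c.A a) p.1 :=
  decAsg (c.g a) c.x v

/-- The graph of a family of functions from (codes of) assignments to iterated power sets. -/
noncomputable def W (i : ℕ) (f : ∀ a, ZFSet.{u} → IterPow (c.A a) i) : ZFSet.{u} :=
  ZFSet.range fun q : Σ _ : κ.out, c.Y.powerset =>
    ZFSet.pair (c.o q.1) (ZFSet.pair q.2 (encPow (c.g q.1) i (f q.1 q.2)))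

/-- The graph of the evaluation of a variable. -/
noncomputable def valV (p : ℕ × κ.out) : ZFSet.{u} := c.W p.1 fun a v => c.asg a v p

/-- The graph of the evaluation of a term. -/
noncomputable def valT (t : L.Term κ.out) : ZFSet.{u} :=
  c.W 0 fun a v => t.realize (M := c.A a) fun y => c.asg a v (0, y)

/-- The satisfaction relation. -/
noncomputable def S : ZFSet.{u} :=
  ZFSet.range fun q : {q : Σ (_ : κ.out) (_ : c.Y.powerset),
      {φ : RawForm L κ // φ.IsFormula ⊤ κ κ} //
      q.2.2.1.Realize (c.A q.1) (c.asg q.1 q.2.1)} =>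
    ZFSet.pair (c.o q.1.1) (ZFSet.pair q.1.2.1 (c.code q.1.2.2))

/-- A set of ordinals below `κ`, as a set. -/
noncomputable def sub (I : Set κ.out) : ZFSet.{u} := ZFSet.range fun a : I => c.o a

theorem x_injective : c.x.Injective := fun _ _ h => c.cV.injective (c.o_inj h)

theorem code_injective : c.code.Injective := fun _ _ h => c.cF.injective (c.o_inj h)

theorem o_mem (a : κ.out) : c.o a ∈ cardSet κ := (c.mem_iff _).2 ⟨a, rfl⟩

theorem mem_Q {a : κ.out} {i : ℕ} {y : ZFSet.{u}} :
    ZFSet.pair (c.o a) y ∈ c.Q i ↔ ∃ s, encPow (c.g a) i s = y := by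
  rw [Q, ZFSet.mem_range]
  constructor
  · rintro ⟨⟨b, s⟩, h⟩
    obtain ⟨h1, h2⟩ := ZFSet.pair_inj.1 h
    obtain rfl := c.o_inj h1
    exact ⟨s, h2⟩
  · rintro ⟨s, rfl⟩
    exact ⟨⟨a, s⟩, rfl⟩

theorem pair_mem_Y {a : κ.out} {i : ℕ} {s : IterPow (c.A a) i} {y z : ZFSet.{u}}
    (hy : y ∈ cardSet κ) (hz : z ∈ encPow (c.g a) i s) : ZFSet.pair y z ∈ c.Y := by
  rw [Y, ZFSet.pair_mem_prod, ZFSet.mem_sUnion]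
  exact ⟨hy, _, ZFSet.mem_range.2 ⟨⟨a, i, s⟩, rfl⟩, hz⟩

theorem isCoding (a : κ.out) : IsCoding (c.g a) c.x c.Y (c.asg a) :=
  isCoding_decAsg (c.g_inj a) c.x_injective fun _ _ _ hz => c.pair_mem_Y (c.o_mem _) hz

theorem mem_W {a : κ.out} {i : ℕ} {f : ∀ a, ZFSet.{u} → IterPow (c.A a) i} {v y : ZFSet.{u}} :
    ZFSet.pair (c.o a) (ZFSet.pair v y) ∈ c.W i f ↔ v ⊆ c.Y ∧ encPow (c.g a) i (f a v) = y := by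
  rw [W, ZFSet.mem_range]
  constructor
  · rintro ⟨⟨b, w, hw⟩, h⟩
    obtain ⟨h1, h2⟩ := ZFSet.pair_inj.1 h
    obtain rfl := c.o_inj h1
    obtain ⟨rfl, h3⟩ := ZFSet.pair_inj.1 h2
    exact ⟨ZFSet.mem_powerset.1 hw, h3⟩
  · rintro ⟨hv, rfl⟩
    exact ⟨⟨a, v, ZFSet.mem_powerset.2 hv⟩, rfl⟩

theorem mem_S {a : κ.out} {v : ZFSet.{u}} {φ : {φ : RawForm L κ // φ.IsFormula ⊤ κ κ}} :
    ZFSet.pair (c.o a) (ZFSet.pair v (c.code φ)) ∈ c.S ↔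
      v ⊆ c.Y ∧ φ.1.Realize (c.A a) (c.asg a v) := by
  rw [S, ZFSet.mem_range]
  constructor
  · rintro ⟨⟨⟨b, ⟨w, hw⟩, ψ⟩, hψ⟩, h⟩
    obtain ⟨h1, h2⟩ := ZFSet.pair_inj.1 h
    obtain rfl := c.o_inj h1
    obtain ⟨rfl, h3⟩ := ZFSet.pair_inj.1 h2
    obtain rfl := c.code_injective h3
    exact ⟨ZFSet.mem_powerset.1 hw, hψ⟩
  · rintro ⟨hv, h⟩
    exact ⟨⟨⟨a, ⟨v, ZFSet.mem_powerset.2 hv⟩, φ⟩, h⟩, rfl⟩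

theorem mem_sub {I : Set κ.out} {y : ZFSet.{u}} : y ∈ c.sub I ↔ ∃ a ∈ I, c.o a = y := by
  rw [sub, ZFSet.mem_range]
  exact ⟨fun ⟨a, h⟩ => ⟨a.1, a.2, h⟩, fun ⟨a, ha, h⟩ => ⟨⟨a, ha⟩, h⟩⟩

theorem o_mem_sub {I : Set κ.out} {a : κ.out} : c.o a ∈ c.sub I ↔ a ∈ I := by
  rw [mem_sub]
  exact ⟨fun ⟨b, hb, h⟩ => c.o_inj h ▸ hb, fun h => ⟨a, h, rfl⟩⟩

end ModelSeq

/-! ### The image of the sequence under the embedding -/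

theorem SetDef.relabel {α β : Type} {P : ZFSet.{u} → (α → ZFSet.{u}) → Prop} (hP : SetDef P)
    (f : α → β) : SetDef fun N v => P N fun a => v (f a) := by
  obtain ⟨φ, hφ⟩ := hP
  exact ⟨φ.relabel f, fun θ v => by rw [Language.Formula.realize_relabel]; exact hφ θ (v ∘ f)⟩

namespace Reflection

variable {κ : Cardinal.{u}} {θ θ' : Ordinal.{u}} {M : ZFSet.{u}} {J : ZFSet.{u} → ZFSet.{u}}

/-- A definable property of all ordinals below `κ` passes on to `κ`, because `κ` is below the image
of `κ`; the parameters are replaced by their images. -/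
theorem transfer_card (R : Reflection κ θ θ' M J) {α : Type}
    {P : ZFSet.{u} → ZFSet.{u} → (α → ZFSet.{u}) → Prop}
    (hP : SetDef (α := Option α) fun N v => P N (v none) fun a => v (some a))
    (p : α → ZFSet.{u}) (hp : ∀ a, p a ∈ M) (h : ∀ a ∈ cardSet κ, P (V_ θ) a p) :
    P (V_ θ') (cardSet κ) fun a => J (p a) := by
  have hdef : SetDef (α := Option α) fun N v => ∀ a ∈ N, a ∈ v none →
      P N a fun b => v (some b) :=
    .all (.imp (.mem _ _) (hP.relabel (fun o => o.elim none fun a => some (some a))))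
  exact (R.transfer hdef (fun o => o.elim (cardSet κ) p)
    (by rintro (_ | a); exacts [R.card_mem, hp a])).1 (fun a _ ha => h a ha) _
    (SetDef.mem_level_of_mem R.lt_map (R.map_mem _ R.card_mem)) R.lt_map

/-- `transfer_card` for two families and four single parameters. -/
theorem transfer_card₂₄ (R : Reflection κ θ θ' M J) {α : Type} {P : ZFSet.{u} → ZFSet.{u} →
      (α → ZFSet.{u}) → (α → ZFSet.{u}) → ZFSet.{u} → ZFSet.{u} → ZFSet.{u} → ZFSet.{u} → Prop}
    (hP : SetDef (α := Option (α ⊕ α ⊕ Fin 4)) fun N v => P N (v none) (fun k => v (some (.inl k)))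
      (fun k => v (some (.inr (.inl k)))) (v (some (.inr (.inr 0)))) (v (some (.inr (.inr 1))))
      (v (some (.inr (.inr 2)))) (v (some (.inr (.inr 3)))))
    {p q : α → ZFSet.{u}} {x y z w : ZFSet.{u}} (hp : ∀ a, p a ∈ M) (hq : ∀ a, q a ∈ M)
    (hx : x ∈ M) (hy : y ∈ M) (hz : z ∈ M) (hw : w ∈ M)
    (h : ∀ a ∈ cardSet κ, P (V_ θ) a p q x y z w) :
    P (V_ θ') (cardSet κ) (fun a => J (p a)) (fun a => J (q a)) (J x) (J y) (J z) (J w) :=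
  R.transfer_card (α := α ⊕ α ⊕ Fin 4) (P := fun N a v => P N a (fun k => v (.inl k)) (fun k => v (.inr (.inl k)))
    (v (.inr (.inr 0))) (v (.inr (.inr 1))) (v (.inr (.inr 2))) (v (.inr (.inr 3)))) hP
    (Sum.elim p (Sum.elim q ![x, y, z, w])) (by
      rintro (k | k | k)
      · exact hp k
      · exact hq k
      · fin_cases k
        exacts [hx, hy, hz, hw]) h

/-- `transfer_card` for four parameters. -/
theorem transfer_card₄ (R : Reflection κ θ θ' M J) {P : ZFSet.{u} → ZFSet.{u} →
      ZFSet.{u} → ZFSet.{u} → ZFSet.{u} → ZFSet.{u} → Prop}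
    (hP : SetDef (α := Option (Fin 4)) fun N v =>
      P N (v none) (v (some 0)) (v (some 1)) (v (some 2)) (v (some 3)))
    {x y z w : ZFSet.{u}} (hx : x ∈ M) (hy : y ∈ M) (hz : z ∈ M) (hw : w ∈ M)
    (h : ∀ a ∈ cardSet κ, P (V_ θ) a x y z w) :
    P (V_ θ') (cardSet κ) (J x) (J y) (J z) (J w) :=
  R.transfer_card (α := Fin 4) (P := fun N a v => P N a (v 0) (v 1) (v 2) (v 3)) hP ![x, y, z, w]
    (by intro k; fin_cases k; exacts [hx, hy, hz, hw]) h

theorem mem_iff (R : Reflection κ θ θ' M J) {x y : ZFSet.{u}} (hx : x ∈ M) (hy : y ∈ M) :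
    x ∈ y ↔ J x ∈ J y :=
  R.transfer (SetDef.mem (0 : Fin 2) 1) ![x, y] (by intro k; fin_cases k; exacts [hx, hy])

/-- The embedding fixes the subsets of `κ` of size less than `κ` that belong to `M`. -/
theorem map_eq_of_bounded (R : Reflection κ θ θ' M J) {x y : ZFSet.{u}} (hx : x ∈ M)
    (hy : y ∈ cardSet κ) (hxy : x ⊆ y) : J x = x := by
  have hs : J x ⊆ J y := (R.transfer (SetDef.subset (0 : Fin 2) 1) ![x, y]
    (by intro k; fin_cases k; exacts [hx, R.mem_of_lt y hy])).1 hxy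
  rw [R.map_lt y hy] at hs
  have key : ∀ z ∈ y, (z ∈ x ↔ z ∈ J x) := by
    intro z hz
    have hzκ : z ∈ cardSet κ := (ZFSet.isOrdinal_toZFSet _).mem_trans hz hy
    have := R.mem_iff (R.mem_of_lt z hzκ) hx
    rwa [R.map_lt z hzκ] at this
  ext z
  exact ⟨fun hz => (key z (hs hz)).2 hz, fun hz => (key z (hxy hz)).1 hz⟩

end Reflection

namespace ModelSeq

variable {κ : Cardinal.{u}} {L : FirstOrder.Language.{u, u}} (c : ModelSeq κ L)

theorem exists_sub_subset (hκ : κ.IsRegular) {I : Set κ.out} (hI : #I < κ) :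
    ∃ y ∈ cardSet κ, c.sub I ⊆ y := by
  have h : ∀ a, ∃ b < κ.ord, b.toZFSet = c.o a := fun a => by
    have := c.o_mem a
    rwa [cardSet, Ordinal.mem_toZFSet_iff] at this
  choose b hb hb' using h
  have hlim : (⨆ a : I, b a) < κ.ord :=
    Ordinal.iSup_lt_of_lt_cof (by rwa [hκ.cof_ord]) fun a => hb a
  have hsucc : (⨆ a : I, b a) + 1 < κ.ord := (isSuccLimit_ord hκ.1).add_one_lt hlim
  refine ⟨((⨆ a : I, b a) + 1).toZFSet, Ordinal.toZFSet_mem_toZFSet_iff.2 hsucc, fun z hz => ?_⟩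
  obtain ⟨a, ha, rfl⟩ := c.mem_sub.1 hz
  rw [← hb', Ordinal.toZFSet_mem_toZFSet_iff]
  exact Order.lt_succ_of_le (Ordinal.le_iSup (fun a : I => b a) ⟨a, ha⟩)

/-- `J` is an embedding with critical point `κ`, a regular cardinal, and the sets through which it acts
on the sequence `c` belong to its domain. -/
structure IsImage (θ θ' : Ordinal.{u}) (M : ZFSet.{u}) (J : ZFSet.{u} → ZFSet.{u}) : Prop
    extends Reflection κ θ θ' M J where
  isRegular : κ.IsRegular
  Q : ∀ i, c.Q i ∈ M
  Y : c.Y ∈ M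
  valV : ∀ p, c.valV p ∈ M
  valT : ∀ t, c.valT t ∈ M
  S : c.S ∈ M
  sub : ∀ I : Set κ.out, #I < κ → c.sub I ∈ M

variable (J : ZFSet.{u} → ZFSet.{u})

/-- The universe of the structure with index `κ` in the image of the sequence. -/
noncomputable def dom : ZFSet.{u} :=
  (⋃₀ ⋃₀ J (c.Q 0)).sep fun y => ZFSet.pair (cardSet κ) y ∈ J (c.Q 0)

theorem mem_dom {y : ZFSet.{u}} : y ∈ c.dom J ↔ ZFSet.pair (cardSet κ) y ∈ J (c.Q 0) := by
  rw [dom, ZFSet.mem_sep, and_iff_right_iff_imp]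
  intro h
  rw [ZFSet.mem_sUnion]
  refine ⟨{cardSet κ, y}, ?_, by simp⟩
  rw [ZFSet.mem_sUnion]
  exact ⟨_, h, by simp [ZFSet.pair]⟩

/-- The universe of the structure with index `κ` in the image of the sequence, as a type. -/
def Limit : Type u := Shrink.{u} (c.dom J)

/-- The elements of `c.Limit J`, as sets. -/
noncomputable def gL (a : c.Limit J) : ZFSet.{u} := ((equivShrink (c.dom J)).symm a : c.dom J).1

theorem gL_injective : (c.gL J).Injective := fun _ _ h =>
  (equivShrink (c.dom J)).symm.injective (Subtype.ext h)

theorem exists_gL {y : ZFSet.{u}} : (∃ a, c.gL J a = y) ↔ y ∈ c.dom J := by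
  constructor
  · rintro ⟨a, rfl⟩
    exact ((equivShrink (c.dom J)).symm a).2
  · exact fun h => ⟨equivShrink (c.dom J) ⟨y, h⟩, by simp [gL]⟩

namespace IsImage

variable {c} {θ θ' : Ordinal.{u}} {M : ZFSet.{u}} {J : ZFSet.{u} → ZFSet.{u}}

theorem map_o (h : c.IsImage θ θ' M J) (a : κ.out) : J (c.o a) = c.o a := h.map_lt _ (c.o_mem a)

theorem o_mem_dom (h : c.IsImage θ θ' M J) (a : κ.out) : c.o a ∈ M := h.mem_of_lt _ (c.o_mem a)

theorem map_sub (h : c.IsImage θ θ' M J) {I : Set κ.out} (hI : #I < κ) : J (c.sub I) = c.sub I := by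
  obtain ⟨y, hy, hIy⟩ := c.exists_sub_subset h.isRegular hI
  exact h.map_eq_of_bounded (h.sub I hI) hy hIy

theorem mem_map_Q_succ (h : c.IsImage θ θ' M J) (i : ℕ) {y : ZFSet.{u}} (hy : y ∈ V_ θ') :
    ZFSet.pair (cardSet κ) y ∈ J (c.Q (i + 1)) ↔ ∀ z ∈ y, ZFSet.pair (cardSet κ) z ∈ J (c.Q i) := by
  have := h.transfer_card₄ (P := fun N a q r _ _ => ∀ y ∈ N,
    (ZFSet.pair a y ∈ r ↔ ∀ z ∈ N, z ∈ y → ZFSet.pair a z ∈ q))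
    (.all (.iff (.pairMem _ _ _) (.all (.imp (.mem _ _) (.pairMem _ _ _)))))
    (h.Q i) (h.Q (i + 1)) h.Y h.Y (by
      intro a ha y hy
      obtain ⟨a, rfl⟩ := (c.mem_iff a).1 ha
      refine c.mem_Q.trans (exists_encPow_succ_eq.trans ?_)
      exact ⟨fun h z _ hz => c.mem_Q.2 (h z hz),
        fun h z hz => c.mem_Q.1 (h z (SetDef.mem_level_of_mem hz hy) hz)⟩) y hy
  exact this.trans ⟨fun h z hz => h z (SetDef.mem_level_of_mem hz hy) hz, fun h z _ hz => h z hz⟩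

/-- In the image of the sequence, the iterated power sets are still the full ones. -/
theorem mem_map_Q (h : c.IsImage θ θ' M J) : ∀ (i : ℕ) {y : ZFSet.{u}},
    ZFSet.pair (cardSet κ) y ∈ J (c.Q i) ↔ ∃ s, encPow (c.gL J) i s = y
  | 0, y => (c.mem_dom J).symm.trans (c.exists_gL J).symm
  | i + 1, y => by
    have hQ : ∀ z, ZFSet.pair (cardSet κ) z ∈ J (c.Q i) → z.rank < (J (c.Q i)).rank := by
      intro z hz
      refine lt_trans ?_ (ZFSet.rank_lt_of_mem hz)
      refine lt_trans (ZFSet.rank_lt_of_mem (x := {cardSet κ, z}) (by simp)) ?_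
      exact ZFSet.rank_lt_of_mem (by simp [ZFSet.pair])
    rw [exists_encPow_succ_eq]
    constructor
    · intro hy z hz
      have hyV := SetDef.snd_mem_level (SetDef.mem_level_of_mem hy (h.map_mem _ (h.Q _)))
      exact (h.mem_map_Q i).1 ((h.mem_map_Q_succ i hyV).1 hy z hz)
    · intro hz
      have hy : y ∈ V_ θ' := by
        rw [ZFSet.mem_vonNeumann]
        refine lt_of_le_of_lt ?_ (ZFSet.mem_vonNeumann.1 (h.map_mem _ (h.Q i)))
        rw [ZFSet.rank_le_iff]
        exact fun z hzy => hQ z ((h.mem_map_Q i).2 (hz z hzy))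
      exact (h.mem_map_Q_succ i hy).2 fun z hzy => (h.mem_map_Q i).2 (hz z hzy)

theorem encPow_mem_level (h : c.IsImage θ θ' M J) (i : ℕ) (s : IterPow (c.Limit J) i) : encPow (c.gL J) i s ∈ V_ θ' :=
  SetDef.snd_mem_level (SetDef.mem_level_of_mem ((h.mem_map_Q i).2 ⟨s, rfl⟩)
    (h.map_mem _ (h.Q i)))

theorem mem_level_of_subset (h : c.IsImage θ θ' M J) {v : ZFSet.{u}} (hv : v ⊆ J c.Y) : v ∈ V_ θ' :=
  ZFSet.mem_vonNeumann_of_subset hv (h.map_mem _ h.Y)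

theorem pair_mem_map_Y (h : c.IsImage θ θ' M J) (a : κ.out) {i : ℕ} (s : IterPow (c.Limit J) i) {z : ZFSet.{u}}
    (hz : z ∈ encPow (c.gL J) i s) : ZFSet.pair (c.o a) z ∈ J c.Y := by
  have := h.transfer_card₄ (P := fun N a q Y x _ => ∀ y ∈ N,
    ZFSet.pair a y ∈ q → ∀ z ∈ N, z ∈ y → ZFSet.pair x z ∈ Y)
    (.all (.imp (.pairMem _ _ _) (.all (.imp (.mem _ _) (.pairMem _ _ _)))))
    (h.Q i) h.Y (h.o_mem_dom a) h.Y (by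
      intro b hb y _ hy z _ hz
      obtain ⟨b, rfl⟩ := (c.mem_iff b).1 hb
      obtain ⟨s, rfl⟩ := c.mem_Q.1 hy
      exact c.pair_mem_Y (c.o_mem a) hz) _ (h.encPow_mem_level i s)
      ((h.mem_map_Q i).2 ⟨s, rfl⟩) z
      (SetDef.mem_level_of_mem hz (h.encPow_mem_level i s)) hz
  rwa [h.map_o] at this

theorem exists_val (h : c.IsImage θ θ' M J) {i : ℕ} {f : ∀ a, ZFSet.{u} → IterPow (c.A a) i} (hf : c.W i f ∈ M)
    {v : ZFSet.{u}} (hv : v ⊆ J c.Y) : ∃ s, ∀ y,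
      ZFSet.pair (cardSet κ) (ZFSet.pair v y) ∈ J (c.W i f) ↔ encPow (c.gL J) i s = y := by
  obtain ⟨y, -, hy, hu⟩ := h.transfer_card₄ (P := fun N a Y q w _ => ∀ x ∈ N, x ⊆ Y →
    ∃ y ∈ N, ZFSet.pair a y ∈ q ∧ ∀ z ∈ N, (ZFSet.pair a (ZFSet.pair x z) ∈ w ↔ y = z))
    (.all (.imp (.subset _ _) (.ex (.and (.pairMem _ _ _)
      (.all (.iff (.tripleMem _ _ _ _) (.eq _ _)))))))
    h.Y (h.Q i) hf h.Y (by
      intro b hb v _ hv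
      obtain ⟨b, rfl⟩ := (c.mem_iff b).1 hb
      have hQ : ZFSet.pair (c.o b) (encPow (c.g b) i (f b v)) ∈ c.Q i := c.mem_Q.2 ⟨_, rfl⟩
      refine ⟨_, SetDef.snd_mem_level (SetDef.mem_level_of_mem hQ (h.subset (h.Q i))), hQ,
        fun z _ => c.mem_W.trans ?_⟩
      exact and_iff_right hv) v (h.mem_level_of_subset hv) hv
  obtain ⟨s, rfl⟩ := (h.mem_map_Q i).1 hy
  refine ⟨s, fun y => ⟨fun hy => (hu y ?_).1 hy, fun hy => (hu y ?_).2 hy⟩⟩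
  · exact SetDef.snd_mem_level (SetDef.snd_mem_level
      (SetDef.mem_level_of_mem hy (h.map_mem _ hf)))
  · exact hy ▸ h.encPow_mem_level i s

theorem nonempty_limit (h : c.IsImage θ θ' M J) (a : κ.out)  : Nonempty (c.Limit J) := by
  obtain ⟨s, -⟩ := h.exists_val (h.valV (0, a)) (ZFSet.empty_subset _)
  exact ⟨s⟩

theorem x_mem (h : c.IsImage θ θ' M J) (p : ℕ × κ.out) : c.x p ∈ M := h.o_mem_dom _

theorem map_x (h : c.IsImage θ θ' M J) (p : ℕ × κ.out) : J (c.x p) = c.x p := h.map_o _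

theorem code_mem (h : c.IsImage θ θ' M J) (φ) : c.code φ ∈ M := h.o_mem_dom _

theorem map_code (h : c.IsImage θ θ' M J) (φ) : J (c.code φ) = c.code φ := h.map_o _

/-- In the image of the sequence, the satisfaction relation of a formula `ψ` that is equivalent to the
negation of `φ` in all members of the sequence is complementary to that of `φ`. -/
theorem mem_map_S_neg_iff (h : c.IsImage θ θ' M J)
    (φ ψ : {φ : RawForm L κ // φ.IsFormula ⊤ κ κ})
    (hφψ : ∀ a v, ψ.1.Realize (c.A a) v ↔ ¬ φ.1.Realize (c.A a) v) {v : ZFSet.{u}}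
    (hv : v ⊆ J c.Y) :
    ZFSet.pair (cardSet κ) (ZFSet.pair v (c.code ψ)) ∈ J c.S ↔
      ¬ ZFSet.pair (cardSet κ) (ZFSet.pair v (c.code φ)) ∈ J c.S := by
  have := h.transfer_card₄ (P := fun N a Y s r S => ∀ v ∈ N, v ⊆ Y →
      (ZFSet.pair a (ZFSet.pair v s) ∈ S ↔ ¬ ZFSet.pair a (ZFSet.pair v r) ∈ S))
    (.all (.imp (.subset _ _) (.iff (.tripleMem _ _ _ _) (.not (.tripleMem _ _ _ _)))))
    h.Y (h.code_mem ψ) (h.code_mem φ) h.S (by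
      intro b hb v _ hv
      obtain ⟨b, rfl⟩ := (c.mem_iff b).1 hb
      have h1 := c.mem_S (a := b) (v := v) (φ := ψ)
      have h2 := c.mem_S (a := b) (v := v) (φ := φ)
      rw [and_iff_right hv] at h1 h2
      exact h1.trans ((hφψ b _).trans (not_congr h2.symm))) v (h.mem_level_of_subset hv) hv
  rwa [h.map_code, h.map_code] at this

/-- The clause of the satisfaction relation for conjunctions of fewer than `κ` formulas. -/
theorem mem_map_S_conj_iff (h : c.IsImage θ θ' M J) {ι : Type u} (hι : #ι < κ)
    (φ : {φ : RawForm L κ // φ.IsFormula ⊤ κ κ})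
    (ψ : ι → {φ : RawForm L κ // φ.IsFormula ⊤ κ κ})
    (hφ : ∀ a v, φ.1.Realize (c.A a) v ↔ ∀ k, (ψ k).1.Realize (c.A a) v)
    {v : ZFSet.{u}} (hv : v ⊆ J c.Y) :
    ZFSet.pair (cardSet κ) (ZFSet.pair v (c.code φ)) ∈ J c.S ↔
      ∀ k, ZFSet.pair (cardSet κ) (ZFSet.pair v (c.code (ψ k))) ∈ J c.S := by
  have hI : #(Set.range fun k => c.cF (ψ k)) < κ := mk_range_le.trans_lt hι
  have hsub : ∀ {y}, y ∈ c.sub (Set.range fun k => c.cF (ψ k)) ↔ ∃ k, c.code (ψ k) = y := by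
    intro y
    rw [c.mem_sub, Set.exists_range_iff]
    rfl
  have := h.transfer_card₄ (P := fun N a Y r I S => ∀ v ∈ N, v ⊆ Y →
      (ZFSet.pair a (ZFSet.pair v r) ∈ S ↔
        ∀ d ∈ N, d ∈ I → ZFSet.pair a (ZFSet.pair v d) ∈ S))
    (.all (.imp (.subset _ _) (.iff (.tripleMem _ _ _ _)
      (.all (.imp (.mem _ _) (.tripleMem _ _ _ _))))))
    h.Y (h.code_mem φ) (h.sub _ hI) h.S (by
      intro b hb v _ hv
      obtain ⟨b, rfl⟩ := (c.mem_iff b).1 hb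
      rw [c.mem_S, and_iff_right hv, hφ]
      constructor
      · intro H d _ hd
        obtain ⟨k, rfl⟩ := hsub.1 hd
        exact c.mem_S.2 ⟨hv, H k⟩
      · intro H k
        exact (c.mem_S.1 (H _ (h.subset (h.code_mem _)) (hsub.2 ⟨k, rfl⟩))).2) v
      (h.mem_level_of_subset hv) hv
  rw [h.map_code, h.map_sub hI] at this
  rw [this]
  constructor
  · intro H k
    exact H _ (h.map_code (ψ k) ▸ h.map_mem _ (h.code_mem _)) (hsub.2 ⟨k, rfl⟩)
  · intro H d _ hd
    obtain ⟨k, rfl⟩ := hsub.1 hd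
    exact H k

/-- The clause of the satisfaction relation for quantification over fewer than `κ` variables. -/
theorem mem_map_S_ex_iff (h : c.IsImage θ θ' M J) {B : Set (ℕ × κ.out)} (hB : #B < κ)
    (φ ψ : {φ : RawForm L κ // φ.IsFormula ⊤ κ κ}) (hφ : ψ.1 = .ex B φ.1)
    {v : ZFSet.{u}} (hv : v ⊆ J c.Y) :
    ZFSet.pair (cardSet κ) (ZFSet.pair v (c.code ψ)) ∈ J c.S ↔ ∃ w ⊆ J c.Y,
      (∀ y z, y ∉ c.sub (c.cV '' B) → (ZFSet.pair y z ∈ w ↔ ZFSet.pair y z ∈ v)) ∧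
      ZFSet.pair (cardSet κ) (ZFSet.pair w (c.code φ)) ∈ J c.S := by
  have hI : #(c.cV '' B) < κ := mk_image_le.trans_lt hB
  have hlevel : ∀ {θ : Ordinal.{u}} {w v b : ZFSet.{u}}, w ∈ V_ θ → v ∈ V_ θ →
      ((∀ y ∈ V_ θ, ∀ z ∈ V_ θ, ¬ y ∈ b → (ZFSet.pair y z ∈ w ↔ ZFSet.pair y z ∈ v)) ↔
        ∀ y z, y ∉ b → (ZFSet.pair y z ∈ w ↔ ZFSet.pair y z ∈ v)) := by
    intro θ w v b hw hv
    refine ⟨fun H y z hy => ⟨fun hyz => ?_, fun hyz => ?_⟩, fun H y _ z _ => H y z⟩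
    · have := SetDef.mem_level_of_mem hyz hw
      exact (H y (SetDef.fst_mem_level this) z (SetDef.snd_mem_level this) hy).1 hyz
    · have := SetDef.mem_level_of_mem hyz hv
      exact (H y (SetDef.fst_mem_level this) z (SetDef.snd_mem_level this) hy).2 hyz
  have := h.transfer_card₂₄ (α := Unit) (P := fun N a p b Y r s S => ∀ v ∈ N, v ⊆ Y →
      (ZFSet.pair a (ZFSet.pair v r) ∈ S ↔ ∃ w ∈ N, w ⊆ Y ∧
        (∀ y ∈ N, ∀ z ∈ N, ¬ y ∈ b () → (ZFSet.pair y z ∈ w ↔ ZFSet.pair y z ∈ v)) ∧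
        ZFSet.pair a (ZFSet.pair w s) ∈ S))
    (.all (.imp (.subset _ _) (.iff (.tripleMem _ _ _ _) (.ex (.and (.subset _ _) (.and
      (.all (.all (.imp (.not (.mem _ _)) (.iff (.pairMem _ _ _) (.pairMem _ _ _)))))
      (.tripleMem _ _ _ _)))))))
    (fun _ => h.Y) (fun _ => h.sub _ hI) h.Y (h.code_mem ψ) (h.code_mem φ) h.S (by
      intro b hb v hvN hv
      obtain ⟨b, rfl⟩ := (c.mem_iff b).1 hb
      have hYN : c.Y ∈ V_ θ := h.subset h.Y
      rw [c.mem_S, and_iff_right hv, hφ, (c.isCoding b).realize_ex hv (b := c.sub (c.cV '' B))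
        fun p => c.o_mem_sub.trans c.cV.injective.mem_set_image]
      constructor
      · rintro ⟨w, hw, hag, hr⟩
        have hwN := ZFSet.mem_vonNeumann_of_subset hw hYN
        exact ⟨w, hwN, hw, (hlevel hwN hvN).2 hag, c.mem_S.2 ⟨hw, hr⟩⟩
      · rintro ⟨w, hwN, hw, hag, hr⟩
        exact ⟨w, hw, (hlevel hwN hvN).1 hag, (c.mem_S.1 hr).2⟩) v (h.mem_level_of_subset hv) hv
  rw [h.map_code, h.map_code, h.map_sub hI] at this
  rw [this]
  have hvN := h.mem_level_of_subset hv
  constructor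
  · rintro ⟨w, hwN, hw, hag, hr⟩
    exact ⟨w, hw, (hlevel hwN hvN).1 hag, hr⟩
  · rintro ⟨w, hw, hag, hr⟩
    have hwN := h.mem_level_of_subset hw
    exact ⟨w, hwN, hw, (hlevel hwN hvN).2 hag, hr⟩

end IsImage

end ModelSeq

/-! ### The structure with index `κ` -/

namespace ModelSeq

variable {κ : Cardinal.{u}} {L : FirstOrder.Language.{u, u}} (c : ModelSeq κ L)
  (J : ZFSet.{u} → ZFSet.{u}) [Nonempty (c.Limit J)]

/-- The value at `v` of the function with graph `W` and index `κ` in the image of the sequence. -/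
noncomputable def val (i : ℕ) (W v : ZFSet.{u}) : IterPow (c.Limit J) i :=
  Classical.epsilon fun s => ∀ y,
    ZFSet.pair (cardSet κ) (ZFSet.pair v y) ∈ W ↔ encPow (c.gL J) i s = y

/-- The assignment coded by `v` in the structure with index `κ`. -/
noncomputable def asgL (v : ZFSet.{u}) (p : ℕ × κ.out) : IterPow (c.Limit J) p.1 :=
  c.val J p.1 (J (c.valV p)) v

/-- The value of the term `t` under the assignment coded by `v` in the structure with index `κ`. -/
noncomputable def termL (t : L.Term κ.out) (v : ZFSet.{u}) : c.Limit J :=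
  c.val J 0 (J (c.valT t)) v

namespace IsImage

variable {c J} {θ θ' : Ordinal.{u}} {M : ZFSet.{u}}

theorem mem_map_W (h : c.IsImage θ θ' M J) {i : ℕ} {f : ∀ a, ZFSet.{u} → IterPow (c.A a) i}
    (hf : c.W i f ∈ M) {v y : ZFSet.{u}} (hv : v ⊆ J c.Y) :
    ZFSet.pair (cardSet κ) (ZFSet.pair v y) ∈ J (c.W i f) ↔
      encPow (c.gL J) i (c.val J i (J (c.W i f)) v) = y :=
  Classical.epsilon_spec (h.exists_val hf hv) y

theorem mem_map_valV (h : c.IsImage θ θ' M J) {p : ℕ × κ.out} {v y : ZFSet.{u}} (hv : v ⊆ J c.Y) :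
    ZFSet.pair (cardSet κ) (ZFSet.pair v y) ∈ J (c.valV p) ↔
      encPow (c.gL J) p.1 (c.asgL J v p) = y :=
  h.mem_map_W (h.valV p) hv

theorem mem_map_valT (h : c.IsImage θ θ' M J) {t : L.Term κ.out} {v y : ZFSet.{u}}
    (hv : v ⊆ J c.Y) :
    ZFSet.pair (cardSet κ) (ZFSet.pair v y) ∈ J (c.valT t) ↔ c.gL J (c.termL J t v) = y :=
  h.mem_map_W (h.valT t) hv

/-- In the image of the sequence, the subsets of the image of `Y` still code the assignments. -/
theorem isCoding (h : c.IsImage θ θ' M J) : IsCoding (c.gL J) c.x (J c.Y) (c.asgL J) where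
  inj := c.x_injective
  cover p s z hz := h.pair_mem_map_Y _ s hz
  eq_of_section := by
    intro v hv p s hs
    have := h.transfer_card₄ (P := fun N a Y q x w => ∀ v ∈ N, v ⊆ Y →
      ∀ y ∈ N, ZFSet.pair a y ∈ q → (∀ z ∈ N, (z ∈ y ↔ ZFSet.pair x z ∈ v)) →
        ZFSet.pair a (ZFSet.pair v y) ∈ w)
      (.all (.imp (.subset _ _) (.all (.imp (.pairMem _ _ _) (.imp
        (.all (.iff (.mem _ _) (.pairMem _ _ _))) (.tripleMem _ _ _ _))))))
      h.Y (h.Q p.1) (h.x_mem p) (h.valV p) (by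
        intro b hb v hvN hv y hyN hy hsec
        obtain ⟨b, rfl⟩ := (c.mem_iff b).1 hb
        obtain ⟨s, rfl⟩ := c.mem_Q.1 hy
        refine c.mem_W.2 ⟨hv, congrArg _ ((c.isCoding b).eq_of_section v hv p s fun z =>
          ⟨fun hz => (hsec z ?_).1 hz, fun hz => (hsec z ?_).2 hz⟩)⟩
        · exact SetDef.mem_level_of_mem hz hyN
        · exact SetDef.snd_mem_level (SetDef.mem_level_of_mem hz hvN))
      v (h.mem_level_of_subset hv) hv _ (h.encPow_mem_level p.1 s)
      ((h.mem_map_Q p.1).2 ⟨s, rfl⟩) (by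
        intro z _
        rw [h.map_x]
        exact hs z)
    exact encPow_injective (c.gL_injective J) _ ((h.mem_map_valV hv).1 this)
  congr := by
    intro v hv w hw p hvw
    have := h.transfer_card₄ (P := fun N a Y x r _ => ∀ v ∈ N, v ⊆ Y → ∀ w ∈ N, w ⊆ Y →
      (∀ z ∈ N, (ZFSet.pair x z ∈ v ↔ ZFSet.pair x z ∈ w)) →
        ∀ y ∈ N, ZFSet.pair a (ZFSet.pair v y) ∈ r → ZFSet.pair a (ZFSet.pair w y) ∈ r)
      (.all (.imp (.subset _ _) (.all (.imp (.subset _ _) (.imp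
        (.all (.iff (.pairMem _ _ _) (.pairMem _ _ _)))
        (.all (.imp (.tripleMem _ _ _ _) (.tripleMem _ _ _ _))))))))
      h.Y (h.x_mem p) (h.valV p) h.Y (by
        intro b hb v hvN hv w hwN hw hvw y _ hy
        obtain ⟨b, rfl⟩ := (c.mem_iff b).1 hb
        obtain ⟨-, rfl⟩ := c.mem_W.1 hy
        refine c.mem_W.2 ⟨hw, congrArg _ ((c.isCoding b).congr w hw v hv p fun z =>
          ⟨fun hz => (hvw z ?_).2 hz, fun hz => (hvw z ?_).1 hz⟩)⟩
        · exact SetDef.snd_mem_level (SetDef.mem_level_of_mem hz hwN)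
        · exact SetDef.snd_mem_level (SetDef.mem_level_of_mem hz hvN))
      v (h.mem_level_of_subset hv) hv w (h.mem_level_of_subset hw) hw (by
        intro z _
        rw [h.map_x]
        exact hvw z) _ (h.encPow_mem_level p.1 _) ((h.mem_map_valV hv).2 rfl)
    exact encPow_injective (c.gL_injective J) _ ((h.mem_map_valV hw).1 this).symm

/-- If the values of the arguments agree, then so do the values of terms with the same function
symbol. -/
theorem termL_func (h : c.IsImage θ θ' M J) {n : ℕ} (f : L.Functions n) (ts ts' : Fin n → L.Term κ.out)
    {v w : ZFSet.{u}} (hv : v ⊆ J c.Y) (hw : w ⊆ J c.Y)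
    (hvw : ∀ k, c.termL J (ts k) v = c.termL J (ts' k) w) :
    c.termL J (.func f ts) v = c.termL J (.func f ts') w := by
  have := h.transfer_card₂₄ (P := fun N a p q Y r s _ => ∀ v ∈ N, v ⊆ Y → ∀ w ∈ N, w ⊆ Y →
      (∀ k, ∃ y ∈ N, ZFSet.pair a (ZFSet.pair v y) ∈ p k ∧
        ZFSet.pair a (ZFSet.pair w y) ∈ q k) →
      ∀ y ∈ N, ZFSet.pair a (ZFSet.pair v y) ∈ r → ZFSet.pair a (ZFSet.pair w y) ∈ s)
    (.all (.imp (.subset _ _) (.all (.imp (.subset _ _) (.imp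
      (.forallFin fun k => .ex (.and (.tripleMem _ _ _ _) (.tripleMem _ _ _ _)))
      (.all (.imp (.tripleMem _ _ _ _) (.tripleMem _ _ _ _))))))))
    (fun k => h.valT (ts k)) (fun k => h.valT (ts' k)) h.Y (h.valT (.func f ts))
    (h.valT (.func f ts')) h.Y (by
      intro b hb v _ hv w _ hw hvw y _ hy
      obtain ⟨b, rfl⟩ := (c.mem_iff b).1 hb
      obtain ⟨-, rfl⟩ := c.mem_W.1 hy
      refine c.mem_W.2 ⟨hw, congrArg _ (congrArg (Language.Structure.funMap f) (funext fun k => ?_))⟩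
      obtain ⟨y, -, h1, h2⟩ := hvw k
      exact c.g_inj b ((c.mem_W.1 h2).2.trans (c.mem_W.1 h1).2.symm))
    v (h.mem_level_of_subset hv) hv w (h.mem_level_of_subset hw) hw
    (fun k => ⟨_, h.encPow_mem_level 0 _, (h.mem_map_valT hv).2 rfl,
      (h.mem_map_valT hw).2 (congrArg _ (hvw k).symm)⟩) _ (h.encPow_mem_level 0 _)
    ((h.mem_map_valT hv).2 rfl)
  exact c.gL_injective J ((h.mem_map_valT hw).1 this).symm

/-- If the values of the arguments agree, then so do the truth values of atomic formulas with the same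
relation symbol. -/
theorem mem_map_S_rel_iff (h : c.IsImage θ θ' M J) {n : ℕ} (r : L.Relations n)
    (ts ts' : Fin n → L.Term κ.out) {v w : ZFSet.{u}} (hv : v ⊆ J c.Y) (hw : w ⊆ J c.Y)
    (hvw : ∀ k, c.termL J (ts k) v = c.termL J (ts' k) w) :
    ZFSet.pair (cardSet κ) (ZFSet.pair v (c.code ⟨.rel r ts, trivial⟩)) ∈ J c.S ↔
      ZFSet.pair (cardSet κ) (ZFSet.pair w (c.code ⟨.rel r ts', trivial⟩)) ∈ J c.S := by
  have := h.transfer_card₂₄ (P := fun N a p q Y r s S => ∀ v ∈ N, v ⊆ Y → ∀ w ∈ N, w ⊆ Y →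
      (∀ k, ∃ y ∈ N, ZFSet.pair a (ZFSet.pair v y) ∈ p k ∧
        ZFSet.pair a (ZFSet.pair w y) ∈ q k) →
      (ZFSet.pair a (ZFSet.pair v r) ∈ S ↔ ZFSet.pair a (ZFSet.pair w s) ∈ S))
    (.all (.imp (.subset _ _) (.all (.imp (.subset _ _) (.imp
      (.forallFin fun k => .ex (.and (.tripleMem _ _ _ _) (.tripleMem _ _ _ _)))
      (.iff (.tripleMem _ _ _ _) (.tripleMem _ _ _ _)))))))
    (fun k => h.valT (ts k)) (fun k => h.valT (ts' k)) h.Y (h.code_mem ⟨.rel r ts, trivial⟩)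
    (h.code_mem ⟨.rel r ts', trivial⟩) h.S (by
      intro b hb v _ hv w _ hw hvw
      obtain ⟨b, rfl⟩ := (c.mem_iff b).1 hb
      refine c.mem_S.trans (Iff.trans ?_ c.mem_S.symm)
      refine and_congr (iff_of_true hv hw) (iff_of_eq (congrArg (Language.Structure.RelMap r)
        (funext fun k => ?_)))
      obtain ⟨y, -, h1, h2⟩ := hvw k
      exact c.g_inj b ((c.mem_W.1 h1).2.trans (c.mem_W.1 h2).2.symm))
    v (h.mem_level_of_subset hv) hv w (h.mem_level_of_subset hw) hw
    (fun k => ⟨_, h.encPow_mem_level 0 _, (h.mem_map_valT hv).2 rfl,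
      (h.mem_map_valT hw).2 (congrArg _ (hvw k).symm)⟩)
  rwa [h.map_code, h.map_code] at this

theorem mem_map_S_eq_iff (h : c.IsImage θ θ' M J) (t s : L.Term κ.out) {v : ZFSet.{u}}
    (hv : v ⊆ J c.Y) :
    ZFSet.pair (cardSet κ) (ZFSet.pair v (c.code ⟨.eq t s, trivial⟩)) ∈ J c.S ↔
      c.termL J t v = c.termL J s v := by
  have := h.transfer_card₂₄ (α := Unit) (P := fun N a p q Y r S _ => ∀ v ∈ N, v ⊆ Y →
      ((∀ y ∈ N, ZFSet.pair a (ZFSet.pair v y) ∈ p () → ZFSet.pair a (ZFSet.pair v y) ∈ q ()) ↔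
        ZFSet.pair a (ZFSet.pair v r) ∈ S))
    (.all (.imp (.subset _ _) (.iff (.all (.imp (.tripleMem _ _ _ _) (.tripleMem _ _ _ _)))
      (.tripleMem _ _ _ _))))
    (fun _ => h.valT t) (fun _ => h.valT s) h.Y (h.code_mem ⟨.eq t s, trivial⟩) h.S h.Y (by
      intro b hb v _ hv
      obtain ⟨b, rfl⟩ := (c.mem_iff b).1 hb
      refine Iff.trans ?_ c.mem_S.symm
      constructor
      · intro H
        have ht := c.mem_W (a := b) (i := 0) (f := fun a v => t.realize (M := c.A a) fun y =>
          c.asg a v (0, y)) (v := v) |>.2 ⟨hv, rfl⟩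
        exact ⟨hv, (c.g_inj b (c.mem_W.1 (H _ (SetDef.snd_mem_level (SetDef.snd_mem_level
          (SetDef.mem_level_of_mem ht (h.subset (h.valT t))))) ht)).2).symm⟩
      · intro H y _ hy
        obtain ⟨-, rfl⟩ := c.mem_W.1 hy
        exact c.mem_W.2 ⟨hv, congrArg (c.g b) H.2.symm⟩) v (h.mem_level_of_subset hv) hv
  rw [h.map_code] at this
  rw [← this]
  constructor
  · intro H
    exact c.gL_injective J ((h.mem_map_valT hv).1 (H _ (h.encPow_mem_level 0 _)
      ((h.mem_map_valT hv).2 rfl))).symm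
  · intro H y _ hy
    rw [h.mem_map_valT hv] at hy ⊢
    rw [← hy, H]

/-- The clause of the satisfaction relation for formulas `t ε X` and `X ε Y`. -/
theorem mem_map_S_mem_iff (h : c.IsImage θ θ' M J) (φ : {φ : RawForm L κ // φ.IsFormula ⊤ κ κ})
    {i : ℕ} {f : ∀ a, ZFSet.{u} → IterPow (c.A a) i} {f' : ∀ a, ZFSet.{u} → IterPow (c.A a) (i + 1)}
    (hf : c.W i f ∈ M) (hf' : c.W (i + 1) f' ∈ M)
    (hφ : ∀ a v, φ.1.Realize (c.A a) (c.asg a v) ↔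
      f a v ∈ (show Set (IterPow (c.A a) i) from f' a v))
    {v : ZFSet.{u}} (hv : v ⊆ J c.Y) :
    ZFSet.pair (cardSet κ) (ZFSet.pair v (c.code φ)) ∈ J c.S ↔
      c.val J i (J (c.W i f)) v ∈
        (show Set (IterPow (c.Limit J) i) from c.val J (i + 1) (J (c.W (i + 1) f')) v) := by
  have := h.transfer_card₂₄ (α := Unit) (P := fun N a p q Y r S _ => ∀ v ∈ N, v ⊆ Y →
      ((∃ y ∈ N, ∃ z ∈ N, ZFSet.pair a (ZFSet.pair v y) ∈ p () ∧
          ZFSet.pair a (ZFSet.pair v z) ∈ q () ∧ y ∈ z) ↔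
        ZFSet.pair a (ZFSet.pair v r) ∈ S))
    (.all (.imp (.subset _ _) (.iff (.ex (.ex (.and (.tripleMem _ _ _ _)
      (.and (.tripleMem _ _ _ _) (.mem _ _))))) (.tripleMem _ _ _ _))))
    (fun _ => hf) (fun _ => hf') h.Y (h.code_mem φ) h.S h.Y (by
      intro b hb v _ hv
      obtain ⟨b, rfl⟩ := (c.mem_iff b).1 hb
      refine Iff.trans ?_ c.mem_S.symm
      constructor
      · rintro ⟨y, -, z, -, hy, hz, hyz⟩
        obtain ⟨-, rfl⟩ := c.mem_W.1 hy
        obtain ⟨-, rfl⟩ := c.mem_W.1 hz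
        exact ⟨hv, (hφ b v).2 ((encPow_mem_iff (c.g_inj b)).1 hyz)⟩
      · rintro ⟨-, hr⟩
        have h1 := (c.mem_W (a := b) (f := f) (v := v)).2 ⟨hv, rfl⟩
        have h2 := (c.mem_W (a := b) (f := f') (v := v)).2 ⟨hv, rfl⟩
        exact ⟨_, SetDef.snd_mem_level (SetDef.snd_mem_level
          (SetDef.mem_level_of_mem h1 (h.subset hf))), _, SetDef.snd_mem_level
          (SetDef.snd_mem_level (SetDef.mem_level_of_mem h2 (h.subset hf'))), h1, h2,
          (encPow_mem_iff (c.g_inj b)).2 ((hφ b v).1 hr)⟩) v (h.mem_level_of_subset hv) hv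
  rw [h.map_code] at this
  rw [← this]
  constructor
  · rintro ⟨y, -, z, -, hy, hz, hyz⟩
    rw [h.mem_map_W hf hv] at hy
    rw [h.mem_map_W hf' hv] at hz
    subst hy hz
    exact (encPow_mem_iff (c.gL_injective J)).1 hyz
  · intro H
    exact ⟨_, h.encPow_mem_level _ _, _, h.encPow_mem_level _ _, (h.mem_map_W hf hv).2 rfl,
      (h.mem_map_W hf' hv).2 rfl, (encPow_mem_iff (c.gL_injective J)).2 H⟩

end IsImage

variable [Infinite κ.out]

/-- The code of an assignment of `y` to the first `n` variables. -/
noncomputable def tup {n : ℕ} (y : Fin n → c.Limit J) : ZFSet.{u} :=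
  Classical.epsilon fun v => v ⊆ J c.Y ∧ ∀ k : Fin n, c.asgL J v (0, HOForm.vr k) = y k

/-- The formula `R x₀ … xₙ₋₁`, with its membership in the logic. -/
noncomputable def relVars {n : ℕ} (R : L.Relations n) : {φ : RawForm L κ // φ.IsFormula ⊤ κ κ} :=
  ⟨.rel R fun k => .var (HOForm.vr k), trivial⟩

/-- The interpretation of the symbols in the structure with index `κ` is read off from the image of
the evaluation of terms and from that of the satisfaction relation. -/
noncomputable instance : L.Structure (c.Limit J) where
  funMap f y := c.termL J (.func f fun k => .var (HOForm.vr k)) (c.tup J y)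
  RelMap R y := ZFSet.pair (cardSet κ) (ZFSet.pair (c.tup J y) (c.code (relVars R))) ∈ J c.S

namespace IsImage

variable {c J} {θ θ' : Ordinal.{u}} {M : ZFSet.{u}}

theorem tup_spec (h : c.IsImage θ θ' M J) {n : ℕ} (y : Fin n → c.Limit J) :
    c.tup J y ⊆ J c.Y ∧ ∀ k : Fin n, c.asgL J (c.tup J y) (0, HOForm.vr k) = y k := by
  classical
  refine Classical.epsilon_spec
    (p := fun v => v ⊆ J c.Y ∧ ∀ k : Fin n, c.asgL J v (0, HOForm.vr k) = y k) ?_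
  let w : ∀ p : ℕ × κ.out, IterPow (c.Limit J) p.1 := fun p => match p with
    | (0, z) => if hz : ∃ k : Fin n, HOForm.vr k = z then y hz.choose else Classical.arbitrary _
    | (i + 1, _) => Classical.arbitrary _
  obtain ⟨v, hv, hw⟩ := h.isCoding.exists_eq w
  refine ⟨v, hv, fun k => ?_⟩
  rw [hw]
  have hz : ∃ k' : Fin n, (HOForm.vr k' : κ.out) = HOForm.vr k := ⟨k, rfl⟩
  exact (dif_pos hz).trans (congrArg y (Fin.ext (HOForm.vr_inj.1 hz.choose_spec)))

theorem realize_term (h : c.IsImage θ θ' M J) (t : L.Term κ.out) {v : ZFSet.{u}} (hv : v ⊆ J c.Y) :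
    t.realize (M := c.Limit J) (fun y => c.asgL J v (0, y)) = c.termL J t v := by
  induction t with
  | var y => rfl
  | func f ts ih =>
    obtain ⟨h1, h2⟩ := h.tup_spec fun k => (ts k).realize (M := c.Limit J) fun y => c.asgL J v (0, y)
    exact h.termL_func f _ ts h1 hv fun k => (h2 k).trans (ih k)

/-- The image of the satisfaction relation is, at the index `κ`, the satisfaction relation of the
structure `c.Limit J`. -/
theorem mem_map_S_iff (h : c.IsImage θ θ' M J) (φ : RawForm L κ) (hφ : φ.IsFormula ⊤ κ κ)
    {v : ZFSet.{u}} (hv : v ⊆ J c.Y) :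
    ZFSet.pair (cardSet κ) (ZFSet.pair v (c.code ⟨φ, hφ⟩)) ∈ J c.S ↔
      φ.Realize (c.Limit J) (c.asgL J v) := by
  have hex : ∀ (φ : RawForm L κ) (hφ : φ.IsFormula ⊤ κ κ) (B : Set (ℕ × κ.out))
      (hψ : (HOForm.ex B φ).IsFormula ⊤ κ κ), (∀ v ⊆ J c.Y,
        (ZFSet.pair (cardSet κ) (ZFSet.pair v (c.code ⟨φ, hφ⟩)) ∈ J c.S ↔
          φ.Realize (c.Limit J) (c.asgL J v))) → ∀ v ⊆ J c.Y,
      (ZFSet.pair (cardSet κ) (ZFSet.pair v (c.code ⟨.ex B φ, hψ⟩)) ∈ J c.S ↔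
        (HOForm.ex B φ).Realize (c.Limit J) (c.asgL J v)) := by
    intro φ hφ B hψ ih v hv
    rw [h.mem_map_S_ex_iff hψ.1 ⟨φ, hφ⟩ ⟨.ex B φ, hψ⟩ rfl hv, h.isCoding.realize_ex hv
      (b := c.sub (c.cV '' B)) fun p => c.o_mem_sub.trans c.cV.injective.mem_set_image]
    exact exists_congr fun w => and_congr_right fun hw => and_congr_right fun _ => ih w hw
  induction φ generalizing v with
  | eq t s =>
    refine (h.mem_map_S_eq_iff t s hv).trans ?_
    rw [← h.realize_term t hv, ← h.realize_term s hv]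
    rfl
  | rel r ts =>
    obtain ⟨h1, h2⟩ := h.tup_spec fun k => (ts k).realize (M := c.Limit J) fun y =>
      c.asgL J v (0, y)
    exact h.mem_map_S_rel_iff r ts _ hv h1 fun k => (h.realize_term (ts k) hv).symm.trans (h2 k).symm
  | memTerm t X =>
    refine (h.mem_map_S_mem_iff ⟨.memTerm t X, hφ⟩ (h.valT t) (h.valV (1, X))
      (fun _ _ => Iff.rfl) hv).trans ?_
    change c.termL J t v ∈ (show Set (c.Limit J) from c.asgL J v (1, X)) ↔ _
    rw [← h.realize_term t hv]
    rfl
  | memVar i X Y =>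
    exact h.mem_map_S_mem_iff ⟨.memVar i X Y, hφ⟩ (h.valV (i + 1, X)) (h.valV (i + 2, Y))
      (fun _ _ => Iff.rfl) hv
  | neg φ ih =>
    exact (h.mem_map_S_neg_iff ⟨φ, hφ⟩ ⟨.neg φ, hφ⟩ (fun _ _ => Iff.rfl) hv).trans
      (not_congr (ih hφ hv))
  | conj I φ ih =>
    exact (h.mem_map_S_conj_iff hφ.1 ⟨.conj I φ, hφ⟩ (fun k => ⟨φ k, hφ.2.2 k⟩)
      (fun _ _ => Iff.rfl) hv).trans (forall_congr' fun k => ih k (hφ.2.2 k) hv)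
  | disj I φ ih =>
    have h1 := h.mem_map_S_neg_iff ⟨.conj I fun k => (φ k).neg, hφ⟩ ⟨.disj I φ, hφ⟩
      (fun a v => by simp [HOForm.Realize]) hv
    have h2 := h.mem_map_S_conj_iff hφ.1 ⟨.conj I fun k => (φ k).neg, hφ⟩
      (fun k => ⟨(φ k).neg, hφ.2.2 k⟩) (fun _ _ => Iff.rfl) hv
    rw [h1, h2, not_forall]
    exact exists_congr fun k => (not_congr ((h.mem_map_S_neg_iff ⟨φ k, hφ.2.2 k⟩
      ⟨.neg (φ k), hφ.2.2 k⟩ (fun _ _ => Iff.rfl) hv).trans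
        (not_congr (ih k (hφ.2.2 k) hv)))).trans not_not
  | ex B φ ih => exact hex φ hφ.2.2 B hφ (fun v hv => ih hφ.2.2 hv) v hv
  | all B φ ih =>
    have h1 := h.mem_map_S_neg_iff ⟨.ex B φ.neg, hφ⟩ ⟨.all B φ, hφ⟩
      (fun a v => by simp [HOForm.Realize]) hv
    rw [h1, hex φ.neg hφ.2.2 B hφ (fun v hv => (h.mem_map_S_neg_iff ⟨φ, hφ.2.2⟩
      ⟨.neg φ, hφ.2.2⟩ (fun _ _ => Iff.rfl) hv).trans (not_congr (ih hφ.2.2 hv))) v hv]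
    simp [HOForm.Realize]

/-- A sentence that holds in the structures with index above its code holds in `c.Limit J`. -/
theorem realize_limit (h : c.IsImage θ θ' M J) {φ : RawForm L κ} (hφ : φ.IsFormula ⊤ κ κ)
    (H : ∀ a, c.code ⟨φ, hφ⟩ ∈ c.o a → ∀ v, φ.Realize (c.A a) v) (w) :
    φ.Realize (c.Limit J) w := by
  obtain ⟨v, hv, rfl⟩ := h.isCoding.exists_eq w
  rw [← h.mem_map_S_iff φ hφ hv]
  have := h.transfer_card₄ (P := fun N a Y r S _ => r ∈ a → ∀ v ∈ N, v ⊆ Y →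
      ZFSet.pair a (ZFSet.pair v r) ∈ S)
    (.imp (.mem _ _) (.all (.imp (.subset _ _) (.tripleMem _ _ _ _))))
    h.Y (h.code_mem ⟨φ, hφ⟩) h.S h.Y (by
      intro b hb hr v _ hv
      obtain ⟨b, rfl⟩ := (c.mem_iff b).1 hb
      exact c.mem_S.2 ⟨hv, H b hr _⟩)
  rw [h.map_code] at this
  exact this (c.o_mem _) v (h.mem_level_of_subset hv) hv

end IsImage

end ModelSeq

/-! ### Compactness from weak extendibility -/

theorem IsWeaklyExtendible.mem_WCS {κ : Cardinal.{u}} (h : IsWeaklyExtendible κ) (hκ : ℵ₀ ≤ κ) :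
    κ ∈ WCS ⊤ κ κ := by
  refine ⟨h.aleph0_lt hκ, fun L hL T hT hsat => ?_⟩
  have hpow : ∀ c < κ, κ ^ c ≤ κ := fun c hc => h.power_le hκ hc
  have hout : #κ.out ≤ κ := (mk_out κ).le
  have : Infinite κ.out := by rwa [Cardinal.infinite_iff, mk_out]
  obtain ⟨o, o_inj, hmem⟩ := exists_code κ.out
  rw [mk_out] at hmem
  obtain ⟨cF⟩ : Nonempty ({φ : RawForm L κ // φ.IsFormula ⊤ κ κ} ↪ κ.out) :=
    Cardinal.le_def _ _ |>.1 (by rw [mk_out]; exact HOForm.mk_isFormula_le hκ hpow hL hout)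
  have hvar : #(ℕ × κ.out) ≤ κ := by
    simpa using Cardinal.mul_le_of_le hκ hκ le_rfl
  obtain ⟨cV⟩ : Nonempty (ℕ × κ.out ↪ κ.out) :=
    Cardinal.le_def _ _ |>.1 (by rwa [mk_out])
  -- The structure with index `a` is a model of the sentences of `T` with codes below `a`.
  have hA : ∀ a, IsSatisfiableTheory {φ ∈ T | ∃ hφ, o (cF ⟨φ, hφ⟩) ∈ o a} := by
    intro a
    refine hsat _ (fun φ hφ => hφ.1) ?_
    have hle : lift.{u + 1} #{φ ∈ T | ∃ hφ, o (cF ⟨φ, hφ⟩) ∈ o a} ≤ #(o a) := by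
      rw [← Cardinal.lift_id'.{u, u + 1} #(o a)]
      refine Cardinal.lift_mk_le_lift_mk_of_injective
        (f := fun φ => (⟨o (cF ⟨φ.1, φ.2.2.choose⟩), φ.2.2.choose_spec⟩ : o a)) ?_
      intro φ ψ hφψ
      exact Subtype.ext (Subtype.mk.inj (cF.injective (o_inj (congrArg Subtype.val hφψ))))
    rw [ZFSet.cardinalMk_coe_sort, lift_le] at hle
    refine hle.trans_lt ?_
    have ha := (hmem (o a)).2 ⟨a, rfl⟩
    rw [cardSet, Ordinal.mem_toZFSet_iff] at ha
    obtain ⟨b, hb, hab⟩ := ha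
    rw [← hab, Ordinal.card_toZFSet]
    exact lt_ord.1 hb
  choose A inst ne hA using hA
  have hg : ∀ a, ∃ g : A a → ZFSet.{u}, g.Injective := fun a =>
    (exists_code (A a)).imp fun _ h => h.1
  choose g g_inj using hg
  let c : ModelSeq κ L := ⟨o, o_inj, hmem, cF, cV, A, inst, ne, g, g_inj⟩
  obtain ⟨θ, θ', M, J, R, hM⟩ := h.exists_reflection hκ
    (ι := (ULift.{u} ℕ ⊕ ULift.{u} Bool) ⊕ (ℕ × κ.out ⊕ L.Term κ.out) ⊕
      {I : Set κ.out // #I < κ})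
    (Sum.elim (Sum.elim (fun i => c.Q i.down) fun b => bif b.down then c.Y else c.S)
      (Sum.elim (Sum.elim c.valV c.valT) fun I => c.sub I.1)) (by
      simp only [mk_sum, lift_id]
      refine add_le_of_le hκ (add_le_of_le hκ ?_ ?_) (add_le_of_le hκ (add_le_of_le hκ hvar
        (HOForm.mk_term_le hκ hL hout)) (HOForm.mk_subset_lt_le hκ hpow hout))
      · simpa using hκ
      · exact mk_le_aleph0.trans hκ)
  have hc : c.IsImage θ θ' M J :=
    { toReflection := R
      isRegular := h.isRegular hκ
      Q := fun i => hM (.inl (.inl ⟨i⟩))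
      Y := hM (.inl (.inr ⟨true⟩))
      S := hM (.inl (.inr ⟨false⟩))
      valV := fun p => hM (.inr (.inl (.inl p)))
      valT := fun t => hM (.inr (.inl (.inr t)))
      sub := fun I hI => hM (.inr (.inr ⟨I, hI⟩)) }
  have : Nonempty (c.Limit J) := hc.nonempty_limit (HOForm.vr 0)
  exact ⟨c.Limit J, inferInstance, inferInstance, fun φ hφ w => hc.realize_limit (hT φ hφ).1
    (fun a ha v => hA a φ ⟨hφ, _, ha⟩ v) w⟩

theorem theorem2p2 (κ : Cardinal.{u}) (hκ : ℵ₀ ≤ κ) :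
    List.TFAE
      [(κ : WithTop Cardinal.{u}) = wcnII κ ℵ₀,
       (κ : WithTop Cardinal.{u}) = wcnHO κ κ,
       IsWeaklyExtendible κ] := by
  rw [wcnII, wcnHO, coe_eq_wcn_iff_mem aleph0_pos, coe_eq_wcn_iff_mem (aleph0_pos.trans_le hκ)]
  tfae_have 1 → 3 := isWeaklyExtendible_of_mem_WCS
  tfae_have 3 → 2 := fun h => h.mem_WCS hκ
  tfae_have 2 → 1 := fun h => WCS_subset_of_le le_top hκ h
  tfae_finish
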